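/- Let $(M,g)$ be a smooth Lorentz 4-manifold of signature $(-,+,+,+)$ which is a Yang pure space, i.e. its Ricci tensor satisfies $\nabla_aR_{bc}=\nabla_bR_{ac}$ (sign convention: $R_{ab}$ is positive on round spheres). Suppose that it is generated by a self-interacting scalar field: there are a smooth function $\phi:M\to\mathbb R$ and a potential $V:\mathbb R\to\mathbb R$ such that Einstein's equation $$R_{ab}-\tfrac12Rg_{ab}=\nabla_a\phi\nabla_b\phi-g_{ab}\bigl(\tfrac12\nabla_c\phi\nabla^c\phi-V(\phi)\bigr)$$ holds on $M$, and suppose that $\nabla_a\phi\nabla^a\phi\neq0$ everywhere. Then the Ricci scalar $R$ is locally constant, and for every $p\in M$, with $\epsilon=\operatorname{sgn}(\nabla_a\phi\nabla^a\phi)(p)\in\{1,-1\}$ and $R=R(p)$, there are smooth coordinates $(u,x,y,z)$ on a neighbourhood of $p$, constants $k\in\{-1,0,1\}$ and $a\ne0$, and a function $A(u)>0$ such that on this neighbourhood $$ds^2=\epsilon\,du^2+A(u)^2\Bigl(1+\tfrac k4(x^2+y^2-\epsilon z^2)\Bigr)^{-2}(dx^2+dy^2-\epsilon\,dz^2),$$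 $\phi=\phi(u)$ is a function of $u$ alone, and $$\frac{d\phi}{du}=\frac{a}{A(u)^2},\qquad V(\phi)=\frac{\epsilon a^2}{4A(u)^4}-\frac R4 .$$ Moreover: * if $R=0$, the coordinate $u$ can be translated so that, for some constants $a_0,c$ and a sign $\sigma\in\{1,-1\}$, $A^2=\epsilon ku^2+a_0u$, $a=\sigma a_0$ and $\phi=\sigma\ln\left|\dfrac{u}{\epsilon ku+a_0}\right|+c$; * if $-\epsilon R>0$, there are real constants $a_0,a_1$ with $A^2=\dfrac{6k}{R}+a_0e^{\sqrt{-\epsilon R/3}\,u}+a_1e^{-\sqrt{-\epsilon R/3}\,u}$ and $a^2=-\dfrac{12\epsilon k^2}{R}+\dfrac43\epsilon R\,a_0a_1$; * if $\epsilon R>0$ (the exponentials being then complex conjugate), there are real constants $b_0,b_1$ with $A^2=\dfrac{6k}{R}+b_0\cos\bigl(\sqrt{\epsilon R/3}\,u\bigr)+b_1\sin\bigl(\sqrt{\epsilon R/3}\,u\bigr)$ and $a^2=-\dfrac{12\epsilon k^2}{R}+\dfrac13\epsilon R\,(b_0^2+b_1^2)$. -/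

import Mathlib

open scoped Manifold ContDiff

noncomputable section

namespace YangPure

/-- The model space of coordinates. -/
abbrev E4 : Type := EuclideanSpace ℝ (Fin 4)

/-! ### Tensor calculus in a coordinate domain of `ℝ⁴` -/

/-- Coordinate partial derivative `∂ᵢ f` at `y`. -/
def pd (i : Fin 4) (f : E4 → ℝ) (y : E4) : ℝ :=
  fderiv ℝ f y (EuclideanSpace.single i 1)

/-- Christoffel symbols `Γᵏᵢⱼ` of the metric components `G`. -/
def christoffel (G : E4 → Matrix (Fin 4) (Fin 4) ℝ) (k i j : Fin 4) (y : E4) : ℝ :=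
  (1 / 2) * ∑ l, (G y)⁻¹ k l *
    (pd i (fun z => G z l j) y + pd j (fun z => G z l i) y - pd l (fun z => G z i j) y)

/-- Riemann tensor `Rˡₖᵢⱼ = ∂ᵢ Γˡⱼₖ - ∂ⱼ Γˡᵢₖ + Γˡᵢₘ Γᵐⱼₖ - Γˡⱼₘ Γᵐᵢₖ`. -/
def riemann (G : E4 → Matrix (Fin 4) (Fin 4) ℝ) (l k i j : Fin 4) (y : E4) : ℝ :=
  pd i (christoffel G l j k) y - pd j (christoffel G l i k) y
    + ∑ m, (christoffel G l i m y * christoffel G m j k y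
        - christoffel G l j m y * christoffel G m i k y)

/-- Ricci tensor `Rₖⱼ = Rⁱₖᵢⱼ` (positive on round spheres). -/
def ricci (G : E4 → Matrix (Fin 4) (Fin 4) ℝ) (k j : Fin 4) (y : E4) : ℝ :=
  ∑ i, riemann G i k i j y

/-- Ricci scalar `gⁱʲ Rᵢⱼ`. -/
def coordScalar (G : E4 → Matrix (Fin 4) (Fin 4) ℝ) (y : E4) : ℝ :=
  ∑ i, ∑ j, (G y)⁻¹ i j * ricci G i j y

/-- Covariant derivative `∇ₐ R_bc` of the Ricci tensor. -/
def covRicci (G : E4 → Matrix (Fin 4) (Fin 4) ℝ) (a b c : Fin 4) (y : E4) : ℝ :=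
  pd a (ricci G b c) y
    - ∑ d, (christoffel G d a b y * ricci G d c y + christoffel G d a c y * ricci G b d y)

/-- `∇ₐψ ∇ᵃψ` in coordinates. -/
def coordGradSq (G : E4 → Matrix (Fin 4) (Fin 4) ℝ) (ψ : E4 → ℝ) (y : E4) : ℝ :=
  ∑ i, ∑ j, (G y)⁻¹ i j * pd i ψ y * pd j ψ y

/-- `8π T_ab = ∂ₐψ ∂_bψ - g_ab (½ ∂_cψ ∂ᶜψ - V(ψ))`, the energy-momentum tensor of a scalar
field `ψ` with self-interaction potential `V`. -/
def scalarStress (G : E4 → Matrix (Fin 4) (Fin 4) ℝ) (V : ℝ → ℝ) (ψ : E4 → ℝ)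
    (a b : Fin 4) (y : E4) : ℝ :=
  pd a ψ y * pd b ψ y - G y a b * ((1 / 2) * coordGradSq G ψ y - V (ψ y))

/-! ### Lorentz 4-manifolds -/

/-- A bilinear form on a 4-dimensional space is Lorentzian, of signature `(-,+,+,+)`, if it has a
pseudo-orthonormal basis. -/
def IsLorentzForm {T : Type*} [AddCommGroup T] [Module ℝ T] (b : T → T → ℝ) : Prop :=
  ∃ v : Module.Basis (Fin 4) ℝ T, ∀ i j,
    b (v i) (v j) = if i = j then (if i = 0 then -1 else 1) else 0

section Manifold

variable {M : Type*} [TopologicalSpace M] [ChartedSpace E4 M]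

/-- Components `g(∂ᵢ, ∂ⱼ)` of a tensor field `g` in the coordinates given by a chart `e`. -/
def chartMetric
    (g : ∀ x : M, TangentSpace (𝓡 4) x →L[ℝ] TangentSpace (𝓡 4) x →L[ℝ] ℝ)
    (e : OpenPartialHomeomorph M E4) (y : E4) : Matrix (Fin 4) (Fin 4) ℝ :=
  Matrix.of fun i j =>
    g (e.symm y)
      (mfderiv (𝓡 4) (𝓡 4) e.symm y (EuclideanSpace.single i (1 : ℝ) : E4))
      (mfderiv (𝓡 4) (𝓡 4) e.symm y (EuclideanSpace.single j (1 : ℝ) : E4))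

/-- `g` is a smooth Lorentz metric on the 4-manifold `M`. -/
structure IsLorentzMetric
    (g : ∀ x : M, TangentSpace (𝓡 4) x →L[ℝ] TangentSpace (𝓡 4) x →L[ℝ] ℝ) : Prop where
  symm : ∀ (x : M) (v w : TangentSpace (𝓡 4) x), g x v w = g x w v
  lorentz : ∀ x : M, IsLorentzForm (fun v w : TangentSpace (𝓡 4) x => g x v w)
  smooth : ∀ e ∈ IsManifold.maximalAtlas (𝓡 4) ∞ M, ∀ i j : Fin 4,
    ContDiffOn ℝ ∞ (fun y => chartMetric g e y i j) e.target

/-- `(M, g)` is a Yang pure space: a Lorentz 4-manifold with `∇ₐ R_bc = ∇_b R_ac`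
(in every coordinate system). -/
structure IsYangPureSpace
    (g : ∀ x : M, TangentSpace (𝓡 4) x →L[ℝ] TangentSpace (𝓡 4) x →L[ℝ] ℝ) : Prop
    extends IsLorentzMetric g where
  yang : ∀ e ∈ IsManifold.maximalAtlas (𝓡 4) ∞ M, ∀ y ∈ e.target, ∀ a b c : Fin 4,
    covRicci (chartMetric g e) a b c y = covRicci (chartMetric g e) b a c y

/-- Einstein's equation `R_ab - ½ R g_ab = 8π T_ab`, with the energy-momentum tensor of the scalar
field `φ` with potential `V` as source (in every coordinate system). -/
def IsGeneratedByScalarField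
    (g : ∀ x : M, TangentSpace (𝓡 4) x →L[ℝ] TangentSpace (𝓡 4) x →L[ℝ] ℝ)
    (V : ℝ → ℝ) (φ : M → ℝ) : Prop :=
  ∀ e ∈ IsManifold.maximalAtlas (𝓡 4) ∞ M, ∀ y ∈ e.target, ∀ a b : Fin 4,
    ricci (chartMetric g e) a b y
        - (1 / 2) * coordScalar (chartMetric g e) y * chartMetric g e y a b
      = scalarStress (chartMetric g e) V (fun z => φ (e.symm z)) a b y

/-- The Ricci scalar as a function on `M`. -/
def scalarCurvature
    (g : ∀ x : M, TangentSpace (𝓡 4) x →L[ℝ] TangentSpace (𝓡 4) x →L[ℝ] ℝ) (p : M) : ℝ :=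
  coordScalar (chartMetric g (chartAt E4 p)) (chartAt E4 p p)

/-- `∇ₐφ ∇ᵃφ` as a function on `M`. -/
def gradSq
    (g : ∀ x : M, TangentSpace (𝓡 4) x →L[ℝ] TangentSpace (𝓡 4) x →L[ℝ] ℝ)
    (φ : M → ℝ) (p : M) : ℝ :=
  coordGradSq (chartMetric g (chartAt E4 p)) (fun z => φ ((chartAt E4 p).symm z))
    (chartAt E4 p p)

end Manifold

/-- The conformal factor `1 + (k/4)(x² + y² - ε z²)` in coordinates `(u, x, y, z)`. -/
def confFactor (ε k : ℝ) (y : E4) : ℝ :=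
  1 + k / 4 * (y 1 ^ 2 + y 2 ^ 2 - ε * y 3 ^ 2)

/-- Components, in coordinates `(u, x, y, z)`, of
`ε du² + A(u)² (1 + (k/4)(x² + y² - ε z²))⁻² (dx² + dy² - ε dz²)`. -/
def lineElement (ε k : ℝ) (A : ℝ → ℝ) (y : E4) : Matrix (Fin 4) (Fin 4) ℝ :=
  Matrix.diagonal ![ε,
    A (y 0) ^ 2 / confFactor ε k y ^ 2,
    A (y 0) ^ 2 / confFactor ε k y ^ 2,
    -ε * (A (y 0) ^ 2 / confFactor ε k y ^ 2)]

end YangPure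

end

/-! Write N = ∇φ², W = V(φ), H = ∇∇φ. Tracing Einstein's equation in dimension four gives R = N - 4W
and Ric = dφ⊗dφ - W g. So W is smooth although V is an arbitrary function, and the contracted
Bianchi identity becomes dW = -□φ dφ (`potential_grad`).

Yang's equation is then algebraic in H. Its two contractions with the metric and with ∇φ determine H
completely: H = μ(3 dφ⊗dφ - N g) with μ = -□φ/N (`hess_eq`). Hence dN = 4Nμ dφ and dW = Nμ dφ, which
makes R = N - 4W locally constant. The Ricci identity applied to dφ makes dμ a multiple of dφ, with
an explicit factor (`hessCoeff_grad_aux`), and gives the curvature on ∇φ.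

What remains of the curvature is that of a three-dimensional space. After subtraction of an explicit
model built from g and dφ, one has an algebraic curvature tensor that is Ricci-flat and annihilated
by the non-null covector dφ. It is zero because Ricci determines curvature in dimension three
(`curvature_eq_zero`, `lowRiemann_eq`).

By the Gauss equation the leaves of constant φ have curvature Nμ² - (N + 2W)/6, a constant multiple
of |∇φ|; a scaling α turns this into kγ, with γ = |∇φ|/α and k ∈ {-1, 0, 1}. The squared warping
function is A² = 1/γ = α/|∇φ|.

To find coordinates without the classification of space forms, one looks for functions f with df ⊥
dφ which restrict to the leaves as ambient linear functions restrict to a quadric. They solve an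
overdetermined linear system whose curvature vanishes when df ⊥ dφ, a condition that the system
propagates, so a Frobenius theorem applies (`exists_solution`, `exists_leaf_functions`). The
quantity ⟨df₁, df₂⟩/γ + k f₁f₂ is constant; thus three solutions with orthonormal initial data have
the inner products of quadric coordinates, and stereographic projection gives x, y, z. The form
dφ/|∇φ| is closed and supplies u.

Finally B = A² satisfies B'' = 2εk - (εR/3)B with first integral B'² = α² + 4εkB - (εR/3)B²
(`WarpODE`). Solving it in the three cases for the sign of εR yields the formulas for A², and the
first integral yields those for a = α. -/

noncomputable section

namespace YangPure

open Topology

/-! ### Partial derivatives -/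

/-- `f` is differentiable at `q` with partial derivatives `f'`. -/
def HasGrad (f : E4 → ℝ) (f' : Fin 4 → ℝ) (q : E4) : Prop :=
  DifferentiableAt ℝ f q ∧ ∀ i, pd i f q = f' i

lemma DifferentiableAt.hasGrad {f : E4 → ℝ} {q : E4} (h : DifferentiableAt ℝ f q) :
    HasGrad f (fun i => pd i f q) q := ⟨h, fun _ => rfl⟩

namespace HasGrad

variable {f g : E4 → ℝ} {f' g' : Fin 4 → ℝ} {q : E4}

lemma congr_grad (hf : HasGrad f f' q) (h : ∀ i, f' i = g' i) : HasGrad f g' q :=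
  ⟨hf.1, fun i => (hf.2 i).trans (h i)⟩

lemma congr_of_eventuallyEq (hf : HasGrad f f' q) (h : g =ᶠ[𝓝 q] f) : HasGrad g f' q :=
  ⟨h.differentiableAt_iff.2 hf.1, fun i => by rw [← hf.2 i, pd, pd, h.fderiv_eq]⟩

lemma const (c : ℝ) (q : E4) : HasGrad (fun _ => c) (fun _ => 0) q :=
  ⟨differentiableAt_const c, fun i => by simp [pd]⟩

lemma add (hf : HasGrad f f' q) (hg : HasGrad g g' q) :
    HasGrad (fun y => f y + g y) (fun i => f' i + g' i) q :=
  ⟨hf.1.add hg.1, fun i => by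
    beta_reduce; rw [← hf.2 i, ← hg.2 i, pd, fderiv_fun_add hf.1 hg.1]; rfl⟩

lemma neg (hf : HasGrad f f' q) : HasGrad (fun y => -f y) (fun i => -f' i) q :=
  ⟨hf.1.neg, fun i => by beta_reduce; rw [← hf.2 i, pd, fderiv_fun_neg]; rfl⟩

lemma sub (hf : HasGrad f f' q) (hg : HasGrad g g' q) :
    HasGrad (fun y => f y - g y) (fun i => f' i - g' i) q :=
  ⟨hf.1.sub hg.1, fun i => by
    beta_reduce; rw [← hf.2 i, ← hg.2 i, pd, fderiv_fun_sub hf.1 hg.1]; rfl⟩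

lemma mul (hf : HasGrad f f' q) (hg : HasGrad g g' q) :
    HasGrad (fun y => f y * g y) (fun i => f' i * g q + f q * g' i) q :=
  ⟨hf.1.mul hg.1, fun i => by
    beta_reduce; rw [← hf.2 i, ← hg.2 i, pd, fderiv_fun_mul hf.1 hg.1]
    simp [pd]; ring⟩

lemma const_mul (c : ℝ) (hf : HasGrad f f' q) :
    HasGrad (fun y => c * f y) (fun i => c * f' i) q :=
  ((const c q).mul hf).congr_grad fun i => by simp

lemma sum {ι : Type*} {s : Finset ι} {F : ι → E4 → ℝ} {F' : ι → Fin 4 → ℝ}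
    (h : ∀ a ∈ s, HasGrad (F a) (F' a) q) :
    HasGrad (fun y => ∑ a ∈ s, F a y) (fun i => ∑ a ∈ s, F' a i) q :=
  ⟨DifferentiableAt.fun_sum fun a ha => (h a ha).1, fun i => by
    rw [pd, fderiv_fun_sum fun a ha => (h a ha).1, sum_apply]
    exact Finset.sum_congr rfl fun a ha => (h a ha).2 i⟩

lemma comp {u : ℝ → ℝ} {u' : ℝ} (hu : HasDerivAt u u' (f q)) (hf : HasGrad f f' q) :
    HasGrad (fun y => u (f y)) (fun i => u' * f' i) q :=
  ⟨hu.differentiableAt.comp q hf.1, fun i => by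
    have := (hu.comp_hasFDerivAt q hf.1.hasFDerivAt).fderiv
    beta_reduce; rw [← hf.2 i, pd, pd]
    change fderiv ℝ (u ∘ f) q _ = _
    rw [this]; simp⟩

lemma inv (hf : HasGrad f f' q) (h0 : f q ≠ 0) :
    HasGrad (fun y => (f y)⁻¹) (fun i => -f' i / f q ^ 2) q :=
  (comp (hasDerivAt_inv h0) hf).congr_grad fun i => by field_simp

lemma div (hf : HasGrad f f' q) (hg : HasGrad g g' q) (h0 : g q ≠ 0) :
    HasGrad (fun y => f y / g y) (fun i => (f' i * g q - f q * g' i) / g q ^ 2) q := by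
  simp only [div_eq_mul_inv (f _)]
  exact (hf.mul (hg.inv h0)).congr_grad fun i => by field_simp; ring

lemma unique (hf : HasGrad f f' q) (hg : HasGrad f g' q) (i : Fin 4) : f' i = g' i := by
  rw [← hf.2, hg.2]

lemma fderiv_apply (hf : HasGrad f f' q) (v : E4) : fderiv ℝ f q v = ∑ i, v i * f' i := by
  have hv : v = ∑ i, v i • EuclideanSpace.single i (1 : ℝ) := by
    ext j
    simp [Finset.sum_apply, Pi.single_apply]
  conv_lhs => rw [hv]
  rw [map_sum]
  refine Finset.sum_congr rfl fun i _ => ?_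
  rw [map_smul, ← hf.2 i]; rfl

end HasGrad

lemma contDiffOn_pd {D : Set E4} (hD : IsOpen D) {f : E4 → ℝ} (hf : ContDiffOn ℝ ∞ f D)
    (i : Fin 4) : ContDiffOn ℝ ∞ (pd i f) D :=
  (hf.fderiv_of_isOpen hD (m := ∞) (by simp)).clm_apply contDiffOn_const

lemma _root_.ContDiffOn.hasGrad {D : Set E4} (hD : IsOpen D) {f : E4 → ℝ} {q : E4}
    (hf : ContDiffOn ℝ ∞ f D) (hq : q ∈ D) : HasGrad f (fun i => pd i f q) q :=
  DifferentiableAt.hasGrad ((hf.contDiffAt (hD.mem_nhds hq)).differentiableAt (by simp))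

lemma two_le_infty : (2 : WithTop ℕ∞) ≤ ∞ :=
  WithTop.coe_le_coe.2 (le_top : (2 : ℕ∞) ≤ ⊤)

lemma pd_comm {f : E4 → ℝ} {q : E4} (hf : ContDiffAt ℝ ∞ f q) (i j : Fin 4) :
    pd i (pd j f) q = pd j (pd i f) q := by
  have hd : DifferentiableAt ℝ (fderiv ℝ f) q :=
    (hf.fderiv_right (m := 1) (by rw [one_add_one_eq_two]; exact two_le_infty)).differentiableAt (by simp)
  have key (i j : Fin 4) : pd i (pd j f) q
      = fderiv ℝ (fderiv ℝ f) q (EuclideanSpace.single i 1) (EuclideanSpace.single j 1) := by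
    unfold pd
    rw [fderiv_clm_apply hd (differentiableAt_const _)]
    simp
  rw [key, key]
  exact (hf.isSymmSndFDerivAt (by simpa using two_le_infty)) _ _

/-! ### Smoothness of matrix operations -/

lemma contDiffOn_matrix_det {n : Type*} [Fintype n] [DecidableEq n] {D : Set E4}
    {A : E4 → Matrix n n ℝ} (hA : ∀ i j, ContDiffOn ℝ ∞ (fun y => A y i j) D) :
    ContDiffOn ℝ ∞ (fun y => (A y).det) D := by
  simp only [Matrix.det_apply']
  exact ContDiffOn.sum fun σ _ => contDiffOn_const.mul (contDiffOn_prod fun i _ => hA _ _)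

lemma contDiffOn_matrix_inv {n : Type*} [Fintype n] [DecidableEq n] {D : Set E4}
    {A : E4 → Matrix n n ℝ} (hA : ∀ i j, ContDiffOn ℝ ∞ (fun y => A y i j) D)
    (h0 : ∀ y ∈ D, (A y).det ≠ 0) (i j : n) :
    ContDiffOn ℝ ∞ (fun y => (A y)⁻¹ i j) D := by
  simp only [Matrix.inv_def, Ring.inverse_eq_inv', Matrix.smul_apply, Matrix.adjugate_apply,
    smul_eq_mul]
  refine ((contDiffOn_matrix_det hA).inv h0).mul (contDiffOn_matrix_det fun a b => ?_)
  by_cases h : a = j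
  · subst h; simpa using contDiffOn_const
  · simpa [Matrix.updateRow_ne h] using hA a b

end YangPure

end

noncomputable section

namespace YangPure

open Topology Matrix

/-! ### Matrix-valued functions -/

/-- All entries of `A` are smooth on `D`. -/
def SmoothMat {n : Type*} (A : E4 → Matrix n n ℝ) (D : Set E4) : Prop :=
  ∀ i j, ContDiffOn ℝ ∞ (fun y => A y i j) D

/-- Entrywise partial derivative of a matrix-valued function. -/
def pdMat {n : Type*} (i : Fin 4) (A : E4 → Matrix n n ℝ) (y : E4) : Matrix n n ℝ :=
  of fun a b => pd i (fun z => A z a b) y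

namespace SmoothMat

variable {n : Type*} {A B : E4 → Matrix n n ℝ} {D : Set E4}

lemma add (hA : SmoothMat A D) (hB : SmoothMat B D) : SmoothMat (fun y => A y + B y) D :=
  fun i j => (hA i j).add (hB i j)

lemma sub (hA : SmoothMat A D) (hB : SmoothMat B D) : SmoothMat (fun y => A y - B y) D :=
  fun i j => (hA i j).sub (hB i j)

lemma mul [Fintype n] (hA : SmoothMat A D) (hB : SmoothMat B D) :
    SmoothMat (fun y => A y * B y) D := fun i j => by
  simp only [mul_apply]
  exact ContDiffOn.sum fun k _ => (hA i k).mul (hB k j)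

lemma transpose (hA : SmoothMat A D) : SmoothMat (fun y => (A y)ᵀ) D := fun i j => hA j i

lemma pdMat (hD : IsOpen D) (hA : SmoothMat A D) (i : Fin 4) : SmoothMat (pdMat i A) D :=
  fun a b => contDiffOn_pd hD (hA a b) i

end SmoothMat

section pdMat

variable {n : Type*} {A B : E4 → Matrix n n ℝ} {D : Set E4} {q : E4}

lemma pdMat_congr (h : A =ᶠ[𝓝 q] B) (i : Fin 4) : pdMat i A q = pdMat i B q := by
  ext a b
  have : (fun z => A z a b) =ᶠ[𝓝 q] fun z => B z a b := h.mono fun z hz => by simp [hz]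
  simp [pdMat, pd, this.fderiv_eq]

lemma pdMat_add (hD : IsOpen D) (hq : q ∈ D) (hA : SmoothMat A D) (hB : SmoothMat B D)
    (i : Fin 4) : pdMat i (fun y => A y + B y) q = pdMat i A q + pdMat i B q := by
  ext a b
  exact (((hA a b).hasGrad hD hq).add ((hB a b).hasGrad hD hq)).2 i

lemma pdMat_sub (hD : IsOpen D) (hq : q ∈ D) (hA : SmoothMat A D) (hB : SmoothMat B D)
    (i : Fin 4) : pdMat i (fun y => A y - B y) q = pdMat i A q - pdMat i B q := by
  ext a b
  exact (((hA a b).hasGrad hD hq).sub ((hB a b).hasGrad hD hq)).2 i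

lemma pdMat_mul [Fintype n] (hD : IsOpen D) (hq : q ∈ D) (hA : SmoothMat A D)
    (hB : SmoothMat B D) (i : Fin 4) :
    pdMat i (fun y => A y * B y) q = pdMat i A q * B q + A q * pdMat i B q := by
  ext a b
  simp only [pdMat, of_apply, mul_apply, Matrix.add_apply, ← Finset.sum_add_distrib]
  exact (HasGrad.sum fun k _ => ((hA a k).hasGrad hD hq).mul ((hB k b).hasGrad hD hq)).2 i

lemma pdMat_transpose (i : Fin 4) : pdMat i (fun y => (A y)ᵀ) q = (pdMat i A q)ᵀ := rfl

lemma pdMat_comm (hD : IsOpen D) (hq : q ∈ D) (hA : SmoothMat A D) (i j : Fin 4) :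
    pdMat i (pdMat j A) q = pdMat j (pdMat i A) q := by
  ext a b
  exact pd_comm ((hA a b).contDiffAt (hD.mem_nhds hq)) i j

lemma pdMat_const (i : Fin 4) (C : Matrix n n ℝ) : pdMat i (fun _ => C) q = 0 := by
  ext a b
  exact (HasGrad.const (C a b) q).2 i

end pdMat

/-! ### Metric components and the Levi-Civita connection -/

/-- `G` consists of the components of a smooth nondegenerate metric on the open set `D`. -/
structure IsMetricOn (G : E4 → Matrix (Fin 4) (Fin 4) ℝ) (D : Set E4) : Prop where
  isOpen : IsOpen D
  smooth : SmoothMat G D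
  symm : ∀ y ∈ D, ∀ i j, G y i j = G y j i
  det_ne_zero : ∀ y ∈ D, (G y).det ≠ 0

/-- The connection matrix `(Γᵢ)ˡₘ = Γˡᵢₘ`. -/
def connMat (G : E4 → Matrix (Fin 4) (Fin 4) ℝ) (i : Fin 4) (y : E4) : Matrix (Fin 4) (Fin 4) ℝ :=
  of fun l m => christoffel G l i m y

/-- The curvature matrix `(Fᵢⱼ)ˡₖ = Rˡₖᵢⱼ`. -/
def curvMat (G : E4 → Matrix (Fin 4) (Fin 4) ℝ) (i j : Fin 4) (y : E4) : Matrix (Fin 4) (Fin 4) ℝ :=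
  pdMat i (connMat G j) y - pdMat j (connMat G i) y
    + (connMat G i y * connMat G j y - connMat G j y * connMat G i y)

lemma riemann_eq_curvMat (G : E4 → Matrix (Fin 4) (Fin 4) ℝ) (l k i j : Fin 4) (y : E4) :
    riemann G l k i j y = curvMat G i j y l k := by
  simp only [riemann, curvMat, pdMat, connMat, Matrix.add_apply, Matrix.sub_apply, of_apply,
    mul_apply, Finset.sum_sub_distrib]

lemma curvMat_swap (G : E4 → Matrix (Fin 4) (Fin 4) ℝ) (i j : Fin 4) (y : E4) :
    curvMat G j i y = -curvMat G i j y := by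
  simp only [curvMat]; abel

lemma riemann_swap (G : E4 → Matrix (Fin 4) (Fin 4) ℝ) (l k i j : Fin 4) (y : E4) :
    riemann G l k j i y = -riemann G l k i j y := by
  rw [riemann_eq_curvMat, riemann_eq_curvMat, curvMat_swap]; rfl

namespace IsMetricOn

variable {G : E4 → Matrix (Fin 4) (Fin 4) ℝ} {D : Set E4} {q : E4}

lemma transpose_eq (h : IsMetricOn G D) (hq : q ∈ D) : (G q)ᵀ = G q := by
  ext i j; exact h.symm q hq j i

lemma isUnit_det (h : IsMetricOn G D) (hq : q ∈ D) : IsUnit (G q).det :=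
  isUnit_iff_ne_zero.2 (h.det_ne_zero q hq)

lemma mul_inv (h : IsMetricOn G D) (hq : q ∈ D) : G q * (G q)⁻¹ = 1 :=
  Matrix.mul_nonsing_inv _ (h.isUnit_det hq)

lemma inv_mul (h : IsMetricOn G D) (hq : q ∈ D) : (G q)⁻¹ * G q = 1 :=
  Matrix.nonsing_inv_mul _ (h.isUnit_det hq)

lemma inv_transpose (h : IsMetricOn G D) (hq : q ∈ D) : ((G q)⁻¹)ᵀ = (G q)⁻¹ := by
  rw [Matrix.transpose_nonsing_inv, h.transpose_eq hq]

lemma inv_symm (h : IsMetricOn G D) (hq : q ∈ D) (i j : Fin 4) :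
    (G q)⁻¹ i j = (G q)⁻¹ j i := by
  conv_lhs => rw [← h.inv_transpose hq, Matrix.transpose_apply]

lemma sum_mul_inv (h : IsMetricOn G D) (hq : q ∈ D) (a b : Fin 4) :
    ∑ m, G q a m * (G q)⁻¹ m b = if a = b then 1 else 0 := by
  rw [← mul_apply, h.mul_inv hq, one_apply]

lemma sum_inv_mul (h : IsMetricOn G D) (hq : q ∈ D) (a b : Fin 4) :
    ∑ m, (G q)⁻¹ a m * G q m b = if a = b then 1 else 0 := by
  rw [← mul_apply, h.inv_mul hq, one_apply]

lemma smooth_inv (h : IsMetricOn G D) : SmoothMat (fun y => (G y)⁻¹) D :=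
  fun i j => contDiffOn_matrix_inv h.smooth h.det_ne_zero i j

lemma contDiffOn_christoffel (h : IsMetricOn G D) (k i j : Fin 4) :
    ContDiffOn ℝ ∞ (christoffel G k i j) D := by
  unfold christoffel
  exact contDiffOn_const.mul (ContDiffOn.sum fun l _ => (h.smooth_inv k l).mul
    (((contDiffOn_pd h.isOpen (h.smooth l j) i).add (contDiffOn_pd h.isOpen (h.smooth l i) j)).sub
      (contDiffOn_pd h.isOpen (h.smooth i j) l)))

lemma smooth_connMat (h : IsMetricOn G D) (i : Fin 4) : SmoothMat (connMat G i) D :=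
  fun l m => h.contDiffOn_christoffel l i m

lemma smooth_curvMat (h : IsMetricOn G D) (i j : Fin 4) : SmoothMat (curvMat G i j) D :=
  (((h.smooth_connMat j).pdMat h.isOpen i).sub ((h.smooth_connMat i).pdMat h.isOpen j)).add
    (((h.smooth_connMat i).mul (h.smooth_connMat j)).sub
      ((h.smooth_connMat j).mul (h.smooth_connMat i)))

lemma contDiffOn_ricci (h : IsMetricOn G D) (k j : Fin 4) : ContDiffOn ℝ ∞ (ricci G k j) D := by
  unfold ricci
  refine ContDiffOn.sum fun i _ => ?_
  have : riemann G i k i j = fun y => curvMat G i j y i k :=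
    funext fun y => riemann_eq_curvMat G i k i j y
  rw [this]
  exact h.smooth_curvMat i j i k

lemma pd_symm (h : IsMetricOn G D) (hq : q ∈ D) (i a b : Fin 4) :
    pd i (fun z => G z a b) q = pd i (fun z => G z b a) q := by
  have : (fun z => G z a b) =ᶠ[𝓝 q] fun z => G z b a :=
    Filter.eventuallyEq_of_mem (h.isOpen.mem_nhds hq) fun z hz => h.symm z hz a b
  rw [pd, pd, this.fderiv_eq]

lemma christoffel_symm (h : IsMetricOn G D) (hq : q ∈ D) (k i j : Fin 4) :
    christoffel G k i j q = christoffel G k j i q := by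
  unfold christoffel
  congr 1
  refine Finset.sum_congr rfl fun l _ => ?_
  rw [h.pd_symm hq l i j]; ring

lemma lower_christoffel (h : IsMetricOn G D) (hq : q ∈ D) (b i j : Fin 4) :
    ∑ m, G q b m * christoffel G m i j q = (1 / 2) * (pd i (fun z => G z b j) q
      + pd j (fun z => G z b i) q - pd b (fun z => G z i j) q) := by
  have e : (fun m => christoffel G m i j q) = (G q)⁻¹ *ᵥ fun l => (1 / 2) *
      (pd i (fun z => G z l j) q + pd j (fun z => G z l i) q - pd l (fun z => G z i j) q) := by
    funext m
    simp only [christoffel, mulVec, dotProduct, Finset.mul_sum]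
    exact Finset.sum_congr rfl fun l _ => by ring
  change (G q *ᵥ fun m => christoffel G m i j q) b = _
  rw [e, mulVec_mulVec, h.mul_inv hq, one_mulVec]

/-- Metric compatibility: in the sum of the two lowered Christoffel symbols the terms other than
∂ᵢG_ab cancel in pairs. -/
lemma hasGrad_metric (h : IsMetricOn G D) (hq : q ∈ D) (a b : Fin 4) :
    HasGrad (fun y => G y a b) (fun i => ∑ m, christoffel G m i a q * G q m b
      + ∑ m, christoffel G m i b q * G q a m) q := by
  refine ((h.smooth a b).hasGrad h.isOpen hq).congr_grad fun i => ?_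
  have h1 := h.lower_christoffel hq b i a
  have h2 := h.lower_christoffel hq a i b
  have e1 : ∑ m, christoffel G m i a q * G q m b = ∑ m, G q b m * christoffel G m i a q :=
    Finset.sum_congr rfl fun m _ => by rw [h.symm q hq m b]; ring
  have e2 : ∑ m, christoffel G m i b q * G q a m = ∑ m, G q a m * christoffel G m i b q :=
    Finset.sum_congr rfl fun m _ => by ring
  rw [e1, e2, h1, h2, h.pd_symm hq i b a, h.pd_symm hq a b i, h.pd_symm hq b a i]
  ring

lemma pdMat_metric (h : IsMetricOn G D) (hq : q ∈ D) (i : Fin 4) :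
    pdMat i G q = (connMat G i q)ᵀ * G q + G q * connMat G i q := by
  ext a b
  simp only [pdMat, of_apply, (h.hasGrad_metric hq a b).2 i, Matrix.add_apply, mul_apply, connMat,
    transpose_apply]
  congr 1
  exact Finset.sum_congr rfl fun m _ => by ring

lemma pdMat_inv (h : IsMetricOn G D) (hq : q ∈ D) (i : Fin 4) :
    pdMat i (fun y => (G y)⁻¹) q
      = -(connMat G i q * (G q)⁻¹ + (G q)⁻¹ * (connMat G i q)ᵀ) := by
  -- Differentiate G G⁻¹ = 1 and solve for the derivative of G⁻¹.
  have h1 : pdMat i (fun y => G y * (G y)⁻¹) q = 0 := by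
    rw [← pdMat_const i (1 : Matrix (Fin 4) (Fin 4) ℝ)]
    exact pdMat_congr (Filter.eventuallyEq_of_mem (h.isOpen.mem_nhds hq)
      fun z hz => h.mul_inv hz) i
  rw [pdMat_mul h.isOpen hq h.smooth h.smooth_inv, h.pdMat_metric hq] at h1
  have h2 := congrArg (fun M => (G q)⁻¹ * M) h1
  simp only [Matrix.mul_add, Matrix.add_mul, Matrix.mul_zero] at h2
  rw [← Matrix.mul_assoc (G q)⁻¹ (G q), h.inv_mul hq, Matrix.one_mul] at h2
  have e1 : (G q)⁻¹ * ((connMat G i q)ᵀ * G q * (G q)⁻¹) = (G q)⁻¹ * (connMat G i q)ᵀ := by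
    rw [Matrix.mul_assoc _ (G q), h.mul_inv hq, Matrix.mul_one]
  have e2 : (G q)⁻¹ * (G q * connMat G i q * (G q)⁻¹) = connMat G i q * (G q)⁻¹ := by
    rw [Matrix.mul_assoc (G q), ← Matrix.mul_assoc (G q)⁻¹, h.inv_mul hq, Matrix.one_mul]
  rw [e1, e2] at h2
  rw [eq_neg_iff_add_eq_zero, ← h2]; abel

lemma hasGrad_inv (h : IsMetricOn G D) (hq : q ∈ D) (a b : Fin 4) :
    HasGrad (fun y => (G y)⁻¹ a b) (fun i => -(∑ m, christoffel G a i m q * (G q)⁻¹ m b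
      + ∑ m, christoffel G b i m q * (G q)⁻¹ a m)) q := by
  refine ((h.smooth_inv a b).hasGrad h.isOpen hq).congr_grad fun i => ?_
  have := congrFun (congrFun (h.pdMat_inv hq i) a) b
  simp only [pdMat, of_apply, Matrix.neg_apply, Matrix.add_apply, mul_apply, connMat,
    transpose_apply] at this
  rw [this]
  congr 2
  exact Finset.sum_congr rfl fun m _ => by ring

/-! ### Symmetries of the curvature -/

lemma pdMat_curvMat (h : IsMetricOn G D) (hq : q ∈ D) (i j k : Fin 4) :
    pdMat i (curvMat G j k) q
      = pdMat i (pdMat j (connMat G k)) q - pdMat i (pdMat k (connMat G j)) q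
        + (pdMat i (connMat G j) q * connMat G k q + connMat G j q * pdMat i (connMat G k) q
          - (pdMat i (connMat G k) q * connMat G j q + connMat G k q * pdMat i (connMat G j) q)) := by
  have hc := h.smooth_connMat
  have hO := h.isOpen
  have e : curvMat G j k = fun y => (fun y => pdMat j (connMat G k) y - pdMat k (connMat G j) y) y
    + (fun y => (fun y => connMat G j y * connMat G k y) y
      - (fun y => connMat G k y * connMat G j y) y) y := rfl
  rw [e, pdMat_add hO hq (((hc k).pdMat hO j).sub ((hc j).pdMat hO k))
      (((hc j).mul (hc k)).sub ((hc k).mul (hc j))),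
    pdMat_sub hO hq ((hc k).pdMat hO j) ((hc j).pdMat hO k),
    pdMat_sub hO hq ((hc j).mul (hc k)) ((hc k).mul (hc j)),
    pdMat_mul hO hq (hc j) (hc k), pdMat_mul hO hq (hc k) (hc j)]

/-- The second Bianchi identity. -/
lemma second_bianchi (h : IsMetricOn G D) (hq : q ∈ D) (i j k : Fin 4) :
    (pdMat i (curvMat G j k) q + connMat G i q * curvMat G j k q
        - curvMat G j k q * connMat G i q)
      + (pdMat j (curvMat G k i) q + connMat G j q * curvMat G k i q
        - curvMat G k i q * connMat G j q)
      + (pdMat k (curvMat G i j) q + connMat G k q * curvMat G i j q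
        - curvMat G i j q * connMat G k q) = 0 := by
  rw [h.pdMat_curvMat hq, h.pdMat_curvMat hq, h.pdMat_curvMat hq,
    pdMat_comm h.isOpen hq (h.smooth_connMat k) j i,
    pdMat_comm h.isOpen hq (h.smooth_connMat i) k j,
    pdMat_comm h.isOpen hq (h.smooth_connMat j) k i]
  -- Second derivatives have cancelled by symmetry; the rest is the Jacobi identity for commutators
  -- of connection matrices.
  simp only [curvMat]
  noncomm_ring

/-- The equation ∂ᵢG = ΓᵢᵀG + GΓᵢ has the curvature acting on G as its integrability obstruction.
Since second derivatives of G commute, that action is zero. -/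
lemma lower_curvMat (h : IsMetricOn G D) (hq : q ∈ D) (i j : Fin 4) :
    (curvMat G i j q)ᵀ * G q + G q * curvMat G i j q = 0 := by
  have hO := h.isOpen
  have hc := h.smooth_connMat
  have key (i j : Fin 4) : pdMat i (pdMat j G) q
      = (pdMat i (connMat G j) q)ᵀ * G q
        + (connMat G j q)ᵀ * ((connMat G i q)ᵀ * G q + G q * connMat G i q)
        + (((connMat G i q)ᵀ * G q + G q * connMat G i q) * connMat G j q
        + G q * pdMat i (connMat G j) q) := by
    rw [pdMat_congr (B := fun y => (fun y => (fun y => (connMat G j y)ᵀ) y * G y) y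
        + (fun y => G y * connMat G j y) y) (Filter.eventuallyEq_of_mem (hO.mem_nhds hq)
        fun z hz => h.pdMat_metric hz j) i,
      pdMat_add hO hq ((hc j).transpose.mul h.smooth) (h.smooth.mul (hc j)),
      pdMat_mul hO hq (hc j).transpose h.smooth, pdMat_mul hO hq h.smooth (hc j),
      h.pdMat_metric hq, pdMat_transpose]
  have h1 := pdMat_comm hO hq h.smooth i j
  rw [key, key, ← sub_eq_zero] at h1
  rw [← h1]
  simp only [curvMat, transpose_add, transpose_sub, transpose_mul]
  noncomm_ring

/-- `∑ G_cl Rˡ_bij` is antisymmetric in `c, b`. -/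
lemma lower_riemann_antisymm (h : IsMetricOn G D) (hq : q ∈ D) (c b i j : Fin 4) :
    ∑ l, G q b l * riemann G l c i j q = -∑ l, G q c l * riemann G l b i j q := by
  have := congrFun (congrFun (h.lower_curvMat hq i j) c) b
  simp only [Matrix.add_apply, mul_apply, transpose_apply, Matrix.zero_apply] at this
  rw [eq_neg_iff_add_eq_zero, ← this]
  simp only [riemann_eq_curvMat]
  congr 1
  exact Finset.sum_congr rfl fun m _ => by rw [h.symm q hq b m]; ring

/-- The first Bianchi identity. -/
lemma first_bianchi (h : IsMetricOn G D) (hq : q ∈ D) (l k i j : Fin 4) :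
    riemann G l k i j q + riemann G l i j k q + riemann G l j k i q = 0 := by
  have hs (a i j k : Fin 4) : pd a (christoffel G i j k) q = pd a (christoffel G i k j) q := by
    have : christoffel G i j k =ᶠ[𝓝 q] christoffel G i k j :=
      Filter.eventuallyEq_of_mem (h.isOpen.mem_nhds hq) fun z hz => h.christoffel_symm hz i j k
    rw [pd, pd, this.fderiv_eq]
  have e (m i j : Fin 4) := h.christoffel_symm hq m i j
  simp only [riemann, Finset.sum_sub_distrib]
  simp only [hs i l k j, hs j l k i, hs k l j i, e _ k j, e _ k i, e _ j i]
  ring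

end IsMetricOn

end YangPure

end

noncomputable section

namespace YangPure

open Topology Matrix

/-! ### The contracted second Bianchi identity -/

lemma sum_sum_eq_zero_of_antisymm {ι : Type*} [Fintype ι] {f : ι → ι → ℝ}
    (hf : ∀ i j, f j i = -f i j) : ∑ i, ∑ j, f i j = 0 := by
  have h : ∑ i, ∑ j, f i j = -∑ i, ∑ j, f i j := by
    conv_lhs => rw [Finset.sum_comm]
    simp only [← Finset.sum_neg_distrib]
    exact Finset.sum_congr rfl fun i _ => Finset.sum_congr rfl fun j _ => hf i j
  linarith

/-- The index manipulation behind the contracted second Bianchi identity: `w` plays the role of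
the partial derivatives of the curvature `W` with the upper indices last. -/
lemma contract_cyclic {ι : Type*} [Fintype ι] {w : ι → ι → ι → ι → ι → ℝ}
    {W : ι → ι → ι → ι → ℝ} {Γ : ι → ι → ι → ℝ}
    (hw₁ : ∀ i j k l m, w i k j l m = -w i j k l m)
    (hw₂ : ∀ i j k l m, w i j k m l = -w i j k l m)
    (hW₁ : ∀ j k l m, W k j l m = -W j k l m) (hW₂ : ∀ j k l m, W j k m l = -W j k l m)
    (hΓ : ∀ i l n, Γ i l n = Γ n l i)
    (star : ∀ i j k l m,
      (w i j k l m + ∑ n, Γ i l n * W j k n m + ∑ n, W j k l n * Γ i m n)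
      + (w j k i l m + ∑ n, Γ j l n * W k i n m + ∑ n, W k i l n * Γ j m n)
      + (w k i j l m + ∑ n, Γ k l n * W i j n m + ∑ n, W i j l n * Γ k m n) = 0) (i : ι) :
    ∑ j, ∑ k, w i j k j k + 2 * ∑ j, ∑ n, Γ i j n * ∑ k, W k j k n
      - 2 * ∑ j, ∑ k, w j k i k j - 2 * ∑ j, ∑ n, Γ j j n * ∑ k, W k i k n = 0 := by
  -- Contract the upper pair l, m with the lower pair j, k.
  have h : ∑ j, ∑ k, (
      (w i j k j k + ∑ n, Γ i j n * W j k n k + ∑ n, W j k j n * Γ i k n)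
      + (w j k i j k + ∑ n, Γ j j n * W k i n k + ∑ n, W k i j n * Γ j k n)
      + (w k i j j k + ∑ n, Γ k j n * W i j n k + ∑ n, W i j j n * Γ k k n)) = 0 :=
    Finset.sum_eq_zero fun j _ => Finset.sum_eq_zero fun k _ => star i j k j k
  simp only [Finset.sum_add_distrib] at h
  have a1 : ∑ j, ∑ k, ∑ n, Γ i j n * W j k n k = ∑ j, ∑ n, Γ i j n * ∑ k, W k j k n := by
    refine Finset.sum_congr rfl fun j _ => ?_
    rw [Finset.sum_comm]
    simp only [Finset.mul_sum]
    refine Finset.sum_congr rfl fun n _ => Finset.sum_congr rfl fun k _ => ?_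
    rw [hW₁ k j n k, hW₂ k j k n, neg_neg]
  have a2 : ∑ j, ∑ k, ∑ n, W j k j n * Γ i k n = ∑ j, ∑ n, Γ i j n * ∑ k, W k j k n := by
    rw [Finset.sum_comm]
    refine Finset.sum_congr rfl fun j _ => ?_
    rw [Finset.sum_comm]
    simp only [Finset.mul_sum]
    exact Finset.sum_congr rfl fun n _ => Finset.sum_congr rfl fun k _ => mul_comm _ _
  have b1 : ∑ j, ∑ k, w j k i j k = -∑ j, ∑ k, w j k i k j := by
    simp only [← Finset.sum_neg_distrib]
    exact Finset.sum_congr rfl fun j _ => Finset.sum_congr rfl fun k _ => hw₂ j k i k j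
  have b2 : ∑ j, ∑ k, ∑ n, Γ j j n * W k i n k = -∑ j, ∑ n, Γ j j n * ∑ k, W k i k n := by
    simp only [← Finset.sum_neg_distrib]
    refine Finset.sum_congr rfl fun j _ => ?_
    rw [Finset.sum_comm]
    simp only [Finset.mul_sum, ← Finset.sum_neg_distrib]
    refine Finset.sum_congr rfl fun n _ => Finset.sum_congr rfl fun k _ => ?_
    rw [hW₂ k i k n]; ring
  -- A contraction of the antisymmetric upper pair of `W` with the symmetric lower pair of `Γ`; `c2`
  -- vanishes for the same reason.
  have b3 : ∑ j, ∑ k, ∑ n, W k i j n * Γ j k n = 0 := by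
    rw [Finset.sum_comm]
    refine Finset.sum_eq_zero fun k _ => sum_sum_eq_zero_of_antisymm fun j n => ?_
    rw [hW₂ k i j n, hΓ n k j]; ring
  have c1 : ∑ j, ∑ k, w k i j j k = -∑ j, ∑ k, w j k i k j := by
    rw [Finset.sum_comm]
    simp only [← Finset.sum_neg_distrib]
    exact Finset.sum_congr rfl fun j _ => Finset.sum_congr rfl fun k _ => hw₁ j k i k j
  have c2 : ∑ j, ∑ k, ∑ n, Γ k j n * W i j n k = 0 := by
    refine Finset.sum_eq_zero fun j _ => sum_sum_eq_zero_of_antisymm fun k n => ?_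
    rw [hW₂ i j n k, hΓ n j k]; ring
  have c3 : ∑ j, ∑ k, ∑ n, W i j j n * Γ k k n = -∑ j, ∑ n, Γ j j n * ∑ k, W k i k n := by
    rw [Finset.sum_comm]
    simp only [← Finset.sum_neg_distrib]
    refine Finset.sum_congr rfl fun j _ => ?_
    rw [Finset.sum_comm]
    simp only [Finset.mul_sum, ← Finset.sum_neg_distrib]
    refine Finset.sum_congr rfl fun n _ => Finset.sum_congr rfl fun k _ => ?_
    rw [hW₁ k i k n]; ring
  rw [a1, a2, b1, b2, b3, c1, c2, c3] at h
  linarith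

namespace IsMetricOn

variable {G : E4 → Matrix (Fin 4) (Fin 4) ℝ} {D : Set E4} {q : E4}

/-- The mixed Ricci tensor `Rᵐⱼ`. -/
def mixedRicci (G : E4 → Matrix (Fin 4) (Fin 4) ℝ) (m j : Fin 4) (y : E4) : ℝ :=
  ∑ n, ricci G n j y * (G y)⁻¹ n m

lemma mixedRicci_eq (G : E4 → Matrix (Fin 4) (Fin 4) ℝ) (m j : Fin 4) (y : E4) :
    mixedRicci G m j y = ∑ l, (curvMat G l j y * (G y)⁻¹) l m := by
  simp only [mixedRicci, ricci, riemann_eq_curvMat, mul_apply, Finset.sum_mul]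
  exact Finset.sum_comm

lemma raised_antisymm (h : IsMetricOn G D) (hq : q ∈ D) (j k : Fin 4) :
    (curvMat G j k q * (G q)⁻¹)ᵀ = -(curvMat G j k q * (G q)⁻¹) := by
  have h1 := h.lower_curvMat hq j k
  have h2 : (G q)⁻¹ * ((curvMat G j k q)ᵀ * G q + G q * curvMat G j k q) * (G q)⁻¹ = 0 := by
    rw [h1]; simp
  rw [transpose_mul, h.inv_transpose hq, eq_neg_iff_add_eq_zero, ← h2, Matrix.mul_add,
    Matrix.add_mul, ← Matrix.mul_assoc (G q)⁻¹ (G q), h.inv_mul hq, Matrix.one_mul,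
    Matrix.mul_assoc, Matrix.mul_assoc _ (G q), h.mul_inv hq, Matrix.mul_one]

/-- The contracted second Bianchi identity `∂ᵢR - 2 ∇ⱼRʲᵢ = 0`, with the covariant divergence
written out. -/
lemma contracted_bianchi (h : IsMetricOn G D) (hq : q ∈ D) (i : Fin 4) :
    pd i (coordScalar G) q
      + 2 * ∑ j, ∑ n, christoffel G j i n q * mixedRicci G n j q
      - 2 * ∑ j, pd j (mixedRicci G j i) q
      - 2 * ∑ j, ∑ n, christoffel G j j n q * mixedRicci G n i q = 0 := by
  set W : Fin 4 → Fin 4 → E4 → Matrix (Fin 4) (Fin 4) ℝ :=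
    fun j k y => curvMat G j k y * (G y)⁻¹ with hWdef
  have hWs (j k : Fin 4) : SmoothMat (W j k) D := (h.smooth_curvMat j k).mul h.smooth_inv
  have hW₁ (j k : Fin 4) (y : E4) : W k j y = -W j k y := by
    simp only [hWdef, curvMat_swap G j k, Matrix.neg_mul]
  have hW₂ (j k l m : Fin 4) (y : E4) (hy : y ∈ D) : W j k y m l = -W j k y l m :=
    congrFun (congrFun (h.raised_antisymm hy j k) l) m
  -- Raising an index commutes with covariant differentiation, so the second Bianchi identity passes
  -- from the curvature matrices to `W`.
  have hpd (j k i : Fin 4) : pdMat i (W j k) q + connMat G i q * W j k q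
      + W j k q * (connMat G i q)ᵀ = (pdMat i (curvMat G j k) q
        + connMat G i q * curvMat G j k q - curvMat G j k q * connMat G i q) * (G q)⁻¹ := by
    rw [hWdef]
    simp only
    rw [pdMat_mul h.isOpen hq (h.smooth_curvMat j k) h.smooth_inv, h.pdMat_inv hq]
    noncomm_ring
  have star (i j k : Fin 4) :
      (pdMat i (W j k) q + connMat G i q * W j k q + W j k q * (connMat G i q)ᵀ)
      + (pdMat j (W k i) q + connMat G j q * W k i q + W k i q * (connMat G j q)ᵀ)
      + (pdMat k (W i j) q + connMat G k q * W i j q + W i j q * (connMat G k q)ᵀ) = 0 := by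
    rw [hpd, hpd, hpd, ← Matrix.add_mul, ← Matrix.add_mul, h.second_bianchi hq, Matrix.zero_mul]
  have key := contract_cyclic (w := fun i j k l m => pdMat i (W j k) q l m)
    (W := fun j k l m => W j k q l m) (Γ := fun i l n => christoffel G l i n q)
    (fun i j k l m => by
      have : pdMat i (W k j) q = -pdMat i (W j k) q := by
        rw [funext (hW₁ j k)]
        ext a b
        exact ((hWs j k a b).hasGrad h.isOpen hq).neg.2 i
      rw [this]; rfl)
    (fun i j k l m => by
      have e : (fun z => W j k z m l) =ᶠ[𝓝 q] fun z => -W j k z l m :=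
        Filter.eventuallyEq_of_mem (h.isOpen.mem_nhds hq) fun z hz => hW₂ j k l m z hz
      exact (((hWs j k l m).hasGrad h.isOpen hq).neg.congr_of_eventuallyEq e).2 i)
    (fun j k l m => by simp only [hW₁ j k]; rfl)
    (fun j k l m => hW₂ j k l m q hq)
    (fun i l n => h.christoffel_symm hq l i n)
    (fun i j k l m => by
      have := congrFun (congrFun (star i j k) l) m
      simpa only [Matrix.add_apply, mul_apply, connMat, of_apply, transpose_apply,
        Matrix.zero_apply] using this) i
  simp only [← mixedRicci_eq, hWdef] at key
  rw [← key]
  have hs : HasGrad (coordScalar G) (fun i => ∑ j, ∑ k, pdMat i (W j k) q j k) q := by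
    have e : coordScalar G = fun y => ∑ j, ∑ k, W j k y j k := by
      funext y
      simp only [coordScalar, hWdef]
      rw [Finset.sum_comm (f := fun j k => (curvMat G j k y * (G y)⁻¹) j k)]
      simp only [← mixedRicci_eq, mixedRicci]
      rw [Finset.sum_comm]
      exact Finset.sum_congr rfl fun j _ => Finset.sum_congr rfl fun n _ => mul_comm _ _
    rw [e]
    exact HasGrad.sum fun j _ => HasGrad.sum fun k _ => (hWs j k j k).hasGrad h.isOpen hq
  have hm (j : Fin 4) : HasGrad (mixedRicci G j i) (fun a => ∑ k, pdMat a (W k i) q k j) q := by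
    have e : mixedRicci G j i = fun y => ∑ k, W k i y k j := funext fun y => mixedRicci_eq G j i y
    rw [e]
    exact HasGrad.sum fun k _ => (hWs k i k j).hasGrad h.isOpen hq
  rw [hs.2 i]
  simp only [(hm _).2]
  rfl

end IsMetricOn

/-! ### Covariant derivatives -/

section Cov

variable {G : E4 → Matrix (Fin 4) (Fin 4) ℝ} {D : Set E4} {q : E4}

/-- The covector field `v` has covariant derivative `∇ₐv_b = C a b` at `q`. -/
def HasCov (G : E4 → Matrix (Fin 4) (Fin 4) ℝ) (v : Fin 4 → E4 → ℝ) (C : Fin 4 → Fin 4 → ℝ)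
    (q : E4) : Prop :=
  ∀ b, HasGrad (v b) (fun a => ∑ c, christoffel G c a b q * v c q + C a b) q

/-- The covariant 2-tensor field `T` has covariant derivative `∇_dT_ab = C d a b` at `q`. -/
def HasCov₂ (G : E4 → Matrix (Fin 4) (Fin 4) ℝ) (T : Fin 4 → Fin 4 → E4 → ℝ)
    (C : Fin 4 → Fin 4 → Fin 4 → ℝ) (q : E4) : Prop :=
  ∀ a b, HasGrad (T a b) (fun d => ∑ e, christoffel G e d a q * T e b q
    + ∑ e, christoffel G e d b q * T a e q + C d a b) q

/-- Leibniz rule. The calculus of `HasCov` and `HasCov₂` splits off the Christoffel terms once and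
for all, so that later computations see only tensors. -/
lemma HasCov.mul {v w : Fin 4 → E4 → ℝ} {C C' : Fin 4 → Fin 4 → ℝ} (hv : HasCov G v C q)
    (hw : HasCov G w C' q) : HasCov₂ G (fun a b y => v a y * w b y)
      (fun d a b => C d a * w b q + v a q * C' d b) q := fun a b =>
  ((hv a).mul (hw b)).congr_grad fun d => by
    simp only [Fin.sum_univ_four]; ring

lemma HasCov₂.mul {T : Fin 4 → Fin 4 → E4 → ℝ} {C : Fin 4 → Fin 4 → Fin 4 → ℝ} {f : E4 → ℝ}
    {f' : Fin 4 → ℝ} (hf : HasGrad f f' q) (hT : HasCov₂ G T C q) :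
    HasCov₂ G (fun a b y => f y * T a b y) (fun d a b => f' d * T a b q + f q * C d a b) q :=
  fun a b => (hf.mul (hT a b)).congr_grad fun d => by
    simp only [Fin.sum_univ_four]; ring

lemma HasCov₂.add {T T' : Fin 4 → Fin 4 → E4 → ℝ} {C C' : Fin 4 → Fin 4 → Fin 4 → ℝ}
    (hT : HasCov₂ G T C q) (hT' : HasCov₂ G T' C' q) :
    HasCov₂ G (fun a b y => T a b y + T' a b y) (fun d a b => C d a b + C' d a b) q :=
  fun a b => ((hT a b).add (hT' a b)).congr_grad fun d => by
    simp only [Fin.sum_univ_four]; ring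

lemma HasCov₂.sub {T T' : Fin 4 → Fin 4 → E4 → ℝ} {C C' : Fin 4 → Fin 4 → Fin 4 → ℝ}
    (hT : HasCov₂ G T C q) (hT' : HasCov₂ G T' C' q) :
    HasCov₂ G (fun a b y => T a b y - T' a b y) (fun d a b => C d a b - C' d a b) q :=
  fun a b => ((hT a b).sub (hT' a b)).congr_grad fun d => by
    simp only [Fin.sum_univ_four]; ring

lemma HasCov₂.congr_of_eventuallyEq {T T' : Fin 4 → Fin 4 → E4 → ℝ}
    {C : Fin 4 → Fin 4 → Fin 4 → ℝ} (hT : HasCov₂ G T C q)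
    (h : ∀ᶠ y in 𝓝 q, ∀ a b, T' a b y = T a b y) : HasCov₂ G T' C q := fun a b =>
  ((hT a b).congr_of_eventuallyEq (h.mono fun y hy => hy a b)).congr_grad fun d => by
    have := h.self_of_nhds
    simp only [this]

lemma IsMetricOn.hasCov_metric (h : IsMetricOn G D) (hq : q ∈ D) :
    HasCov₂ G (fun a b y => G y a b) (fun _ _ _ => 0) q := fun a b =>
  (h.hasGrad_metric hq a b).congr_grad fun d => by simp

/-- The Ricci identity: the obstruction to the integrability of `∂ₐv_b = Γᶜₐ_b v_c + S_ab`. -/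
lemma ricci_identity {v : Fin 4 → E4 → ℝ} {S : Fin 4 → Fin 4 → E4 → ℝ}
    {T : Fin 4 → Fin 4 → Fin 4 → ℝ} (h : IsMetricOn G D) (hq : q ∈ D)
    (hv : HasCov G v (fun a b => S a b q) q) (hS : HasCov₂ G S T q) (d a b : Fin 4) :
    pd d (fun y => ∑ c, christoffel G c a b y * v c y + S a b y) q
      - pd a (fun y => ∑ c, christoffel G c d b y * v c y + S d b y) q
      = ∑ c, riemann G c b d a q * v c q + T d a b - T a d b := by
  have key (a : Fin 4) := (HasGrad.sum (s := Finset.univ) fun c _ =>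
    ((h.contDiffOn_christoffel c a b).hasGrad h.isOpen hq).mul (hv c)).add (hS a b)
  rw [(key a).2 d, (key d).2 a]
  have e (m : Fin 4) := h.christoffel_symm hq m a d
  simp only [riemann, Fin.sum_univ_four, e]
  ring

/-! ### The inner product of covectors -/

/-- `g⁻¹(v, w)` for covectors at `q`. -/
def ip (G : E4 → Matrix (Fin 4) (Fin 4) ℝ) (q : E4) (v w : Fin 4 → ℝ) : ℝ :=
  ∑ a, ∑ b, (G q)⁻¹ a b * v a * w b

lemma ip_eq_dotProduct (v w : Fin 4 → ℝ) : ip G q v w = v ⬝ᵥ ((G q)⁻¹ *ᵥ w) := by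
  simp only [ip, dotProduct, mulVec, Finset.mul_sum]
  exact Finset.sum_congr rfl fun a _ => Finset.sum_congr rfl fun b _ => by ring

lemma ip_add_left (v v' w : Fin 4 → ℝ) :
    ip G q (fun a => v a + v' a) w = ip G q v w + ip G q v' w := by
  simp only [ip, ← Finset.sum_add_distrib]
  exact Finset.sum_congr rfl fun a _ => Finset.sum_congr rfl fun b _ => by ring

lemma ip_sub_left (v v' w : Fin 4 → ℝ) :
    ip G q (fun a => v a - v' a) w = ip G q v w - ip G q v' w := by
  simp only [ip, ← Finset.sum_sub_distrib]
  exact Finset.sum_congr rfl fun a _ => Finset.sum_congr rfl fun b _ => by ring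

lemma ip_mul_left (c : ℝ) (v w : Fin 4 → ℝ) :
    ip G q (fun a => c * v a) w = c * ip G q v w := by
  simp only [ip, Finset.mul_sum]
  exact Finset.sum_congr rfl fun a _ => Finset.sum_congr rfl fun b _ => by ring

lemma ip_add_right (w v v' : Fin 4 → ℝ) :
    ip G q w (fun a => v a + v' a) = ip G q w v + ip G q w v' := by
  simp only [ip, ← Finset.sum_add_distrib]
  exact Finset.sum_congr rfl fun a _ => Finset.sum_congr rfl fun b _ => by ring

lemma ip_sub_right (w v v' : Fin 4 → ℝ) :
    ip G q w (fun a => v a - v' a) = ip G q w v - ip G q w v' := by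
  simp only [ip, ← Finset.sum_sub_distrib]
  exact Finset.sum_congr rfl fun a _ => Finset.sum_congr rfl fun b _ => by ring

lemma ip_mul_right (c : ℝ) (w v : Fin 4 → ℝ) :
    ip G q w (fun a => c * v a) = c * ip G q w v := by
  simp only [ip, Finset.mul_sum]
  exact Finset.sum_congr rfl fun a _ => Finset.sum_congr rfl fun b _ => by ring

lemma IsMetricOn.ip_comm (h : IsMetricOn G D) (hq : q ∈ D) (v w : Fin 4 → ℝ) :
    ip G q v w = ip G q w v := by
  simp only [ip]
  rw [Finset.sum_comm]
  exact Finset.sum_congr rfl fun a _ => Finset.sum_congr rfl fun b _ => by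
    rw [h.inv_symm hq b a]; ring

lemma IsMetricOn.ip_metric_left (h : IsMetricOn G D) (hq : q ∈ D) (d : Fin 4) (w : Fin 4 → ℝ) :
    ip G q (fun a => G q d a) w = w d := by
  simp only [ip]
  rw [Finset.sum_comm]
  have (b : Fin 4) : ∑ a, (G q)⁻¹ a b * G q d a * w b = (if d = b then 1 else 0) * w b := by
    rw [← h.sum_mul_inv hq d b, Finset.sum_mul]
    exact Finset.sum_congr rfl fun a _ => by ring
  simp [this]

lemma IsMetricOn.ip_metric_right (h : IsMetricOn G D) (hq : q ∈ D) (d : Fin 4) (w : Fin 4 → ℝ) :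
    ip G q w (fun a => G q d a) = w d := by
  rw [h.ip_comm hq, h.ip_metric_left hq]

/-- Because ∇g⁻¹ = 0, all Christoffel terms cancel. -/
lemma IsMetricOn.hasGrad_ip (h : IsMetricOn G D) (hq : q ∈ D) {v w : Fin 4 → E4 → ℝ}
    {C C' : Fin 4 → Fin 4 → ℝ} (hv : HasCov G v C q) (hw : HasCov G w C' q) :
    HasGrad (fun y => ip G y (fun a => v a y) (fun a => w a y))
      (fun d => ip G q (C d) (fun a => w a q) + ip G q (fun a => v a q) (C' d)) q := by
  refine (HasGrad.sum (s := Finset.univ) fun a _ => HasGrad.sum (s := Finset.univ) fun b _ =>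
    ((h.hasGrad_inv hq a b).mul (hv a)).mul (hw b)).congr_grad fun d => ?_
  simp only [ip, Fin.sum_univ_four]
  ring

end Cov

end YangPure

end

noncomputable section

namespace YangPure

open Topology Matrix

/-! ### Pseudo-orthonormal frames -/

/-- Any non-null covector of Minkowski space can be completed to a pseudo-orthonormal frame. -/
lemma exists_minkowski_frame (w : Fin 4 → ℝ)
    (hn : -w 0 ^ 2 + w 1 ^ 2 + w 2 ^ 2 + w 3 ^ 2 ≠ 0) :
    ∃ P : Matrix (Fin 4) (Fin 4) ℝ, P 0 = w ∧ P * diagonal ![-1, 1, 1, 1] * Pᵀ =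
      diagonal ![-w 0 ^ 2 + w 1 ^ 2 + w 2 ^ 2 + w 3 ^ 2, 1, 1,
        -Real.sign (-w 0 ^ 2 + w 1 ^ 2 + w 2 ^ 2 + w 3 ^ 2)] := by
  set n := -w 0 ^ 2 + w 1 ^ 2 + w 2 ^ 2 + w 3 ^ 2 with hndef
  rcases lt_or_gt_of_ne hn with hneg | hpos
  -- Timelike case: w is c times the unit vector (g, b). The sign of c is chosen so that g ≥ 0,
  -- which keeps 1 + g away from zero.
  · obtain ⟨c, g, b₁, b₂, b₃, hc, hw, hg, hb⟩ : ∃ c g b₁ b₂ b₃ : ℝ, c ^ 2 = -n ∧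
        w = ![c * g, c * b₁, c * b₂, c * b₃] ∧ 0 ≤ g ∧ g ^ 2 = 1 + b₁ ^ 2 + b₂ ^ 2 + b₃ ^ 2 := by
      obtain ⟨c, hc, hcw⟩ : ∃ c : ℝ, c ^ 2 = -n ∧ 0 ≤ w 0 / c := by
        have hs : √(-n) ^ 2 = -n := Real.sq_sqrt (by linarith)
        rcases le_total 0 (w 0) with h | h
        · exact ⟨√(-n), hs, div_nonneg h (Real.sqrt_nonneg _)⟩
        · exact ⟨-√(-n), by rw [neg_sq, hs], div_nonneg_of_nonpos h
            (neg_nonpos.2 (Real.sqrt_nonneg _))⟩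
      have hc0 : c ≠ 0 := by rintro rfl; simp at hc; linarith
      refine ⟨c, w 0 / c, w 1 / c, w 2 / c, w 3 / c, hc, ?_, hcw, ?_⟩
      · ext i; fin_cases i <;> simp <;> field_simp
      · field_simp; rw [hc, hndef]; ring
    set t := 1 / (1 + g)
    have ht : t * (1 + g) = 1 := by
      have : 1 + g ≠ 0 := by positivity
      simp only [t]; field_simp
    -- The boost with first row (g, b) and spatial block 1 + b bᵀ/(1 + g), its first row scaled by
    -- c.
    refine ⟨of ![w, ![b₁, 1 + b₁ * b₁ * t, b₁ * b₂ * t, b₁ * b₃ * t],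
      ![b₂, b₂ * b₁ * t, 1 + b₂ * b₂ * t, b₂ * b₃ * t],
      ![b₃, b₃ * b₁ * t, b₃ * b₂ * t, 1 + b₃ * b₃ * t]], rfl, ?_⟩
    rw [Real.sign_of_neg hneg]
    have k0 : (2 * t - 1 + t ^ 2 * (b₁ ^ 2 + b₂ ^ 2 + b₃ ^ 2)) = 0 := by
      linear_combination (t * (g - 1) + 1) * ht - t ^ 2 * hb
    have k1 : -g + 1 + t * (b₁ ^ 2 + b₂ ^ 2 + b₃ ^ 2) = 0 := by
      linear_combination (g - 1) * ht - t * hb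
    ext i j
    fin_cases i <;> fin_cases j <;>
      simp [mul_apply, Fin.sum_univ_four, hw, diagonal, Matrix.vecHead, Matrix.vecTail]
    · linear_combination -c ^ 2 * hb - hc
    · linear_combination c * b₁ * k1
    · linear_combination c * b₂ * k1
    · linear_combination c * b₃ * k1
    · linear_combination c * b₁ * k1
    · linear_combination b₁ * b₁ * k0
    · linear_combination b₁ * b₂ * k0
    · linear_combination b₁ * b₃ * k0
    · linear_combination c * b₂ * k1
    · linear_combination b₁ * b₂ * k0
    · linear_combination b₂ * b₂ * k0
    · linear_combination b₂ * b₃ * k0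
    · linear_combination c * b₃ * k1
    · linear_combination b₁ * b₃ * k0
    · linear_combination b₃ * b₂ * k0
    · linear_combination b₃ * b₃ * k0
  -- Spacelike case: the spatial part of w is r times a unit vector n, with the sign of r chosen so
  -- that n₃ ≥ 0.
  · obtain ⟨r, n₁, n₂, n₃, hr, hw, hn3, hu⟩ : ∃ r n₁ n₂ n₃ : ℝ, r ^ 2 - w 0 ^ 2 = n ∧
        w = ![w 0, r * n₁, r * n₂, r * n₃] ∧ 0 ≤ n₃ ∧ n₁ ^ 2 + n₂ ^ 2 + n₃ ^ 2 = 1 := by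
      have hs0 : 0 < w 1 ^ 2 + w 2 ^ 2 + w 3 ^ 2 := by nlinarith [sq_nonneg (w 0)]
      obtain ⟨r, hr, hrw⟩ : ∃ r : ℝ, r ^ 2 = w 1 ^ 2 + w 2 ^ 2 + w 3 ^ 2 ∧ 0 ≤ w 3 / r := by
        have hs := Real.sq_sqrt hs0.le
        rcases le_total 0 (w 3) with h | h
        · exact ⟨_, hs, div_nonneg h (Real.sqrt_nonneg _)⟩
        · exact ⟨-√(w 1 ^ 2 + w 2 ^ 2 + w 3 ^ 2), by rw [neg_sq, hs], div_nonneg_of_nonpos h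
            (neg_nonpos.2 (Real.sqrt_nonneg _))⟩
      have hr0 : r ≠ 0 := by rintro rfl; simp at hr; linarith
      refine ⟨r, w 1 / r, w 2 / r, w 3 / r, by rw [hr, hndef]; ring, ?_, hrw, ?_⟩
      · ext i; fin_cases i <;> simp <;> field_simp
      · field_simp; rw [hr]
    set t := 1 / (1 + n₃)
    have ht : t * (1 + n₃) = 1 := by
      have : 1 + n₃ ≠ 0 := by positivity
      simp only [t]; field_simp
    set m := 1 / √n
    have hm : m ^ 2 * n = 1 := by
      simp only [m, div_pow, Real.sq_sqrt hpos.le]; field_simp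
    have hn' := hndef
    -- Rows two and three complete n to an orthonormal basis of space; the last row is the unit
    -- timelike vector of the plane spanned by e₀ and n that is orthogonal to w.
    refine ⟨of ![w, ![0, 1 - n₁ * n₁ * t, -n₁ * n₂ * t, -n₁],
      ![0, -n₁ * n₂ * t, 1 - n₂ * n₂ * t, -n₂],
      ![m * r, m * (w 0 * n₁), m * (w 0 * n₂), m * (w 0 * n₃)]], rfl, ?_⟩
    rw [Real.sign_of_pos hpos]
    generalize w 0 = w₀ at hw hr
    have k1 : 1 - n₃ - t * (n₁ ^ 2 + n₂ ^ 2) = 0 := by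
      linear_combination (n₃ - 1) * ht - t * hu
    have k2 : 1 - 2 * t + t ^ 2 * (n₁ ^ 2 + n₂ ^ 2) = 0 := by
      linear_combination t ^ 2 * hu + (1 - t + t * n₃) * ht * (-1)
    ext i j
    fin_cases i <;> fin_cases j <;>
      simp [mul_apply, Fin.sum_univ_four, hw, diagonal, Matrix.vecHead, Matrix.vecTail]
    · linear_combination r ^ 2 * hu + hr
    · linear_combination r * n₁ * k1
    · linear_combination r * n₂ * k1
    · linear_combination m * r * w₀ * hu
    · linear_combination r * n₁ * k1
    · linear_combination n₁ ^ 2 * k2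
    · linear_combination n₁ * n₂ * k2
    · linear_combination m * w₀ * n₁ * k1
    · linear_combination r * n₂ * k1
    · linear_combination n₁ * n₂ * k2
    · linear_combination n₂ ^ 2 * k2
    · linear_combination m * w₀ * n₂ * k1
    · linear_combination m * r * w₀ * hu
    · linear_combination m * w₀ * n₁ * k1
    · linear_combination m * w₀ * n₂ * k1
    · linear_combination m ^ 2 * w₀ ^ 2 * hu - m ^ 2 * hr - hm

/-- Any non-null covector can be completed to a pseudo-orthonormal frame of covectors. -/
lemma exists_frame {A Q : Matrix (Fin 4) (Fin 4) ℝ}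
    (hA : Qᵀ * A * Q = diagonal ![-1, 1, 1, 1]) (w : Fin 4 → ℝ) {n : ℝ}
    (hn : w ⬝ᵥ (A⁻¹ *ᵥ w) = n) (hn0 : n ≠ 0) :
    ∃ P : Matrix (Fin 4) (Fin 4) ℝ, P 0 = w ∧
      P * A⁻¹ * Pᵀ = diagonal ![n, 1, 1, -Real.sign n] := by
  have hdet : IsUnit Q.det := by
    have := congrArg det hA
    rw [det_mul, det_mul, det_diagonal, Fin.prod_univ_four] at this
    simp at this
    exact isUnit_iff_ne_zero.2 fun h => by simp [h] at this
  have hdetT : IsUnit Qᵀ.det := by rwa [det_transpose]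
  have hη : (diagonal ![-1, 1, 1, 1] : Matrix (Fin 4) (Fin 4) ℝ) * diagonal ![-1, 1, 1, 1] = 1 := by
    rw [diagonal_mul_diagonal, ← diagonal_one]
    congr 1; ext i; fin_cases i <;> simp
  have hinv : A⁻¹ = Q * diagonal ![-1, 1, 1, 1] * Qᵀ := by
    apply inv_eq_right_inv
    have h1 : A = Qᵀ⁻¹ * diagonal ![-1, 1, 1, 1] * Q⁻¹ := by
      rw [← hA, Matrix.mul_assoc Qᵀ, nonsing_inv_mul_cancel_left _ _ hdetT,
        mul_nonsing_inv_cancel_right _ _ hdet]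
    rw [h1]
    calc _ = Qᵀ⁻¹ * (diagonal ![-1, 1, 1, 1] * (Q⁻¹ * Q) * diagonal ![-1, 1, 1, 1]) * Qᵀ := by
            simp only [Matrix.mul_assoc]
      _ = 1 := by
        rw [nonsing_inv_mul _ hdet, Matrix.mul_one, hη, Matrix.mul_one, nonsing_inv_mul _ hdetT]
  set w' := w ᵥ* Q with hw'
  have hnw : -w' 0 ^ 2 + w' 1 ^ 2 + w' 2 ^ 2 + w' 3 ^ 2 = n := by
    rw [← hn, hinv, dotProduct_mulVec, ← vecMul_vecMul, ← vecMul_vecMul, ← hw',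
      ← dotProduct_mulVec, mulVec_transpose, ← hw']
    simp [dotProduct, Fin.sum_univ_four, vecMul_diagonal]
    ring
  obtain ⟨P, hP0, hP⟩ := exists_minkowski_frame w' (by rw [hnw]; exact hn0)
  rw [hnw] at hP
  refine ⟨P * Q⁻¹, ?_, ?_⟩
  · have : (P * Q⁻¹) 0 = P 0 ᵥ* Q⁻¹ := rfl
    rw [this, hP0, hw', vecMul_vecMul, mul_nonsing_inv _ hdet, vecMul_one]
  · rw [hinv, transpose_mul, ← hP]
    calc _ = P * (Q⁻¹ * Q) * diagonal ![-1, 1, 1, 1] * (Qᵀ * Q⁻¹ᵀ) * Pᵀ := by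
            simp only [Matrix.mul_assoc]
      _ = _ := by
        rw [nonsing_inv_mul _ hdet, ← transpose_mul, nonsing_inv_mul _ hdet]
        simp [Matrix.mul_assoc]

/-! ### Ricci-flat algebraic curvature tensors with a non-null nullity direction vanish -/

/-- In a frame: the spatial part is a three-dimensional Ricci-flat curvature tensor. -/
lemma curvature_eq_zero_of_frame {T : Fin 4 → Fin 4 → Fin 4 → Fin 4 → ℝ} {d : Fin 4 → ℝ}
    (hd : ∀ i, d i ≠ 0)
    (h12 : ∀ k l m n, T l k m n = -T k l m n) (h34 : ∀ k l m n, T k l n m = -T k l m n)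
    (hcyc : ∀ k l m n, T k l m n + T k m n l + T k n l m = 0)
    (h0 : ∀ l m n, T 0 l m n = 0) (hric : ∀ l n, ∑ k, d k * T k l k n = 0) (k l m n : Fin 4) :
    T k l m n = 0 := by
  have h0' (k m n) : T k 0 m n = 0 := by rw [h12, h0, neg_zero]
  have h00 (k l n) : T k l 0 n = 0 := by
    have hs (k l n) : T k l 0 n = T k n 0 l := by
      have h1 := hcyc k l 0 n
      rw [h0', h34 k n 0 l] at h1
      linarith
    linarith [hs k l n, h12 k n 0 l, hs n k l, h12 n l 0 k, hs l n k, h12 l k 0 n]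
  have h00' (k l m) : T k l m 0 = 0 := by rw [h34, h00, neg_zero]
  have hz (k m n) : T k k m n = 0 := by linarith [h12 k k m n]
  have hz' (k l m) : T k l m m = 0 := by linarith [h34 k l m m]
  have hric' (l n) : d 1 * T 1 l 1 n + d 2 * T 2 l 2 n + d 3 * T 3 l 3 n = 0 := by
    have := hric l n
    rw [Fin.sum_univ_four, h0] at this
    linarith
  have f (k l m n) : T l k n m = T k l m n := by rw [h12, h34, neg_neg]
  have r11 := hric' 1 1
  have r22 := hric' 2 2
  have r33 := hric' 3 3
  have r12 := hric' 1 2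
  have r21 := hric' 2 1
  have r13 := hric' 1 3
  have r31 := hric' 3 1
  have r23 := hric' 2 3
  have r32 := hric' 3 2
  simp only [hz, hz', mul_zero, zero_add, add_zero, mul_eq_zero, hd, false_or]  at r11 r22 r33 r12 r21 r13
  simp only [hz, hz', mul_zero, zero_add, add_zero, mul_eq_zero, hd, false_or] at r31 r23 r32
  rw [f 1 2 1 2, f 1 3 1 3] at r11
  rw [f 2 3 2 3] at r22
  -- The three diagonal Ricci equations form an invertible linear system for the three sectional
  -- components.
  have a : T 1 2 1 2 = 0 := by
    have : 2 * (d 1 * d 2) * T 1 2 1 2 = 0 := by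
      linear_combination d 1 * r11 + d 2 * r22 - d 3 * r33
    simpa [hd] using this
  have b : T 1 3 1 3 = 0 := by simpa [a, hd] using r11
  have c : T 2 3 2 3 = 0 := by simpa [a, hd] using r22
  have t12 (m n) : T 1 2 m n = 0 := by
    fin_cases m <;> fin_cases n <;>
      simp [h00, h00', hz', a, r23, h34 1 2 1 2, h34 1 2 1 3, h34 1 2 2 3]
    all_goals linarith [h12 1 2 2 3, h34 1 2 1 3, h34 1 2 2 3]
  have t13 (m n) : T 1 3 m n = 0 := by
    fin_cases m <;> fin_cases n <;>
      simp [h00, h00', hz', b, r32, h34 1 3 1 2, h34 1 3 1 3, h34 1 3 2 3]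
    all_goals linarith [f 1 3 2 3, h34 1 3 2 3]
  have t23 (m n) : T 2 3 m n = 0 := by
    fin_cases m <;> fin_cases n <;>
      simp [h00, h00', hz', c, h34 2 3 1 2, h34 2 3 1 3, h34 2 3 2 3]
    all_goals linarith [f 2 3 1 3, h34 2 3 1 3, h34 2 3 1 2]
  fin_cases k <;> fin_cases l <;>
    simp [h0, h0', hz, t12, t13, t23, h12 1 2, h12 1 3, h12 2 3]

/-- An algebraic curvature tensor which is Ricci-flat and annihilated by a non-null covector
vanishes in dimension four. -/
lemma curvature_eq_zero {A P : Matrix (Fin 4) (Fin 4) ℝ} {d : Fin 4 → ℝ} (hd : ∀ i, d i ≠ 0)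
    (hP : P * A * Pᵀ = diagonal d) {T : Fin 4 → Fin 4 → Fin 4 → Fin 4 → ℝ}
    (h12 : ∀ k l m n, T l k m n = -T k l m n) (h34 : ∀ k l m n, T k l n m = -T k l m n)
    (hcyc : ∀ k l m n, T k l m n + T k m n l + T k n l m = 0)
    (h0 : ∀ l m n, ∑ c, (∑ e, A c e * P 0 e) * T c l m n = 0)
    (hric : ∀ l n, ∑ c, ∑ e, A c e * T c l e n = 0) (k l m n : Fin 4) :
    T k l m n = 0 := by
  have hD : IsUnit (diagonal d).det := by
    rw [det_diagonal]; exact isUnit_iff_ne_zero.2 (Finset.prod_ne_zero_iff.2 fun i _ => hd i)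
  have hAP : IsUnit (A * Pᵀ).det := by
    have := congrArg det hP
    rw [Matrix.mul_assoc, det_mul] at this
    exact isUnit_of_mul_isUnit_right (this ▸ hD)
  have hPd : IsUnit P.det := by
    have := congrArg det hP
    rw [Matrix.mul_assoc, det_mul] at this
    exact isUnit_of_mul_isUnit_left (this ▸ hD)
  -- The columns of `E` are the covectors of the frame with raised indices; `S` below collects the
  -- components of `T` along them.
  set E := A * Pᵀ with hE
  have hcomp : E * diagonal (fun i => (d i)⁻¹) * Eᵀ = Aᵀ := by
    have h1 : diagonal d * diagonal (fun i => (d i)⁻¹) = 1 := by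
      rw [diagonal_mul_diagonal, ← diagonal_one]; congr 1; ext i; simp [hd i]
    have h2 : P * E = diagonal d := by rw [hE, ← Matrix.mul_assoc, hP]
    have h3 : P * (E * diagonal (fun i => (d i)⁻¹)) = 1 := by rw [← Matrix.mul_assoc, h2, h1]
    have h4 : E * diagonal (fun i => (d i)⁻¹) * P = 1 := by
      rwa [mul_eq_one_comm] at h3
    rw [hE, transpose_mul, transpose_transpose, ← hE, ← Matrix.mul_assoc, h4, Matrix.one_mul]
  have hcomp' (c e : Fin 4) : ∑ k, (d k)⁻¹ * E c k * E e k = A c e := by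
    have := congrFun (congrFun hcomp e) c
    rw [transpose_apply, mul_apply] at this
    rw [← this]
    refine Finset.sum_congr rfl fun k _ => ?_
    rw [mul_diagonal, transpose_apply]; ring
  have hE0 {t : Fin 4 → ℝ} (ht : ∀ k, ∑ c, E c k * t c = 0) (c : Fin 4) : t c = 0 := by
    have : Eᵀ *ᵥ t = 0 := by ext k; exact ht k
    have h2 : (Eᵀ)⁻¹ *ᵥ (Eᵀ *ᵥ t) = 0 := by rw [this, mulVec_zero]
    rw [mulVec_mulVec, nonsing_inv_mul _ (by rwa [det_transpose]), one_mulVec] at h2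
    rw [h2]; rfl
  set S : Fin 4 → Fin 4 → Fin 4 → Fin 4 → ℝ := fun k l m n =>
    ∑ c, ∑ b, ∑ i, ∑ j, E c k * (E b l * (E i m * (E j n * T c b i j))) with hS
  have hSz (k l m n) : S k l m n = 0 := by
    refine curvature_eq_zero_of_frame (d := fun i => (d i)⁻¹) (fun i => inv_ne_zero (hd i))
      ?_ ?_ ?_ ?_ ?_ k l m n
    · intro k l m n
      simp only [hS, ← Finset.sum_neg_distrib]
      rw [Finset.sum_comm]
      refine Finset.sum_congr rfl fun c _ => Finset.sum_congr rfl fun b _ =>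
        Finset.sum_congr rfl fun i _ => Finset.sum_congr rfl fun j _ => ?_
      rw [h12 c b]; ring
    · intro k l m n
      simp only [hS, ← Finset.sum_neg_distrib]
      refine Finset.sum_congr rfl fun c _ => Finset.sum_congr rfl fun b _ => ?_
      rw [Finset.sum_comm]
      refine Finset.sum_congr rfl fun i _ => Finset.sum_congr rfl fun j _ => ?_
      rw [h34 c b i j]; ring
    · intro k l m n
      have e1 : S k m n l = ∑ c, ∑ b, ∑ i, ∑ j,
          E c k * (E b l * (E i m * (E j n * T c i j b))) := by
        refine Finset.sum_congr rfl fun c _ => ?_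
        calc _ = ∑ i, ∑ b, ∑ j, E c k * (E i m * (E j n * (E b l * T c i j b))) :=
              Finset.sum_congr rfl fun i _ => Finset.sum_comm
          _ = _ := by
              rw [Finset.sum_comm]
              refine Finset.sum_congr rfl fun b _ => Finset.sum_congr rfl fun i _ =>
                Finset.sum_congr rfl fun j _ => by ring
      have e2 : S k n l m = ∑ c, ∑ b, ∑ i, ∑ j,
          E c k * (E b l * (E i m * (E j n * T c j b i))) := by
        refine Finset.sum_congr rfl fun c _ => ?_
        rw [Finset.sum_comm]
        refine Finset.sum_congr rfl fun b _ => ?_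
        rw [Finset.sum_comm]
        refine Finset.sum_congr rfl fun i _ => Finset.sum_congr rfl fun j _ => by ring
      rw [e1, e2]
      simp only [hS, ← Finset.sum_add_distrib, ← mul_add, hcyc, mul_zero, Finset.sum_const_zero]
    · intro l m n
      have : S 0 l m n = ∑ b, ∑ i, ∑ j, E b l * (E i m * (E j n *
          ∑ c, (∑ e, A c e * P 0 e) * T c b i j)) := by
        simp only [hS, Finset.mul_sum]
        rw [Finset.sum_comm]
        refine Finset.sum_congr rfl fun b _ => ?_
        rw [Finset.sum_comm]
        refine Finset.sum_congr rfl fun i _ => ?_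
        rw [Finset.sum_comm]
        refine Finset.sum_congr rfl fun j _ => Finset.sum_congr rfl fun c _ => ?_
        have : E c 0 = ∑ e, A c e * P 0 e := rfl
        rw [this]; ring
      simp only [this, h0, mul_zero, Finset.sum_const_zero]
    · intro l n
      have : ∑ k, (d k)⁻¹ * S k l k n = ∑ b, ∑ j, E b l * (E j n *
          ∑ i, ∑ c, A c i * T c b i j) := by
        simp only [← hcomp', hS, Finset.mul_sum, Finset.sum_mul]
        calc _ = ∑ k, ∑ b, ∑ j, ∑ i, ∑ c, (d k)⁻¹ *
                (E c k * (E b l * (E i k * (E j n * T c b i j)))) := by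
              refine Finset.sum_congr rfl fun k _ => ?_
              rw [Finset.sum_comm]
              refine Finset.sum_congr rfl fun b _ => ?_
              calc _ = ∑ c, ∑ j, ∑ i, (d k)⁻¹ *
                    (E c k * (E b l * (E i k * (E j n * T c b i j)))) :=
                    Finset.sum_congr rfl fun c _ => Finset.sum_comm
                _ = _ := by
                    rw [Finset.sum_comm]
                    exact Finset.sum_congr rfl fun j _ => Finset.sum_comm
          _ = ∑ b, ∑ j, ∑ k, ∑ i, ∑ c, (d k)⁻¹ *
                (E c k * (E b l * (E i k * (E j n * T c b i j)))) := by
              rw [Finset.sum_comm]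
              exact Finset.sum_congr rfl fun b _ => Finset.sum_comm
          _ = _ := by
              refine Finset.sum_congr rfl fun b _ => Finset.sum_congr rfl fun j _ => ?_
              rw [Finset.sum_comm]
              refine Finset.sum_congr rfl fun i _ => ?_
              rw [Finset.sum_comm]
              refine Finset.sum_congr rfl fun c _ => Finset.sum_congr rfl fun k _ => by ring
      rw [this]
      refine Finset.sum_eq_zero fun b _ => Finset.sum_eq_zero fun j _ => ?_
      rw [Finset.sum_comm, hric b j]; ring
  -- `E` is invertible, so its four factors are stripped off one at a time.
  have s1 (c l m n) : ∑ b, E b l * ∑ i, E i m * ∑ j, E j n * T c b i j = 0 := by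
    refine hE0 (t := fun c => ∑ b, E b l * ∑ i, E i m * ∑ j, E j n * T c b i j) (fun k => ?_) c
    rw [← hSz k l m n]
    simp only [hS, Finset.mul_sum]
  have s2 (c b m n) : ∑ i, E i m * ∑ j, E j n * T c b i j = 0 := hE0 (fun l => s1 c l m n) b
  have s3 (c b i n) : ∑ j, E j n * T c b i j = 0 := hE0 (fun m => s2 c b m n) i
  exact hE0 (fun n' => s3 k l m n') n

end YangPure

end

/-! ### Contractions, Hessians and the field equations in coordinates -/

noncomputable section

namespace YangPure

open Topology Matrix

section Contraction

variable {G : E4 → Matrix (Fin 4) (Fin 4) ℝ} {D : Set E4} {q : E4}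

/-- The covector `v` with its index raised. -/
def raise (G : E4 → Matrix (Fin 4) (Fin 4) ℝ) (q : E4) (v : Fin 4 → ℝ) (a : Fin 4) : ℝ :=
  ∑ b, (G q)⁻¹ a b * v b

/-- The trace of a covariant 2-tensor. -/
def trace₂ (G : E4 → Matrix (Fin 4) (Fin 4) ℝ) (q : E4) (T : Fin 4 → Fin 4 → ℝ) : ℝ :=
  ∑ a, ∑ b, (G q)⁻¹ a b * T a b

lemma trace₂_add (T T' : Fin 4 → Fin 4 → ℝ) :
    trace₂ G q (fun a b => T a b + T' a b) = trace₂ G q T + trace₂ G q T' := by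
  simp only [trace₂, mul_add, Finset.sum_add_distrib]

lemma trace₂_sub (T T' : Fin 4 → Fin 4 → ℝ) :
    trace₂ G q (fun a b => T a b - T' a b) = trace₂ G q T - trace₂ G q T' := by
  simp only [trace₂, mul_sub, Finset.sum_sub_distrib]

lemma trace₂_smul (c : ℝ) (T : Fin 4 → Fin 4 → ℝ) :
    trace₂ G q (fun a b => c * T a b) = c * trace₂ G q T := by
  simp only [trace₂, Finset.mul_sum]
  exact Finset.sum_congr rfl fun a _ => Finset.sum_congr rfl fun b _ => by ring

lemma trace₂_mul (v w : Fin 4 → ℝ) : trace₂ G q (fun a b => v a * w b) = ip G q v w := by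
  simp only [trace₂, ip, mul_assoc]

namespace IsMetricOn

lemma trace₂_metric (h : IsMetricOn G D) (hq : q ∈ D) :
    trace₂ G q (fun a b => G q a b) = 4 := by
  have (a : Fin 4) : ∑ b, (G q)⁻¹ a b * G q a b = 1 := by
    have := h.sum_inv_mul hq a a
    simp only [h.symm q hq a] at *
    simpa using this
  simp [trace₂, this]

lemma sum_raise_mul (h : IsMetricOn G D) (hq : q ∈ D) (v w : Fin 4 → ℝ) :
    ∑ a, raise G q v a * w a = ip G q v w := by
  rw [h.ip_comm hq]
  simp only [raise, ip, Finset.sum_mul]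
  exact Finset.sum_congr rfl fun a _ => Finset.sum_congr rfl fun b _ => by ring

lemma sum_raise_metric (h : IsMetricOn G D) (hq : q ∈ D) (v : Fin 4 → ℝ) (l : Fin 4) :
    ∑ a, raise G q v a * G q a l = v l := by
  rw [h.sum_raise_mul hq v fun a => G q a l]
  simp only [h.symm q hq _ l]
  exact h.ip_metric_right hq l v

end IsMetricOn

/-- The curvature tensor with all indices lowered. -/
def lowRiemann (G : E4 → Matrix (Fin 4) (Fin 4) ℝ) (q : E4) (c b i j : Fin 4) : ℝ :=
  ∑ l, G q c l * riemann G l b i j q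

namespace IsMetricOn

lemma sum_raise_lowRiemann (h : IsMetricOn G D) (hq : q ∈ D) (v : Fin 4 → ℝ) (b i j : Fin 4) :
    ∑ c, raise G q v c * lowRiemann G q c b i j = ∑ c, riemann G c b i j q * v c := by
  simp only [lowRiemann, Finset.mul_sum]
  rw [Finset.sum_comm]
  refine Finset.sum_congr rfl fun l _ => ?_
  conv_rhs => rw [← h.sum_raise_metric hq v l, Finset.mul_sum]
  exact Finset.sum_congr rfl fun c _ => by ring

lemma lowRiemann_antisymm (h : IsMetricOn G D) (hq : q ∈ D) (c b i j : Fin 4) :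
    lowRiemann G q b c i j = -lowRiemann G q c b i j :=
  h.lower_riemann_antisymm hq c b i j

lemma lowRiemann_swap (c b i j : Fin 4) :
    lowRiemann G q c b j i = -lowRiemann G q c b i j := by
  simp only [lowRiemann, riemann_swap G _ b i j, mul_neg, Finset.sum_neg_distrib]

lemma lowRiemann_cyclic (h : IsMetricOn G D) (hq : q ∈ D) (c b i j : Fin 4) :
    lowRiemann G q c b i j + lowRiemann G q c i j b + lowRiemann G q c j b i = 0 := by
  simp only [lowRiemann, ← Finset.sum_add_distrib, ← mul_add, h.first_bianchi hq, mul_zero,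
    Finset.sum_const_zero]

lemma trace_lowRiemann (h : IsMetricOn G D) (hq : q ∈ D) (b j : Fin 4) :
    trace₂ G q (fun c i => lowRiemann G q c b i j) = ricci G b j q := by
  have (i : Fin 4) : ∑ c, (G q)⁻¹ c i * lowRiemann G q c b i j = riemann G i b i j q := by
    simp only [lowRiemann, Finset.mul_sum]
    rw [Finset.sum_comm]
    have (l : Fin 4) : ∑ c, (G q)⁻¹ c i * (G q c l * riemann G l b i j q)
        = (if i = l then 1 else 0) * riemann G l b i j q := by
      rw [← h.sum_inv_mul hq, Finset.sum_mul]
      exact Finset.sum_congr rfl fun c _ => by rw [h.inv_symm hq c i]; ring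
    simp [this]
  rw [trace₂, Finset.sum_comm]
  simp only [this, ricci]

end IsMetricOn

lemma ip_mul_right' (c : ℝ) (w v : Fin 4 → ℝ) :
    ip G q w (fun a => v a * c) = ip G q w v * c := by
  simp only [mul_comm _ c, ip_mul_right]

/-! ### The Hessian of a function -/

/-- The Hessian `∇ₐ∇_bφ`. -/
def hess (G : E4 → Matrix (Fin 4) (Fin 4) ℝ) (φ : E4 → ℝ) (a b : Fin 4) (y : E4) : ℝ :=
  pd a (pd b φ) y - ∑ c, christoffel G c a b y * pd c φ y

/-- The wave operator `∇ₐ∇ᵃφ`. -/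
def box (G : E4 → Matrix (Fin 4) (Fin 4) ℝ) (φ : E4 → ℝ) (y : E4) : ℝ :=
  trace₂ G y fun a b => hess G φ a b y

namespace IsMetricOn

variable {φ : E4 → ℝ}

lemma hasCov_pd (h : IsMetricOn G D) (hq : q ∈ D) (hφ : ContDiffOn ℝ ∞ φ D) :
    HasCov G (fun b => pd b φ) (fun a b => hess G φ a b q) q := fun b =>
  ((contDiffOn_pd h.isOpen hφ b).hasGrad h.isOpen hq).congr_grad fun a => by
    simp only [hess]; ring

lemma hess_symm (h : IsMetricOn G D) (hq : q ∈ D) (hφ : ContDiffOn ℝ ∞ φ D) (a b : Fin 4) :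
    hess G φ a b q = hess G φ b a q := by
  simp only [hess]
  rw [pd_comm (hφ.contDiffAt (h.isOpen.mem_nhds hq)) a b]
  congr 1
  exact Finset.sum_congr rfl fun c _ => by rw [h.christoffel_symm hq c a b]

lemma hasGrad_gradSq (h : IsMetricOn G D) (hq : q ∈ D) (hφ : ContDiffOn ℝ ∞ φ D) :
    HasGrad (coordGradSq G φ)
      (fun d => 2 * ip G q (fun a => pd a φ q) (fun a => hess G φ d a q)) q :=
  (h.hasGrad_ip hq (h.hasCov_pd hq hφ) (h.hasCov_pd hq hφ)).congr_grad fun d => by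
    rw [h.ip_comm hq]; ring

lemma contDiffOn_hess (h : IsMetricOn G D) (hφ : ContDiffOn ℝ ∞ φ D) (a b : Fin 4) :
    ContDiffOn ℝ ∞ (hess G φ a b) D :=
  (contDiffOn_pd h.isOpen (contDiffOn_pd h.isOpen hφ b) a).sub
    (ContDiffOn.sum fun c _ => (h.contDiffOn_christoffel c a b).mul (contDiffOn_pd h.isOpen hφ c))

lemma contDiffOn_box (h : IsMetricOn G D) (hφ : ContDiffOn ℝ ∞ φ D) :
    ContDiffOn ℝ ∞ (box G φ) D := by
  unfold box trace₂
  exact ContDiffOn.sum fun a _ => ContDiffOn.sum fun b _ =>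
    (h.smooth_inv a b).mul (h.contDiffOn_hess hφ a b)

lemma contDiffOn_gradSq (h : IsMetricOn G D) (hφ : ContDiffOn ℝ ∞ φ D) :
    ContDiffOn ℝ ∞ (coordGradSq G φ) D :=
  ContDiffOn.sum fun a _ => ContDiffOn.sum fun b _ =>
    ((h.smooth_inv a b).mul (contDiffOn_pd h.isOpen hφ a)).mul (contDiffOn_pd h.isOpen hφ b)

lemma contDiffOn_scalar (h : IsMetricOn G D) : ContDiffOn ℝ ∞ (coordScalar G) D :=
  ContDiffOn.sum fun a _ => ContDiffOn.sum fun b _ =>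
    (h.smooth_inv a b).mul (h.contDiffOn_ricci a b)

lemma hasGrad_raise (h : IsMetricOn G D) (hq : q ∈ D) (hφ : ContDiffOn ℝ ∞ φ D) (m : Fin 4) :
    HasGrad (fun y => raise G y (fun a => pd a φ y) m)
      (fun j => raise G q (fun a => hess G φ j a q) m
        - ∑ n, christoffel G m j n q * raise G q (fun a => pd a φ q) n) q :=
  (HasGrad.sum (s := Finset.univ) fun n _ =>
    (h.hasGrad_inv hq m n).mul (h.hasCov_pd hq hφ n)).congr_grad fun j => by
    simp only [raise, Fin.sum_univ_four]; ring

end IsMetricOn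

end Contraction

/-! ### Yang pure spaces generated by a scalar field, in coordinates -/

/-- The field equations in a coordinate domain `D`; `W` is the potential along the field `φ`. -/
structure ScalarYangOn (G : E4 → Matrix (Fin 4) (Fin 4) ℝ) (φ W : E4 → ℝ) (D : Set E4) : Prop
    extends IsMetricOn G D where
  lorentz : ∀ y ∈ D, ∃ Q : Matrix (Fin 4) (Fin 4) ℝ, Qᵀ * G y * Q = diagonal ![-1, 1, 1, 1]
  field : ContDiffOn ℝ ∞ φ D
  einstein : ∀ y ∈ D, ∀ a b, ricci G a b y - (1 / 2) * coordScalar G y * G y a b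
    = pd a φ y * pd b φ y - G y a b * ((1 / 2) * coordGradSq G φ y - W y)
  yang : ∀ y ∈ D, ∀ a b c, covRicci G a b c y = covRicci G b a c y
  grad_ne_zero : ∀ y ∈ D, coordGradSq G φ y ≠ 0

namespace ScalarYangOn

variable {G : E4 → Matrix (Fin 4) (Fin 4) ℝ} {D : Set E4} {q : E4} {φ W : E4 → ℝ}

/-- The trace of Einstein's equation; the trace 4 of the metric is where the dimension enters. -/
lemma scalar_eq (h : ScalarYangOn G φ W D) (hq : q ∈ D) :
    coordScalar G q = coordGradSq G φ q - 4 * W q := by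
  have h1 : trace₂ G q (fun a b => ricci G a b q - (1 / 2) * coordScalar G q * G q a b)
      = trace₂ G q (fun a b => pd a φ q * pd b φ q
        - ((1 / 2) * coordGradSq G φ q - W q) * G q a b) := by
    congr 1; ext a b; rw [h.einstein q hq a b]; ring
  have h4 (c : ℝ) : trace₂ G q (fun a b => c * G q a b) = c * 4 :=
    (trace₂_smul c _).trans (by rw [h.trace₂_metric hq])
  rw [trace₂_sub, trace₂_sub, h4, h4, trace₂_mul] at h1
  have h2 : trace₂ G q (fun a b => ricci G a b q) = coordScalar G q := rfl
  have h3 : ip G q (fun a => pd a φ q) (fun a => pd a φ q) = coordGradSq G φ q := rfl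
  rw [h2, h3] at h1
  linarith

lemma ricci_eq (h : ScalarYangOn G φ W D) (hq : q ∈ D) (a b : Fin 4) :
    ricci G a b q = pd a φ q * pd b φ q - W q * G q a b := by
  have := h.einstein q hq a b
  rw [h.scalar_eq hq] at this
  linear_combination this

/-- Nothing is assumed about the regularity of the potential: its smoothness along the field is
inherited from N and R through the trace equation. -/
lemma contDiffOn_potential (h : ScalarYangOn G φ W D) : ContDiffOn ℝ ∞ W D :=
  (((h.contDiffOn_gradSq h.field).sub h.contDiffOn_scalar).div_const 4).congr fun y hy => by
    simp only [h.scalar_eq hy]; ring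

/-- The equation of motion of the field. For Ric = dφ⊗dφ - W g the divergence is □φ dφ + ½dN - dW,
and the contracted Bianchi identity equates it with ½dR = ½dN - 2dW. -/
lemma potential_grad (h : ScalarYangOn G φ W D) (hq : q ∈ D) (i : Fin 4) :
    pd i W q = -box G φ q * pd i φ q := by
  have hW := h.contDiffOn_potential.hasGrad h.isOpen hq
  set u := raise G q fun a => pd a φ q with hu
  have hmix (m j : Fin 4) : ∀ y ∈ D, IsMetricOn.mixedRicci G m j y
      = raise G y (fun a => pd a φ y) m * pd j φ y - (if m = j then 1 else 0) * W y := by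
    intro y hy
    have : (if m = j then (1 : ℝ) else 0) = ∑ n, (G y)⁻¹ m n * G y n j := (h.sum_inv_mul hy m j).symm
    rw [this]
    simp only [IsMetricOn.mixedRicci, h.ricci_eq hy, raise, Finset.sum_mul,
      ← Finset.sum_sub_distrib]
    exact Finset.sum_congr rfl fun n _ => by rw [h.inv_symm hy n m]; ring
  have hgm (m j : Fin 4) : HasGrad (IsMetricOn.mixedRicci G m j) (fun a =>
      (raise G q (fun b => hess G φ a b q) m - ∑ n, christoffel G m a n q * u n) * pd j φ q
        + u m * (∑ c, christoffel G c a j q * pd c φ q + hess G φ a j q)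
        - (if m = j then 1 else 0) * pd a W q) q :=
    (((h.hasGrad_raise hq h.field m).mul (h.hasCov_pd hq h.field j)).sub
      (hW.const_mul (if m = j then 1 else 0))).congr_of_eventuallyEq
      (Filter.eventuallyEq_of_mem (h.isOpen.mem_nhds hq) (hmix m j))
  have hR : HasGrad (coordScalar G) (fun d => 2 * ip G q (fun a => pd a φ q)
      (fun a => hess G φ d a q) - 4 * pd d W q) q :=
    ((h.hasGrad_gradSq hq h.field).sub (hW.const_mul 4)).congr_of_eventuallyEq
      (Filter.eventuallyEq_of_mem (h.isOpen.mem_nhds hq) fun y hy => h.scalar_eq hy)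
  have hB := h.contracted_bianchi hq i
  simp only [(hgm _ _).2, hmix _ _ q hq, hR.2] at hB
  rw [← h.sum_raise_mul hq, ← hu] at hB
  have hbox : box G φ q = ∑ j, raise G q (fun b => hess G φ j b q) j := rfl
  rw [hbox]
  simp only [mul_sub, sub_mul, mul_add, Finset.sum_sub_distrib, Finset.sum_add_distrib, ite_mul,
    one_mul, zero_mul, mul_ite, mul_zero, Finset.sum_ite_eq',
    Finset.mem_univ, if_true, h.hess_symm hq h.field _ i, h.christoffel_symm hq _ _ i] at hB
  have e1 : ∑ x, (∑ n, christoffel G x x n q * u n) * pd i φ q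
      = ∑ x, ∑ n, christoffel G x x n q * (u n * pd i φ q) := by
    simp only [Finset.sum_mul, mul_assoc]
  have e2 : ∑ x, u x * ∑ c, christoffel G c i x q * pd c φ q
      = ∑ c, ∑ x, christoffel G c i x q * (u x * pd c φ q) := by
    simp only [Finset.mul_sum]
    rw [Finset.sum_comm]
    exact Finset.sum_congr rfl fun c _ => Finset.sum_congr rfl fun x _ => by ring
  rw [e1, e2] at hB
  rw [neg_mul, Finset.sum_mul]
  linarith

end ScalarYangOn

end YangPure

end

/-! ### Yang's equation: the Hessian of the field and the full curvature -/

noncomputable section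

namespace YangPure

open Topology Matrix

/-- The function `μ = -□φ / ∇φ²`. -/
def hessCoeff (G : E4 → Matrix (Fin 4) (Fin 4) ℝ) (φ : E4 → ℝ) (y : E4) : ℝ :=
  -box G φ y / coordGradSq G φ y

lemma covRicci_eq {G : E4 → Matrix (Fin 4) (Fin 4) ℝ} {q : E4} {C : Fin 4 → Fin 4 → Fin 4 → ℝ}
    (h : HasCov₂ G (ricci G) C q) (a b c : Fin 4) : covRicci G a b c q = C a b c := by
  rw [covRicci, (h b c).2 a, Finset.sum_add_distrib]; ring

namespace ScalarYangOn

variable {G : E4 → Matrix (Fin 4) (Fin 4) ℝ} {D : Set E4} {q : E4} {φ W : E4 → ℝ}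

/-- Yang's equation in terms of the Hessian of the field. -/
lemma yang_hess (h : ScalarYangOn G φ W D) (hq : q ∈ D) (a b c : Fin 4) :
    pd b φ q * hess G φ a c q - pd a φ q * hess G φ b c q
      = -box G φ q * (pd a φ q * G q b c - pd b φ q * G q a c) := by
  have hφ := h.hasCov_pd hq h.field
  have hC := ((hφ.mul hφ).sub ((h.hasCov_metric hq).mul
    (h.contDiffOn_potential.hasGrad h.isOpen hq))).congr_of_eventuallyEq (T' := ricci G)
    (Filter.eventually_of_mem (h.isOpen.mem_nhds hq) fun y hy a b => h.ricci_eq hy a b)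
  have := h.yang q hq a b c
  -- Here ∇ₐR_bc = H_ab φ_c + φ_b H_ac - ∂ₐW g_bc, and the first term drops out by symmetry of H.
  rw [covRicci_eq hC, covRicci_eq hC, h.potential_grad hq, h.potential_grad hq,
    h.hess_symm hq h.field b a] at this
  linear_combination this

/-- The trace of Yang's equation over b, c: the gradient is an eigenvector of the Hessian. -/
lemma ip_hess (h : ScalarYangOn G φ W D) (hq : q ∈ D) (a : Fin 4) :
    ip G q (fun b => pd b φ q) (fun b => hess G φ a b q) = -2 * box G φ q * pd a φ q := by
  -- `g` is the metric as a tensor to be contracted, kept apart from the `G` that does the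
  -- contracting.
  obtain ⟨g, hg⟩ : ∃ g : Fin 4 → Fin 4 → ℝ, ∀ a b, G q a b = g a b := ⟨_, fun _ _ => rfl⟩
  have h1 : trace₂ G q (fun b c => pd b φ q * hess G φ a c q - pd a φ q * hess G φ b c q)
      = trace₂ G q (fun b c => -box G φ q * (pd a φ q * g b c - pd b φ q * g a c)) := by
    congr 1; ext b c; rw [h.yang_hess hq a b c, hg, hg]
  have e1 : trace₂ G q (fun b c => g b c) = 4 := by simp only [← hg, h.trace₂_metric hq]
  have e2 : ip G q (fun b => pd b φ q) (fun b => g a b) = pd a φ q := by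
    simp only [← hg]; exact h.ip_metric_right hq a _
  have e3 : trace₂ G q (fun b c => hess G φ b c q) = box G φ q := rfl
  rw [trace₂_sub, trace₂_mul, trace₂_smul, trace₂_smul, trace₂_sub, trace₂_smul, trace₂_mul, e1, e2,
    e3] at h1
  linear_combination h1

lemma gradSq_mul_hessCoeff (h : ScalarYangOn G φ W D) (hq : q ∈ D) :
    coordGradSq G φ q * hessCoeff G φ q = -box G φ q := by
  have := h.grad_ne_zero q hq
  rw [hessCoeff]; field_simp

lemma ip_grad_grad (G : E4 → Matrix (Fin 4) (Fin 4) ℝ) (φ : E4 → ℝ) (q : E4) :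
    ip G q (fun a => pd a φ q) (fun a => pd a φ q) = coordGradSq G φ q := rfl

/-- Contracting Yang's equation with ∇φ in the index b gives N H_ac on the left, since ∇φ is already
known to be an eigenvector; N ≠ 0 then allows division. On vectors tangent to the leaves H is
proportional to g, so the leaves are totally umbilic. -/
lemma hess_eq (h : ScalarYangOn G φ W D) (hq : q ∈ D) (a c : Fin 4) :
    hess G φ a c q
      = hessCoeff G φ q * (3 * (pd a φ q * pd c φ q) - coordGradSq G φ q * G q a c) := by
  obtain ⟨g, hg⟩ : ∃ g : Fin 4 → Fin 4 → ℝ, ∀ a b, G q a b = g a b := ⟨_, fun _ _ => rfl⟩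
  have h1 : ip G q (fun b => pd b φ q)
        (fun b => pd b φ q * hess G φ a c q - pd a φ q * hess G φ b c q)
      = ip G q (fun b => pd b φ q)
        (fun b => -box G φ q * (pd a φ q * g b c - pd b φ q * g a c)) := by
    congr 1; ext b; rw [h.yang_hess hq a b c, hg, hg]
  have e2 : ip G q (fun b => pd b φ q) (fun b => g b c) = pd c φ q := by
    simp only [← hg, h.symm q hq _ c]; exact h.ip_metric_right hq c _
  have e3 : ip G q (fun b => pd b φ q) (fun b => hess G φ b c q) = -2 * box G φ q * pd c φ q := by
    simp only [h.hess_symm hq h.field _ c]; exact h.ip_hess hq c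
  rw [ip_sub_right, ip_mul_right', ip_mul_right, ip_mul_right, ip_sub_right, ip_mul_right,
    ip_mul_right', e2, e3, ip_grad_grad, ← h.gradSq_mul_hessCoeff hq] at h1
  rw [hg]
  apply mul_left_cancel₀ (h.grad_ne_zero q hq)
  linear_combination h1 - 2 * pd a φ q * pd c φ q * h.gradSq_mul_hessCoeff hq

lemma hasGrad_field (h : ScalarYangOn G φ W D) (hq : q ∈ D) : HasGrad φ (fun a => pd a φ q) q :=
  h.field.hasGrad h.isOpen hq

lemma hasGrad_gradSq (h : ScalarYangOn G φ W D) (hq : q ∈ D) :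
    HasGrad (coordGradSq G φ)
      (fun a => 4 * coordGradSq G φ q * hessCoeff G φ q * pd a φ q) q :=
  (h.toIsMetricOn.hasGrad_gradSq hq h.field).congr_grad fun d => by
    rw [h.ip_hess hq]; linear_combination -4 * pd d φ q * h.gradSq_mul_hessCoeff hq

lemma hasGrad_potential (h : ScalarYangOn G φ W D) (hq : q ∈ D) :
    HasGrad W (fun a => coordGradSq G φ q * hessCoeff G φ q * pd a φ q) q :=
  (h.contDiffOn_potential.hasGrad h.isOpen hq).congr_grad fun d => by
    rw [h.potential_grad hq, h.gradSq_mul_hessCoeff hq]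

/-- The gradients of N and W are 4Nμ dφ and Nμ dφ, so they cancel in N - 4W. -/
lemma hasGrad_scalar (h : ScalarYangOn G φ W D) (hq : q ∈ D) :
    HasGrad (coordScalar G) (fun _ => 0) q :=
  (((h.hasGrad_gradSq hq).sub ((h.hasGrad_potential hq).const_mul 4)).congr_of_eventuallyEq
    (Filter.eventuallyEq_of_mem (h.isOpen.mem_nhds hq) fun y hy => h.scalar_eq hy)).congr_grad
    fun d => by ring

lemma hasCov_field (h : ScalarYangOn G φ W D) (hq : q ∈ D) :
    HasCov G (fun b => pd b φ) (fun a b =>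
      hessCoeff G φ q * (3 * (pd a φ q * pd b φ q) - coordGradSq G φ q * G q a b)) q := by
  have := h.hasCov_pd hq h.field
  simp only [h.hess_eq hq] at this
  exact this

lemma contDiffOn_hessCoeff (h : ScalarYangOn G φ W D) : ContDiffOn ℝ ∞ (hessCoeff G φ) D :=
  (h.contDiffOn_box h.field).neg.div (h.contDiffOn_gradSq h.field) h.grad_ne_zero

/-- The curvature of the field gradient. -/
lemma riemann_field (h : ScalarYangOn G φ W D) (hq : q ∈ D) (b d a : Fin 4) :
    ∑ c, riemann G c b d a q * pd c φ q
      = pd a (hessCoeff G φ) q * (3 * (pd d φ q * pd b φ q) - coordGradSq G φ q * G q d b)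
        - pd d (hessCoeff G φ) q * (3 * (pd a φ q * pd b φ q) - coordGradSq G φ q * G q a b)
        + hessCoeff G φ q ^ 2 * coordGradSq G φ q
          * (pd d φ q * G q a b - pd a φ q * G q d b) := by
  have hφ := h.hasCov_field hq
  have hμ := h.contDiffOn_hessCoeff.hasGrad h.isOpen hq
  have hS := HasCov₂.mul hμ ((HasCov₂.mul (HasGrad.const 3 q) (hφ.mul hφ)).sub
    (HasCov₂.mul (h.hasGrad_gradSq hq) (h.hasCov_metric hq)))
  have key := ricci_identity h.toIsMetricOn hq hφ hS d a b
  have e (a : Fin 4) : (fun y => ∑ c, christoffel G c a b y * pd c φ y + hessCoeff G φ y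
      * (3 * (pd a φ y * pd b φ y) - coordGradSq G φ y * G y a b)) =ᶠ[𝓝 q] pd a (pd b φ) :=
    Filter.eventuallyEq_of_mem (h.isOpen.mem_nhds hq) fun y hy => by
      rw [← h.hess_eq hy, hess]; ring
  -- Both sides are third partial derivatives of φ, so the obstruction in the Ricci identity is
  -- zero.
  have hc : pd d (fun y => ∑ c, christoffel G c a b y * pd c φ y + hessCoeff G φ y
      * (3 * (pd a φ y * pd b φ y) - coordGradSq G φ y * G y a b)) q
      = pd a (fun y => ∑ c, christoffel G c d b y * pd c φ y + hessCoeff G φ y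
      * (3 * (pd d φ y * pd b φ y) - coordGradSq G φ y * G y d b)) q := by
    have e1 : pd d (pd a (pd b φ)) q = pd a (pd d (pd b φ)) q :=
      pd_comm ((contDiffOn_pd h.isOpen h.field b).contDiffAt (h.isOpen.mem_nhds hq)) d a
    rw [pd, (e a).fderiv_eq, pd, (e d).fderiv_eq]
    exact e1
  rw [hc, sub_self] at key
  linear_combination -key - hessCoeff G φ q * hessCoeff G φ q *
    coordGradSq G φ q * 3 * pd b φ q * h.symm q hq a d

/-- The radial curvature `L = (N - W) / 3N`. -/
def radialCurv (G : E4 → Matrix (Fin 4) (Fin 4) ℝ) (φ W : E4 → ℝ) (y : E4) : ℝ :=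
  (coordGradSq G φ y - W y) / (3 * coordGradSq G φ y)

/-- The trace turns the curvature into Ricci, and Ric maps ∇φ to (N - W)dφ. The minus sign comes
from exchanging the first index pair. -/
lemma ip_ricci (h : ScalarYangOn G φ W D) (hq : q ∈ D) (a : Fin 4) :
    trace₂ G q (fun b d => ∑ c, riemann G c b d a q * pd c φ q)
      = -(coordGradSq G φ q - W q) * pd a φ q := by
  set u := raise G q fun a => pd a φ q with hu
  have e1 : trace₂ G q (fun b d => ∑ c, riemann G c b d a q * pd c φ q)
      = -∑ c, u c * trace₂ G q (fun b d => lowRiemann G q b c d a) := by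
    simp only [← h.sum_raise_lowRiemann hq, trace₂, Finset.mul_sum, ← Finset.sum_neg_distrib]
    calc _ = ∑ b, ∑ c, ∑ d, (G q)⁻¹ b d * (u c * lowRiemann G q c b d a) :=
          Finset.sum_congr rfl fun b _ => Finset.sum_comm
      _ = _ := by
          rw [Finset.sum_comm]
          refine Finset.sum_congr rfl fun c _ => Finset.sum_congr rfl fun b _ =>
            Finset.sum_congr rfl fun d _ => ?_
          rw [h.lowRiemann_antisymm hq b c]; ring
  rw [e1]
  simp only [h.trace_lowRiemann hq, h.ricci_eq hq]
  rw [h.sum_raise_mul hq]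
  obtain ⟨g, hg⟩ : ∃ g : Fin 4 → Fin 4 → ℝ, ∀ a b, G q a b = g a b := ⟨_, fun _ _ => rfl⟩
  have e2 : ip G q (fun b => pd b φ q) (fun c => g c a) = pd a φ q := by
    simp only [← hg, h.symm q hq _ a]; exact h.ip_metric_right hq a _
  simp only [hg]
  rw [ip_sub_right, ip_mul_right', ip_mul_right, e2, ip_grad_grad]
  ring

/-- Two contractions of the curvature of the gradient. With ∇φ in the index b the curvature side
vanishes by antisymmetry, leaving dμ ∧ dφ = 0; the trace over b, d is known from Ricci and fixes the
factor. -/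
lemma hessCoeff_grad_aux (h : ScalarYangOn G φ W D) (hq : q ∈ D) :
    (∀ a d, pd a (hessCoeff G φ) q * pd d φ q = pd d (hessCoeff G φ) q * pd a φ q) ∧
    ∀ a, pd a (hessCoeff G φ) q = (radialCurv G φ W q - hessCoeff G φ q ^ 2) * pd a φ q := by
  obtain ⟨g, hg⟩ : ∃ g : Fin 4 → Fin 4 → ℝ, ∀ a b, G q a b = g a b := ⟨_, fun _ _ => rfl⟩
  have e2 (a) : ip G q (fun b => pd b φ q) (fun c => g a c) = pd a φ q := by
    simp only [← hg]; exact h.ip_metric_right hq a _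
  have hN := h.grad_ne_zero q hq
  have hX := h.riemann_field hq
  simp only [hg] at hX
  set N := coordGradSq G φ q with hNdef
  set μ := hessCoeff G φ q
  have hpar (a d : Fin 4) :
      pd a (hessCoeff G φ) q * pd d φ q = pd d (hessCoeff G φ) q * pd a φ q := by
    have h1 : ip G q (fun b => pd b φ q) (fun b => ∑ c, riemann G c b d a q * pd c φ q) = 0 := by
      rw [← h.sum_raise_mul hq]
      simp only [← h.sum_raise_lowRiemann hq, Finset.mul_sum]
      refine sum_sum_eq_zero_of_antisymm fun i j => ?_
      rw [h.lowRiemann_antisymm hq j i]; ring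
    simp only [hX] at h1
    rw [ip_add_right, ip_sub_right, ip_mul_right, ip_mul_right, ip_mul_right, ip_sub_right,
      ip_sub_right, ip_sub_right, ip_mul_right, ip_mul_right, ip_mul_right, ip_mul_right,
      ip_mul_right, ip_mul_right, ip_mul_right, ip_mul_right, e2, e2, ip_grad_grad, ← hNdef] at h1
    have : (2 * N) * (pd a (hessCoeff G φ) q * pd d φ q - pd d (hessCoeff G φ) q * pd a φ q)
        = 0 := by linear_combination h1
    have h3 := (mul_eq_zero.1 this).resolve_left (by positivity)
    linarith
  refine ⟨hpar, fun a => ?_⟩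
  have h1 := h.ip_ricci hq a
  have hsym (b d) : g b d = g d b := by rw [← hg, ← hg, h.symm q hq]
  have e1 : trace₂ G q (fun b c => g b c) = 4 := by
    simp only [← hg, h.trace₂_metric hq]
  have hX' (b d) : ∑ c, riemann G c b d a q * pd c φ q
      = pd a (hessCoeff G φ) q * (3 * (pd b φ q * pd d φ q) - N * g b d)
        - (3 * pd a φ q * (pd b φ q * pd d (hessCoeff G φ) q)
          - N * (g a b * pd d (hessCoeff G φ) q))
        + μ ^ 2 * N * (g a b * pd d φ q - pd a φ q * g b d) := by
    rw [hX, hsym d b]; ring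
  have e3 (w : Fin 4 → ℝ) : ip G q (fun c => g a c) w = w a := by
    simp only [← hg]; exact h.ip_metric_left hq a _
  -- Proportionality eliminates the unknown ⟨dφ, dμ⟩ from the trace.
  have e4 : pd a (hessCoeff G φ) q * N
      = pd a φ q * ip G q (fun b => pd b φ q) (fun d => pd d (hessCoeff G φ) q) := by
    rw [hNdef, ← ip_grad_grad, ← ip_mul_right, ← ip_mul_right]
    congr 1; ext d; rw [hpar a d]; ring
  simp only [hX'] at h1
  rw [trace₂_add, trace₂_sub, trace₂_smul, trace₂_sub, trace₂_smul, trace₂_mul, trace₂_smul,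
    trace₂_sub, trace₂_smul, trace₂_mul, trace₂_smul, trace₂_mul, trace₂_smul, trace₂_sub,
    trace₂_smul, trace₂_mul, e1, e3, e3, ip_grad_grad, ← hNdef] at h1
  rw [radialCurv, ← hNdef]
  field_simp
  linear_combination -h1 + 3 * e4

lemma hasGrad_hessCoeff (h : ScalarYangOn G φ W D) (hq : q ∈ D) :
    HasGrad (hessCoeff G φ)
      (fun a => (radialCurv G φ W q - hessCoeff G φ q ^ 2) * pd a φ q) q :=
  (h.contDiffOn_hessCoeff.hasGrad h.isOpen hq).congr_grad (h.hessCoeff_grad_aux hq).2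

lemma frame (h : ScalarYangOn G φ W D) (hq : q ∈ D) :
    ∃ P : Matrix (Fin 4) (Fin 4) ℝ, P 0 = (fun a => pd a φ q) ∧ P * (G q)⁻¹ * Pᵀ =
      diagonal ![coordGradSq G φ q, 1, 1, -Real.sign (coordGradSq G φ q)] := by
  obtain ⟨Q, hQ⟩ := h.lorentz q hq
  exact exists_frame hQ _ (by rw [← ip_eq_dotProduct, ip_grad_grad]) (h.grad_ne_zero q hq)

/-- The curvature is determined by the metric and the field: the metric is conformally flat. -/
lemma lowRiemann_eq (h : ScalarYangOn G φ W D) (hq : q ∈ D) (c b d a : Fin 4) :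
    lowRiemann G q c b d a
      = -((coordGradSq G φ q + 2 * W q) / 6) * (G q c d * G q a b - G q a c * G q b d)
        + 1 / 2 * (pd c φ q * pd d φ q * G q a b - pd c φ q * pd a φ q * G q b d
          - pd b φ q * pd d φ q * G q a c + pd b φ q * pd a φ q * G q c d) := by
  obtain ⟨P, hP0, hP⟩ := h.frame hq
  have hN := h.grad_ne_zero q hq
  have hX := h.riemann_field hq
  have hgs := h.symm q hq
  have hip := fun d w => h.ip_metric_right hq d w
  have htr := h.trace₂_metric hq
  obtain ⟨g, hg⟩ : ∃ g : Fin 4 → Fin 4 → ℝ, ∀ a b, G q a b = g a b := ⟨_, fun _ _ => rfl⟩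
  simp only [hg, (h.hasGrad_hessCoeff hq).2] at hX hgs hip htr ⊢
  set N := coordGradSq G φ q with hNdef
  set K := -((N + 2 * W q) / 6) with hK
  have hL : N * radialCurv G φ W q = (N - W q) / 3 := by
    rw [radialCurv, ← hNdef]; field_simp
  rw [← sub_eq_zero]
  -- The difference from the model has the symmetries of a curvature tensor. That dφ annihilates it
  -- follows from `riemann_field`, and that it is Ricci-flat from `ricci_eq`.
  refine curvature_eq_zero (A := (G q)⁻¹) (P := P) ?_ hP (T := fun c b d a =>
    lowRiemann G q c b d a - (K * (g c d * g a b - g a c * g b d)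
        + 1 / 2 * (pd c φ q * pd d φ q * g a b - pd c φ q * pd a φ q * g b d
          - pd b φ q * pd d φ q * g a c + pd b φ q * pd a φ q * g c d))) ?_ ?_ ?_ ?_ ?_ c b d a
  · intro i
    fin_cases i <;> simp [hN]
  · intro c b d a
    rw [h.lowRiemann_antisymm hq c b, hgs b d, hgs a c, hgs c d, hgs a b]; ring
  · intro c b d a
    rw [IsMetricOn.lowRiemann_swap, hgs b d, hgs a c, hgs c d, hgs a b]; ring
  · intro c b d a
    have := h.lowRiemann_cyclic hq c b d a
    rw [hgs b d, hgs a c, hgs c d, hgs a b, hgs d a, hgs b c]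
    linear_combination this
  · intro b d a
    have e2 (d) : ip G q (fun b => pd b φ q) (fun c => g c d) = pd d φ q := by
      simp only [hgs _ d]; exact hip d _
    have e2' (d) : ip G q (fun b => pd b φ q) (fun c => g d c) = pd d φ q := hip d _
    have e3 : ip G q (fun b => pd b φ q) (fun c => lowRiemann G q c b d a)
        = ∑ c, riemann G c b d a q * pd c φ q := by
      rw [← h.sum_raise_mul hq, h.sum_raise_lowRiemann hq]
    rw [hP0]
    change ∑ c, raise G q (fun a => pd a φ q) c * _ = 0
    rw [h.sum_raise_mul hq]
    have e4 (c : Fin 4) : lowRiemann G q c b d a - (K * (g c d * g a b - g a c * g b d)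
        + 1 / 2 * (pd c φ q * pd d φ q * g a b - pd c φ q * pd a φ q * g b d
          - pd b φ q * pd d φ q * g a c + pd b φ q * pd a φ q * g c d))
        = lowRiemann G q c b d a - (K * (g c d * g a b - g a c * g b d)
        + 1 / 2 * (pd c φ q * (pd d φ q * g a b - pd a φ q * g b d)
          - pd b φ q * pd d φ q * g a c + pd b φ q * pd a φ q * g c d)) := by ring
    simp only [e4]
    rw [ip_sub_right, ip_add_right, ip_mul_right, ip_sub_right, ip_mul_right', ip_mul_right',
      ip_mul_right, ip_add_right, ip_sub_right, ip_mul_right', ip_mul_right, ip_mul_right,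
      e2, e2', e3, hX, ip_grad_grad, ← hNdef, hgs d b]
    -- The μ² terms of `riemann_field` cancel once dμ is inserted, leaving only N times the radial
    -- curvature.
    linear_combination (pd d φ q * g a b - pd a φ q * g b d) * hL
  · intro b a
    have e2 : ip G q (fun b => pd b φ q) (fun d => g b d) = pd b φ q := hip b _
    have e2' : ip G q (fun c => pd c φ q) (fun c => g a c) = pd a φ q := hip a _
    have e3 : ip G q (fun c => g a c) (fun d => g b d) = g a b := hip b _
    have e4 : trace₂ G q (fun c d => lowRiemann G q c b d a)
        = pd b φ q * pd a φ q - W q * g b a := by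
      rw [h.trace_lowRiemann hq, h.ricci_eq hq, hg]
    have e6 : ip G q (fun c => g a c) (fun d => pd d φ q) = pd a φ q := by
      rw [h.ip_comm hq]; exact e2'
    have e5 (c d : Fin 4) : lowRiemann G q c b d a - (K * (g c d * g a b - g a c * g b d)
        + 1 / 2 * (pd c φ q * pd d φ q * g a b - pd c φ q * pd a φ q * g b d
          - pd b φ q * pd d φ q * g a c + pd b φ q * pd a φ q * g c d))
        = lowRiemann G q c b d a - (K * (g a b * g c d - g a c * g b d)
        + 1 / 2 * (g a b * (pd c φ q * pd d φ q) - pd a φ q * (pd c φ q * g b d)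
          - pd b φ q * (g a c * pd d φ q) + pd b φ q * pd a φ q * g c d)) := by ring
    change trace₂ G q (fun c d => _) = 0
    simp only [e5]
    rw [trace₂_sub, trace₂_add, trace₂_smul, trace₂_sub, trace₂_smul, trace₂_mul, trace₂_smul,
      trace₂_add, trace₂_sub, trace₂_sub, trace₂_smul, trace₂_mul, trace₂_smul, trace₂_mul,
      trace₂_smul, trace₂_mul, trace₂_smul, htr, e2, e3, e4, e6, ip_grad_grad, ← hNdef, hgs b a, hK]
    ring

/-- The action of the curvature on a covector. -/
lemma riemann_apply (h : ScalarYangOn G φ W D) (hq : q ∈ D) {v : Fin 4 → ℝ}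
    (hv : ip G q (fun a => pd a φ q) v = 0) (b d a : Fin 4) :
    ∑ c, riemann G c b d a q * v c
      = -((coordGradSq G φ q + 2 * W q) / 6) * (v d * G q a b - v a * G q b d)
        + 1 / 2 * pd b φ q * (pd a φ q * v d - pd d φ q * v a) := by
  have hgs := h.symm q hq
  have hip := fun d w => h.ip_metric_right hq d w
  have hR := h.lowRiemann_eq hq
  obtain ⟨g, hg⟩ : ∃ g : Fin 4 → Fin 4 → ℝ, ∀ a b, G q a b = g a b := ⟨_, fun _ _ => rfl⟩
  rw [← h.sum_raise_lowRiemann hq, h.sum_raise_mul hq]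
  simp only [hg] at hgs hip hR ⊢
  have e2 (d) : ip G q v (fun c => g c d) = v d := by
    simp only [hgs _ d]; exact hip d _
  have e2' (d) : ip G q v (fun c => g d c) = v d := hip d _
  have e4 (c : Fin 4) : lowRiemann G q c b d a
      = -((coordGradSq G φ q + 2 * W q) / 6) * (g c d * g a b - g a c * g b d)
        + 1 / 2 * (pd c φ q * (pd d φ q * g a b - pd a φ q * g b d)
          - pd b φ q * pd d φ q * g a c + pd b φ q * pd a φ q * g c d) := by rw [hR]; ring
  simp only [e4]
  rw [ip_add_right, ip_mul_right, ip_sub_right, ip_mul_right', ip_mul_right', ip_mul_right,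
    ip_add_right, ip_sub_right, ip_mul_right', ip_mul_right, ip_mul_right, e2, e2',
    h.ip_comm hq v, hv]
  ring

end ScalarYangOn

end YangPure

end

noncomputable section

namespace YangPure

open Topology Metric Set

/-! ### Linear connections: radial transport and the Frobenius theorem -/

section Frobenius

set_option maxSynthPendingDepth 3

variable {E F : Type*} [NormedAddCommGroup E] [NormedSpace ℝ E]
  [NormedAddCommGroup F] [NormedSpace ℝ F]

/-- Uniform bounds for a linear connection form `θ` and its first derivative on a small ball. -/
structure ConnBounds (θ : E → E →L[ℝ] F →L[ℝ] F) (x₀ : E) (r C : ℝ) : Prop where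
  pos : 0 < r
  nonneg : 0 ≤ C
  mul_le : C * r ≤ 1 / 2
  norm_le : ∀ x ∈ ball x₀ r, ‖θ x‖ ≤ C
  differentiableAt : ∀ x ∈ ball x₀ r, DifferentiableAt ℝ θ x
  norm_fderiv_le : ∀ x ∈ ball x₀ r, ‖fderiv ℝ θ x‖ ≤ C
  taylor : ∀ x ∈ ball x₀ r, ∀ y ∈ ball x₀ r,
    ‖θ y - θ x - fderiv ℝ θ x (y - x)‖ ≤ C * ‖y - x‖ ^ 2

/-- The derivative of θ is locally Lipschitz, which gives the quadratic Taylor remainder; the radius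
is shrunk further so that C r ≤ 1/2. -/
lemma exists_connBounds {θ : E → E →L[ℝ] F →L[ℝ] F} {D : Set E} (hD : IsOpen D)
    (hθ : ContDiffOn ℝ ∞ θ D) {x₀ : E} (hx₀ : x₀ ∈ D) :
    ∃ r C, ConnBounds θ x₀ r C ∧ ball x₀ r ⊆ D := by
  have hat := hθ.contDiffAt (hD.mem_nhds hx₀)
  have hd : ContDiffAt ℝ 1 (fderiv ℝ θ) x₀ :=
    hat.fderiv_right (m := 1) (by rw [one_add_one_eq_two]; exact two_le_infty)
  obtain ⟨K, s, hs, hK⟩ := hd.exists_lipschitzOnWith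
  have h1 : ∀ᶠ x in 𝓝 x₀, ‖θ x‖ < ‖θ x₀‖ + 1 :=
    hat.continuousAt.norm.eventually_lt_const (lt_add_one _)
  have h2 : ∀ᶠ x in 𝓝 x₀, ‖fderiv ℝ θ x‖ < ‖fderiv ℝ θ x₀‖ + 1 :=
    hd.continuousAt.norm.eventually_lt_const (lt_add_one _)
  obtain ⟨r, hr, hball⟩ := Metric.eventually_nhds_iff_ball.1
    (h1.and (h2.and ((show ∀ᶠ x in 𝓝 x₀, x ∈ D from hD.mem_nhds hx₀).and hs)))
  set C : ℝ := ‖θ x₀‖ + 1 + (‖fderiv ℝ θ x₀‖ + 1) + K with hC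
  have hC0 : 0 < C := by positivity
  have hsub : ball x₀ (min r (1 / (2 * C))) ⊆ ball x₀ r := ball_subset_ball (min_le_left _ _)
  have hdiff : ∀ x ∈ ball x₀ r, DifferentiableAt ℝ θ x := fun x hx =>
    (hθ.contDiffAt (hD.mem_nhds (hball x hx).2.2.1)).differentiableAt (by simp)
  refine ⟨min r (1 / (2 * C)), C, ⟨by positivity, hC0.le, ?_, ?_, fun x hx => hdiff x (hsub hx),
    ?_, ?_⟩, fun x hx => (hball x (hsub hx)).2.2.1⟩
  · calc C * min r (1 / (2 * C)) ≤ C * (1 / (2 * C)) := by gcongr; exact min_le_right _ _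
      _ = 1 / 2 := by field_simp
  · intro x hx
    have := (hball x (hsub hx)).1
    have : 0 ≤ ‖fderiv ℝ θ x₀‖ + 1 + K := by positivity
    linarith
  · intro x hx
    have := (hball x (hsub hx)).2.1
    have : 0 ≤ ‖θ x₀‖ + 1 + K := by positivity
    linarith
  · intro x hx y hy
    have hconv : Convex ℝ (ball x₀ r ∩ closedBall x ‖y - x‖) :=
      (convex_ball _ _).inter (convex_closedBall _ _)
    have := hconv.norm_image_sub_le_of_norm_fderiv_le' (f := θ) (φ := fderiv ℝ θ x)
      (C := K * ‖y - x‖) (x := x) (y := y) (fun z hz => hdiff z hz.1) (fun z hz => by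
        have h3 := hK.dist_le_mul z (hball z hz.1).2.2.2 x (hball x (hsub hx)).2.2.2
        rw [dist_eq_norm] at h3
        refine h3.trans ?_
        gcongr
        exact mem_closedBall.1 hz.2) ⟨hsub hx, by simp⟩ ⟨hsub hy, by simp [dist_eq_norm]⟩
    refine this.trans ?_
    have hKC : (K : ℝ) ≤ C := by
      have : 0 ≤ ‖θ x₀‖ + 1 + (‖fderiv ℝ θ x₀‖ + 1) := by positivity
      linarith
    nlinarith [sq_nonneg ‖y - x‖]

/-- `Y` is parallel along the rays starting from `x₀`. -/
def IsRadial (θ : E → E →L[ℝ] F →L[ℝ] F) (x₀ : E) (r : ℝ) (Y : E → F) : Prop :=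
  ∀ z ∈ ball (0 : E) r, ∀ t ∈ Icc (0 : ℝ) 1,
    HasDerivWithinAt (fun t : ℝ => Y (x₀ + t • z)) (θ (x₀ + t • z) z (Y (x₀ + t • z))) (Icc 0 1) t

lemma ray_mem_ball {x₀ z : E} {r t : ℝ} (hz : z ∈ ball (0 : E) r) (ht : t ∈ Icc (0 : ℝ) 1) :
    x₀ + t • z ∈ ball x₀ r := by
  rw [mem_ball_zero_iff] at hz
  rw [mem_ball_iff_norm, add_sub_cancel_left, norm_smul, Real.norm_of_nonneg ht.1]
  nlinarith [ht.2, norm_nonneg z]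

lemma hasDerivWithinAt_Ici_of_Icc {f : ℝ → F} {f' : F} {t : ℝ} (ht : t ∈ Ico (0 : ℝ) 1)
    (h : HasDerivWithinAt f f' (Icc 0 1) t) : HasDerivWithinAt f f' (Ici t) t :=
  h.mono_of_mem_nhdsWithin (Filter.mem_of_superset (Icc_mem_nhdsGE ht.2)
    (Icc_subset_Icc_left ht.1))

namespace ConnBounds

variable {θ : E → E →L[ℝ] F →L[ℝ] F} {x₀ : E} {r C : ℝ}

lemma norm_apply_le (h : ConnBounds θ x₀ r C) {x z : E} (hx : x ∈ ball x₀ r)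
    (hz : z ∈ ball (0 : E) r) : ‖θ x z‖ ≤ 1 / 2 := by
  rw [mem_ball_zero_iff] at hz
  calc ‖θ x z‖ ≤ ‖θ x‖ * ‖z‖ := (θ x).le_opNorm z
    _ ≤ C * r := by gcongr; exacts [h.nonneg, h.norm_le x hx]
    _ ≤ 1 / 2 := h.mul_le

lemma continuousOn_ray (h : ConnBounds θ x₀ r C) {z : E} (hz : z ∈ ball (0 : E) r) (v : E) :
    ContinuousOn (fun t : ℝ => θ (x₀ + t • z) v) (Icc 0 1) := fun t ht => by
  have h1 : ContinuousAt (fun t : ℝ => θ (x₀ + t • z)) t :=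
    ContinuousAt.comp (g := θ) (f := fun t : ℝ => x₀ + t • z)
      (h.differentiableAt _ (ray_mem_ball hz ht)).continuousAt (by fun_prop)
  exact (h1.clm_apply continuousAt_const).continuousWithinAt

/-- Parallel transport along each ray is a linear ODE on [0, 1]. The value at a point is the end
value of its own ray, and uniqueness makes the transports along rescaled rays agree. -/
lemma exists_radial [CompleteSpace F] (h : ConnBounds θ x₀ r C) (Y₀ : F) :
    ∃ Y : E → F, Y x₀ = Y₀ ∧ IsRadial θ x₀ r Y := by
  have hsol (z : E) (hz : z ∈ ball (0 : E) r) : ∃ α : ℝ → F, α 0 = Y₀ ∧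
      ∀ t ∈ Icc (0 : ℝ) 1, HasDerivWithinAt α (θ (x₀ + t • z) z (α t)) (Icc 0 1) t := by
    -- On the ball of radius ‖Y₀‖ + 1 about Y₀ the velocity is at most ½(2‖Y₀‖ + 1) ≤ ‖Y₀‖ + 1, so
    -- the solution exists up to time 1.
    have hPL : IsPicardLindelof (fun t y => θ (x₀ + t • z) z y)
        (⟨0, by simp⟩ : Icc (0 : ℝ) 1) Y₀ (‖Y₀‖₊ + 1) 0 (‖Y₀‖₊ + 1) (1 / 2) := by
      refine ⟨fun t ht => ?_, fun y _ => (h.continuousOn_ray hz z).clm_apply continuousOn_const,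
        fun t ht y hy => ?_, by simp⟩
      · refine LipschitzWith.lipschitzOnWith ?_
        refine (θ (x₀ + t • z) z).lipschitz.weaken ?_
        have := h.norm_apply_le (ray_mem_ball hz ht) hz
        exact_mod_cast this
      · have h1 := (θ (x₀ + t • z) z).le_of_opNorm_le (h.norm_apply_le (ray_mem_ball hz ht) hz) y
        have h2 : ‖y‖ ≤ ‖Y₀‖ + (‖Y₀‖ + 1) := by
          have := norm_le_norm_add_norm_sub' y Y₀
          rw [mem_closedBall_iff_norm] at hy
          push_cast at hy
          linarith
        push_cast
        linarith
    exact hPL.exists_eq_forall_mem_Icc_hasDerivWithinAt₀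
  choose! α hα0 hα using hsol
  refine ⟨fun x => α (x - x₀) 1, ?_, ?_⟩
  · have h0 : (0 : E) ∈ ball (0 : E) r := mem_ball_self h.pos
    have hc := constant_of_has_deriv_right_zero (f := α 0) (a := 0) (b := 1)
      (fun t ht => (hα 0 h0 t ht).continuousWithinAt) (fun t ht => by
        have := hasDerivWithinAt_Ici_of_Icc ht (hα 0 h0 t ⟨ht.1, ht.2.le⟩)
        simpa using this) 1 (by simp)
    simp only [sub_self]
    rw [hc, hα0 0 h0]
  · intro z hz
    -- Both solutions, after rescaling of time, satisfy the same linear equation with the same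
    -- initial value.
    have key : ∀ t ∈ Icc (0 : ℝ) 1, α (t • z) 1 = α z t := by
      intro t ht
      have htz : t • z ∈ ball (0 : E) r := by
        have := ray_mem_ball (x₀ := (0 : E)) hz ht
        rwa [zero_add] at this
      have hst : ∀ s ∈ Icc (0 : ℝ) 1, s * t ∈ Icc (0 : ℝ) 1 := fun s hs =>
        ⟨mul_nonneg hs.1 ht.1, mul_le_one₀ hs.2 ht.1 ht.2⟩
      have hd : ∀ s ∈ Icc (0 : ℝ) 1, HasDerivWithinAt (fun s => α (t • z) s - α z (s * t))
          (θ (x₀ + s • t • z) (t • z) (α (t • z) s - α z (s * t))) (Icc 0 1) s := by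
        intro s hs
        have h1 := hα (t • z) htz s hs
        have h2 := (hα z hz (s * t) (hst s hs)).scomp s
          ((hasDerivWithinAt_id s (Icc 0 1)).mul_const t) hst
        convert! h1.sub h2 using 1
        rw [map_sub, smul_smul, map_smul]
        simp
      have hz0 := eq_zero_of_abs_deriv_le_mul_abs_self_of_eq_zero_right (K := 1 / 2)
        (fun s hs => (hd s hs).continuousWithinAt)
        (fun s hs => hasDerivWithinAt_Ici_of_Icc hs (hd s ⟨hs.1, hs.2.le⟩))
        (by simp [hα0 _ hz, hα0 _ htz])
        (fun s hs => (θ (x₀ + s • t • z) (t • z)).le_of_opNorm_le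
          (h.norm_apply_le (ray_mem_ball htz ⟨hs.1, hs.2.le⟩) htz) _) 1 (by simp)
      simpa [sub_eq_zero] using hz0
    intro t ht
    simp only [add_sub_cancel_left]
    rw [key t ht]
    exact (hα z hz t ht).congr key (key t ht)

/-- If the curvature of the connection annihilates a radially parallel section, then the section
is parallel. -/
lemma hasFDerivAt_of_isRadial (h : ConnBounds θ x₀ r C) {Y : E → F} (hY : IsRadial θ x₀ r Y)
    (hflat : ∀ x ∈ ball x₀ r, ∀ u v, fderiv ℝ θ x u v (Y x) + θ x v (θ x u (Y x))
      = fderiv ℝ θ x v u (Y x) + θ x u (θ x v (Y x))) {x : E} (hx : x ∈ ball x₀ r) :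
    HasFDerivAt Y ((θ x).flip (Y x)) x := by
  obtain ⟨z, rfl⟩ : ∃ z, x₀ + z = x := ⟨x - x₀, by simp⟩
  have hz : z ∈ ball (0 : E) r := by
    rw [mem_ball_zero_iff]; rwa [mem_ball_iff_norm, add_sub_cancel_left] at hx
  have hcont : ContinuousOn (fun t : ℝ => Y (x₀ + t • z)) (Icc 0 1) :=
    fun t ht => (hY z hz t ht).continuousWithinAt
  obtain ⟨M, hM⟩ := isCompact_Icc.exists_bound_of_continuousOn hcont
  have hM0 : 0 ≤ M := (norm_nonneg _).trans (hM 0 (by simp))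
  have hC := h.nonneg
  have hr := h.pos
  set B := (C * r + C + (2 * C * r + C) * C) * M with hB
  have hB0 : 0 ≤ B := by positivity
  have key : ∀ v : E, z + v ∈ ball (0 : E) r → ‖v‖ ≤ 1 →
      ‖Y (x₀ + z + v) - Y (x₀ + z) - θ (x₀ + z) v (Y (x₀ + z))‖
        ≤ B * Real.exp 1 * ‖v‖ ^ 2 := by
    intro v hv hv1
    set p : ℝ → E := fun t => x₀ + t • z
    set p' : ℝ → E := fun t => x₀ + t • (z + v)
    -- Compares transport along the rays z and z + v. Z(0) = 0, and Z(1) is the first-order Taylor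
    -- remainder of `Y` at x₀ + z; Grönwall's inequality will bound it by a multiple of ‖v‖².
    set Z : ℝ → F := fun t => Y (p' t) - Y (p t) - t • θ (p t) v (Y (p t)) with hZ
    set Z' : ℝ → F := fun t => θ (p' t) (z + v) (Y (p' t)) - θ (p t) z (Y (p t))
      - (θ (p t) v (Y (p t)) + t • (fderiv ℝ θ (p t) v z (Y (p t)) + θ (p t) z (θ (p t) v (Y (p t)))))
      with hZ'
    have hp (t : ℝ) (ht : t ∈ Icc (0 : ℝ) 1) : p t ∈ ball x₀ r := ray_mem_ball hz ht
    have hp' (t : ℝ) (ht : t ∈ Icc (0 : ℝ) 1) : p' t ∈ ball x₀ r := ray_mem_ball hv ht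
    have hd : ∀ t ∈ Icc (0 : ℝ) 1, HasDerivWithinAt Z (Z' t) (Icc 0 1) t := by
      intro t ht
      have h1 := hY _ hv t ht
      have h2 := hY _ hz t ht
      have hpd : HasDerivAt p z t := by
        convert! ((hasDerivAt_id t).smul_const z).const_add x₀ using 1
        simp
      have h3 : HasDerivWithinAt (fun t => θ (p t)) (fderiv ℝ θ (p t) z) (Icc 0 1) t :=
        (HasFDerivAt.comp_hasDerivAt (l := θ) t (h.differentiableAt _ (hp t ht)).hasFDerivAt
          hpd).hasDerivWithinAt
      have h4 := (h3.clm_apply (hasDerivWithinAt_const t _ v)).clm_apply h2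
      have h5 := (h1.sub h2).sub ((hasDerivWithinAt_id t (Icc 0 1)).smul h4)
      convert! h5 using 1
      have := hflat (p t) (hp t ht) z v
      simp only [hZ', map_zero, add_zero, one_smul, id]
      rw [add_comm (t • _) _, this]
    have hbound : ∀ t ∈ Icc (0 : ℝ) 1, ‖Z' t‖ ≤ 1 * ‖Z t‖ + B * ‖v‖ ^ 2 := by
      intro t ht
      -- A term linear in Z plus three terms of order ‖v‖².
      have e : Z' t = θ (p' t) (z + v) (Z t)
          + ((θ (p' t) - θ (p t) - fderiv ℝ θ (p t) (p' t - p t)) (z + v) (Y (p t))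
          + t • fderiv ℝ θ (p t) v v (Y (p t))
          + t • ((θ (p' t) (z + v) - θ (p t) z) (θ (p t) v (Y (p t))))) := by
        have e1 : p' t - p t = t • v := by simp [p, p', smul_add]
        rw [e1]
        simp only [hZ', hZ, map_sub, map_smul, map_add, sub_apply, add_apply, smul_apply, smul_add,
          smul_sub]
        abel
      have hpt := hp t ht
      have hpt' := hp' t ht
      have hYt : ‖Y (p t)‖ ≤ M := hM t ht
      have hzv : ‖z + v‖ ≤ r := by rw [mem_ball_zero_iff] at hv; exact hv.le
      have e1 : ‖p' t - p t‖ ≤ ‖v‖ := by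
        have : p' t - p t = t • v := by simp [p, p', smul_add]
        rw [this, norm_smul, Real.norm_of_nonneg ht.1]
        nlinarith [ht.2, norm_nonneg v]
      have e1' : ‖p' t - p t‖ ^ 2 ≤ ‖v‖ ^ 2 := by gcongr
      have b1 : ‖(θ (p' t) - θ (p t) - fderiv ℝ θ (p t) (p' t - p t)) (z + v) (Y (p t))‖
          ≤ C * ‖v‖ ^ 2 * r * M := by
        refine (ContinuousLinearMap.le_opNorm _ _).trans ?_
        gcongr
        refine (ContinuousLinearMap.le_opNorm _ _).trans ?_
        gcongr
        exact (h.taylor _ hpt _ hpt').trans (by gcongr)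
      have b2 : ‖t • fderiv ℝ θ (p t) v v (Y (p t))‖ ≤ C * ‖v‖ * ‖v‖ * M := by
        rw [norm_smul, Real.norm_of_nonneg ht.1]
        refine (mul_le_of_le_one_left (norm_nonneg _) ht.2).trans ?_
        refine (ContinuousLinearMap.le_opNorm _ _).trans ?_
        gcongr
        refine (ContinuousLinearMap.le_opNorm _ _).trans ?_
        gcongr
        exact (ContinuousLinearMap.le_opNorm _ _).trans (by gcongr; exact h.norm_fderiv_le _ hpt)
      have b3 : ‖θ (p' t) (z + v) - θ (p t) z‖ ≤ (2 * C * r + C) * ‖v‖ := by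
        have e3 : θ (p' t) (z + v) - θ (p t) z
            = (θ (p' t) - θ (p t) - fderiv ℝ θ (p t) (p' t - p t)) (z + v)
              + fderiv ℝ θ (p t) (p' t - p t) (z + v) + θ (p t) v := by
          simp only [sub_apply, map_add]; abel
        have e4 : ‖(θ (p' t) - θ (p t) - fderiv ℝ θ (p t) (p' t - p t)) (z + v)‖
            ≤ C * ‖v‖ ^ 2 * r :=
          ((θ (p' t) - θ (p t) - fderiv ℝ θ (p t) (p' t - p t)).le_opNorm _).trans
            (by gcongr; exact (h.taylor _ hpt _ hpt').trans (by gcongr))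
        have e5 : ‖fderiv ℝ θ (p t) (p' t - p t) (z + v)‖ ≤ C * ‖v‖ * r :=
          (ContinuousLinearMap.le_opNorm _ _).trans (by
            gcongr
            exact (ContinuousLinearMap.le_opNorm _ _).trans
              (by gcongr; exact h.norm_fderiv_le _ hpt))
        have e6 : ‖θ (p t) v‖ ≤ C * ‖v‖ :=
          (ContinuousLinearMap.le_opNorm _ _).trans (by gcongr; exact h.norm_le _ hpt)
        rw [e3]
        refine norm_add₃_le.trans ?_
        have e7 : C * ‖v‖ ^ 2 * r ≤ C * ‖v‖ * r := by
          gcongr; nlinarith [norm_nonneg v]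
        linarith
      have b4 : ‖t • ((θ (p' t) (z + v) - θ (p t) z) (θ (p t) v (Y (p t))))‖
          ≤ (2 * C * r + C) * ‖v‖ * (C * ‖v‖ * M) := by
        rw [norm_smul, Real.norm_of_nonneg ht.1]
        refine (mul_le_of_le_one_left (norm_nonneg _) ht.2).trans ?_
        refine (ContinuousLinearMap.le_opNorm _ _).trans ?_
        gcongr
        refine (ContinuousLinearMap.le_opNorm _ _).trans ?_
        gcongr
        exact (ContinuousLinearMap.le_opNorm _ _).trans (by gcongr; exact h.norm_le _ hpt)
      have b0 : ‖θ (p' t) (z + v) (Z t)‖ ≤ 1 / 2 * ‖Z t‖ :=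
        (θ (p' t) (z + v)).le_of_opNorm_le (h.norm_apply_le hpt' hv) _
      rw [e]
      refine (norm_add_le _ _).trans ?_
      have := norm_add₃_le (a := (θ (p' t) - θ (p t) - fderiv ℝ θ (p t) (p' t - p t)) (z + v) (Y (p t)))
        (b := t • fderiv ℝ θ (p t) v v (Y (p t)))
        (c := t • ((θ (p' t) (z + v) - θ (p t) z) (θ (p t) v (Y (p t)))))
      have hBe : B * ‖v‖ ^ 2 = C * ‖v‖ ^ 2 * r * M + C * ‖v‖ * ‖v‖ * M
          + (2 * C * r + C) * ‖v‖ * (C * ‖v‖ * M) := by rw [hB]; ring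
      rw [hBe]
      linarith [norm_nonneg (Z t)]
    have hg := norm_le_gronwallBound_of_norm_deriv_right_le (δ := 0) (K := 1) (ε := B * ‖v‖ ^ 2)
      (fun t ht => (hd t ht).continuousWithinAt)
      (fun t ht => hasDerivWithinAt_Ici_of_Icc ht (hd t ⟨ht.1, ht.2.le⟩))
      (by simp [hZ, p, p']) (fun t ht => hbound t ⟨ht.1, ht.2.le⟩) 1 (by simp)
    rw [gronwallBound_of_K_ne_0 one_ne_zero] at hg
    simp only [hZ, p, p', one_smul, zero_mul, zero_add, sub_zero, one_mul, div_one] at hg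
    rw [← add_assoc] at hg
    refine hg.trans ?_
    have : 0 ≤ B * ‖v‖ ^ 2 := by positivity
    nlinarith
  rw [hasFDerivAt_iff_isLittleO_nhds_zero]
  have hO : (fun v => Y (x₀ + z + v) - Y (x₀ + z) - (θ (x₀ + z)).flip (Y (x₀ + z)) v)
      =O[𝓝 0] fun v : E => ‖v‖ ^ 2 := by
    refine Asymptotics.IsBigO.of_bound (B * Real.exp 1) ?_
    have h1 : ∀ᶠ v in 𝓝 (0 : E), z + v ∈ ball (0 : E) r := by
      have : Filter.Tendsto (fun v : E => z + v) (𝓝 0) (𝓝 z) := by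
        have := (continuous_const_add z).tendsto (0 : E)
        rwa [add_zero] at this
      exact this.eventually (isOpen_ball.mem_nhds hz)
    have h2 : ∀ᶠ v in 𝓝 (0 : E), ‖v‖ ≤ 1 := by
      filter_upwards [closedBall_mem_nhds (0 : E) one_pos] with v hv
      simpa using hv
    filter_upwards [h1, h2] with v hv hv'
    simpa using key v hv hv'
  exact hO.trans_isLittleO (by simpa using Asymptotics.isLittleO_norm_pow_id one_lt_two)

end ConnBounds

/-- Parallel sections of a smooth connection are smooth. -/
lemma contDiffOn_of_parallel {θ : E → E →L[ℝ] F →L[ℝ] F} {D : Set E} (hD : IsOpen D)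
    (hθ : ContDiffOn ℝ ∞ θ D) {Y : E → F} (hY : ∀ x ∈ D, HasFDerivAt Y ((θ x).flip (Y x)) x) :
    ContDiffOn ℝ ∞ Y D := by
  rw [contDiffOn_infty]
  intro n
  induction n with
  | zero =>
    exact contDiffOn_zero.2 fun x hx => (hY x hx).continuousAt.continuousWithinAt
  | succ n ih =>
    rw [Nat.cast_add, Nat.cast_one, contDiffOn_succ_iff_fderiv_of_isOpen hD]
    refine ⟨fun x hx => (hY x hx).differentiableAt.differentiableWithinAt, by simp, ?_⟩
    have h1 : ContDiffOn ℝ n (fun x => (θ x).flip (Y x)) D :=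
      ((ContinuousLinearMap.flipₗᵢ ℝ E F F).toContinuousLinearEquiv.contDiff.comp_contDiffOn
        (hθ.of_le (mod_cast le_top))).clm_apply ih
    exact h1.congr fun x hx => (hY x hx).fderiv

end Frobenius

end YangPure

end

noncomputable section

namespace YangPure

open Topology Metric Set

/-! ### Overdetermined linear systems `∂ₐY = MₐY` -/

section LinearSystem

set_option maxSynthPendingDepth 3

variable {ι : Type*} [Fintype ι] [DecidableEq ι]

/-- The bilinear map `(z, Y) ↦ zᵃ Yⱼ eᵢ`. -/
def unitConn (a : Fin 4) (i j : ι) : E4 →L[ℝ] (ι → ℝ) →L[ℝ] (ι → ℝ) :=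
  (EuclideanSpace.proj a : E4 →L[ℝ] ℝ).smulRight
    ((ContinuousLinearMap.proj j : (ι → ℝ) →L[ℝ] ℝ).smulRight (Pi.single i (1 : ℝ)))

omit [Fintype ι] in
lemma unitConn_apply (a : Fin 4) (i j : ι) (z : E4) (Y : ι → ℝ) (l : ι) :
    unitConn a i j z Y l = if l = i then z a * Y j else 0 := by
  simp [unitConn, Pi.single_apply]

/-- The connection form of the system `∂ₐYᵢ = ∑ⱼ Mₐᵢⱼ Yⱼ`. -/
def systemConn (M : Fin 4 → ι → ι → E4 → ℝ) (y : E4) : E4 →L[ℝ] (ι → ℝ) →L[ℝ] (ι → ℝ) :=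
  ∑ a, ∑ i, ∑ j, M a i j y • unitConn a i j

variable {M : Fin 4 → ι → ι → E4 → ℝ} {D : Set E4}

lemma systemConn_apply (y z : E4) (Y : ι → ℝ) (l : ι) :
    systemConn M y z Y l = ∑ a, z a * ∑ j, M a l j y * Y j := by
  simp only [systemConn, sum_apply, smul_apply, Finset.sum_apply, Pi.smul_apply,
    unitConn_apply, smul_eq_mul, mul_ite, mul_zero]
  refine Finset.sum_congr rfl fun a _ => ?_
  rw [Finset.sum_comm, Finset.mul_sum]
  refine Finset.sum_congr rfl fun j _ => ?_
  rw [Finset.sum_ite_eq]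
  simp; ring

lemma contDiffOn_systemConn (hM : ∀ a i j, ContDiffOn ℝ ∞ (M a i j) D) :
    ContDiffOn ℝ ∞ (systemConn M) D := by
  unfold systemConn
  exact ContDiffOn.sum fun a _ => ContDiffOn.sum fun i _ => ContDiffOn.sum fun j _ =>
    (hM a i j).smul contDiffOn_const

lemma fderiv_systemConn (hD : IsOpen D) (hM : ∀ a i j, ContDiffOn ℝ ∞ (M a i j) D) {x : E4}
    (hx : x ∈ D) (u v : E4) (Y : ι → ℝ) (l : ι) :
    fderiv ℝ (systemConn M) x u v Y l
      = ∑ a, v a * ∑ d, u d * ∑ j, pd d (M a l j) x * Y j := by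
  have h1 (a i j) := (((hM a i j).contDiffAt (hD.mem_nhds hx)).differentiableAt
    (by simp)).hasFDerivAt.smul_const (unitConn a i j)
  have h2 : HasFDerivAt (systemConn M) (∑ a, ∑ i, ∑ j,
      (fderiv ℝ (M a i j) x).smulRight (unitConn a i j)) x := by
    unfold systemConn
    exact HasFDerivAt.fun_sum fun a _ => HasFDerivAt.fun_sum fun i _ =>
      HasFDerivAt.fun_sum fun j _ => h1 a i j
  rw [h2.fderiv]
  have h3 (a i j) := ((hM a i j).hasGrad hD hx).fderiv_apply u
  simp only [sum_apply, ContinuousLinearMap.smulRight_apply, smul_apply, Finset.sum_apply,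
    Pi.smul_apply, unitConn_apply, smul_eq_mul, mul_ite, mul_zero, h3]
  refine Finset.sum_congr rfl fun a _ => ?_
  rw [Finset.sum_comm]
  simp only [Finset.sum_ite_eq, Finset.mem_univ, if_true, Finset.mul_sum, Finset.sum_mul]
  rw [Finset.sum_comm]
  exact Finset.sum_congr rfl fun d _ => Finset.sum_congr rfl fun j _ => by ring

lemma hasGrad_of_hasFDerivAt {Y : E4 → ι → ℝ} {y : E4}
    (h : HasFDerivAt Y ((systemConn M y).flip (Y y)) y) (i : ι) :
    HasGrad (fun y => Y y i) (fun a => ∑ j, M a i j y * Y y j) y := by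
  have h1 := hasFDerivAt_pi'.1 h i
  refine ⟨h1.differentiableAt, fun a => ?_⟩
  rw [pd, h1.fderiv]
  simp [systemConn_apply]

omit [Fintype ι] [DecidableEq ι] in
/-- A solution at a point to first order. -/
lemma exists_jet (x : E4) (Y : ι → ℝ) (P : Fin 4 → ι → ℝ) :
    ∃ Z : ι → E4 → ℝ, (∀ i, Z i x = Y i) ∧ ∀ i, HasGrad (Z i) (fun a => P a i) x := by
  refine ⟨fun i y => Y i + ∑ a, P a i * (y - x) a, fun i => by simp, fun i => ?_⟩
  have h (a : Fin 4) : HasGrad (fun y : E4 => (y - x) a) (fun b => if b = a then 1 else 0) x := by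
    have h0 : HasFDerivAt (fun y : E4 => (y - x) a) (EuclideanSpace.proj a : E4 →L[ℝ] ℝ) x := by
      simpa using ((EuclideanSpace.proj a : E4 →L[ℝ] ℝ).hasFDerivAt (x := x)).sub_const (x a)
    refine ⟨h0.differentiableAt, fun b => ?_⟩
    rw [pd, h0.fderiv]
    simp [eq_comm]
  exact ((HasGrad.const (Y i) x).add (HasGrad.sum (s := Finset.univ) fun a _ =>
    (h a).const_mul (P a i))).congr_grad fun b => by simp

/-- The Frobenius theorem for a linear system whose curvature vanishes on the kernel of a recurrent
linear form `w`. -/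
theorem exists_solution (hD : IsOpen D) (hM : ∀ a i j, ContDiffOn ℝ ∞ (M a i j) D)
    (w : ι → E4 → ℝ) (β : Fin 4 → E4 → ℝ) (hβ : ∀ a, ContinuousOn (β a) D)
    (hws : ∀ i, ContDiffOn ℝ ∞ (w i) D)
    (hw : ∀ x ∈ D, ∀ Z : ι → E4 → ℝ, (∀ i, HasGrad (Z i) (fun a => ∑ j, M a i j x * Z j x) x) →
      HasGrad (fun y => ∑ i, w i y * Z i y) (fun a => β a x * ∑ i, w i x * Z i x) x)
    (hflat : ∀ x ∈ D, ∀ Z : ι → E4 → ℝ,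
      (∀ i, HasGrad (Z i) (fun a => ∑ j, M a i j x * Z j x) x) → ∑ i, w i x * Z i x = 0 →
      ∀ a d i, pd d (fun y => ∑ j, M a i j y * Z j y) x = pd a (fun y => ∑ j, M d i j y * Z j y) x)
    {x₀ : E4} (hx₀ : x₀ ∈ D) :
    ∃ r > 0, ball x₀ r ⊆ D ∧ ∀ Y₀ : ι → ℝ, ∑ i, w i x₀ * Y₀ i = 0 →
      ∃ Y : ι → E4 → ℝ, (∀ i, Y i x₀ = Y₀ i) ∧ (∀ i, ContDiffOn ℝ ∞ (Y i) (ball x₀ r)) ∧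
        ∀ x ∈ ball x₀ r, (∑ i, w i x * Y i x = 0) ∧
          ∀ i, HasGrad (Y i) (fun a => ∑ j, M a i j x * Y j x) x := by
  have hθ := contDiffOn_systemConn hM
  obtain ⟨r, C, hC, hball⟩ := exists_connBounds hD hθ hx₀
  refine ⟨r, hC.pos, hball, fun Y₀ hY₀ => ?_⟩
  obtain ⟨Y, hYx₀, hY⟩ := hC.exists_radial Y₀
  -- Along a ray the recurrent form evaluated on `Y` satisfies a scalar linear ODE with zero initial
  -- value.
  have hwY : ∀ x ∈ ball x₀ r, ∑ i, w i x * Y x i = 0 := by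
    intro x hx
    obtain ⟨z, rfl⟩ : ∃ z, x₀ + z = x := ⟨x - x₀, by simp⟩
    have hz : z ∈ ball (0 : E4) r := by
      rw [mem_ball_zero_iff]; rwa [mem_ball_iff_norm, add_sub_cancel_left] at hx
    have hmem (t : ℝ) (ht : t ∈ Icc (0 : ℝ) 1) : x₀ + t • z ∈ D := hball (ray_mem_ball hz ht)
    have hd : ∀ t ∈ Icc (0 : ℝ) 1, HasDerivWithinAt
        (fun t : ℝ => ∑ i, w i (x₀ + t • z) * Y (x₀ + t • z) i)
        ((∑ a, z a * β a (x₀ + t • z)) * ∑ i, w i (x₀ + t • z) * Y (x₀ + t • z) i)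
        (Icc 0 1) t := by
      intro t ht
      have hxD := hmem t ht
      have hp : HasDerivAt (fun t : ℝ => x₀ + t • z) z t := by
        convert! ((hasDerivAt_id t).smul_const z).const_add x₀ using 1
        simp
      have h1 (i : ι) : HasDerivWithinAt (fun t : ℝ => w i (x₀ + t • z))
          (∑ a, z a * pd a (w i) (x₀ + t • z)) (Icc 0 1) t := by
        rw [← ((hws i).hasGrad hD hxD).fderiv_apply]
        exact (HasFDerivAt.comp_hasDerivAt (l := w i) t
          ((hws i).hasGrad hD hxD).1.hasFDerivAt hp).hasDerivWithinAt
      have h2 (i : ι) := hasDerivWithinAt_pi.1 (hY z hz t ht) i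
      have h3 := HasDerivWithinAt.fun_sum (u := Finset.univ) fun i _ => (h1 i).mul (h2 i)
      refine h3.congr_deriv ?_
      -- So far `Y` is differentiable only along rays, whereas `hw` concerns functions with a full
      -- gradient at the point; the first-order jet of a would-be solution takes the place of `Y`.
      obtain ⟨Z, hZ, hZd⟩ := exists_jet (x₀ + t • z) (Y (x₀ + t • z))
        (fun a i => ∑ j, M a i j (x₀ + t • z) * Y (x₀ + t • z) j)
      simp only [← hZ] at hZd ⊢
      have h4 (a : Fin 4) := (hw _ hxD Z hZd).unique (HasGrad.sum (s := Finset.univ) fun i _ =>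
        ((hws i).hasGrad hD hxD).mul (hZd i)) a
      have h5 (a : Fin 4) := congrArg (z a * ·) (h4 a)
      simp only [← mul_assoc] at h5
      rw [Finset.sum_mul, Finset.sum_congr rfl fun a _ => h5 a]
      simp only [systemConn_apply, Finset.mul_sum, mul_add, Finset.sum_add_distrib,
        Finset.sum_mul, hZ]
      congr 1
      · rw [Finset.sum_comm]
        exact Finset.sum_congr rfl fun a _ => Finset.sum_congr rfl fun i _ => by ring
      · rw [Finset.sum_comm]
        exact Finset.sum_congr rfl fun a _ => Finset.sum_congr rfl fun i _ =>
          Finset.sum_congr rfl fun j _ => by ring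
    obtain ⟨K, hK⟩ := isCompact_Icc.exists_bound_of_continuousOn
      (f := fun t : ℝ => ∑ a, z a * β a (x₀ + t • z)) (s := Icc 0 1)
      (continuousOn_finsetSum _ fun a _ => continuousOn_const.mul
        ((hβ a).comp (Continuous.continuousOn (by fun_prop)) fun t ht => hmem t ht))
    have := eq_zero_of_abs_deriv_le_mul_abs_self_of_eq_zero_right (K := K)
      (fun t ht => (hd t ht).continuousWithinAt)
      (fun t ht => hasDerivWithinAt_Ici_of_Icc ht (hd t ⟨ht.1, ht.2.le⟩))
      (by simp [hYx₀, hY₀])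
      (fun t ht => by
        rw [norm_mul]
        exact mul_le_mul_of_nonneg_right (hK t ⟨ht.1, ht.2.le⟩) (norm_nonneg _)) 1 (by simp)
    simpa using this
  have hd : ∀ x ∈ ball x₀ r, HasFDerivAt Y ((systemConn M x).flip (Y x)) x := by
    refine fun x hx => hC.hasFDerivAt_of_isRadial hY (fun x hx u v => ?_) hx
    ext l
    have hxD := hball hx
    obtain ⟨Z, hZ, hZd⟩ := exists_jet x (Y x) (fun a i => ∑ j, M a i j x * Y x j)
    simp only [← hZ] at hZd
    have hf := hflat x hxD Z hZd (by simp only [hZ]; exact hwY x hx)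
    have key (a d : Fin 4) : pd d (fun y => ∑ j, M a l j y * Z j y) x
        = ∑ j, pd d (M a l j) x * Y x j + ∑ j, M a l j x * ∑ k, M d j k x * Y x k := by
      have := (HasGrad.sum (s := Finset.univ) fun j _ =>
        ((hM a l j).hasGrad hD hxD).mul (hZd j)).2 d
      rw [this]
      beta_reduce
      rw [Finset.sum_add_distrib]
      simp only [hZ]
    have e (u v : E4) : (fderiv ℝ (systemConn M) x u v (Y x)
        + systemConn M x v (systemConn M x u (Y x))) l
        = ∑ a, ∑ d, v a * u d * pd d (fun y => ∑ j, M a l j y * Z j y) x := by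
      rw [Pi.add_apply, fderiv_systemConn hD hM hxD, systemConn_apply, ← Finset.sum_add_distrib]
      refine Finset.sum_congr rfl fun a _ => ?_
      simp only [key, mul_add, Finset.sum_add_distrib, systemConn_apply, Finset.mul_sum]
      congr 1
      · exact Finset.sum_congr rfl fun d _ => Finset.sum_congr rfl fun j _ => by ring
      · rw [Finset.sum_comm]
        exact Finset.sum_congr rfl fun d _ => Finset.sum_congr rfl fun j _ =>
          Finset.sum_congr rfl fun k _ => by ring
    rw [e, e, Finset.sum_comm]
    exact Finset.sum_congr rfl fun a _ => Finset.sum_congr rfl fun d _ => by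
      rw [hf a d]; ring
  have hsm := contDiffOn_of_parallel isOpen_ball (hθ.mono hball) hd
  exact ⟨fun i y => Y y i, fun i => congr_fun hYx₀ i, fun i => contDiffOn_pi.1 hsm i,
    fun x hx => ⟨hwY x hx, fun i => hasGrad_of_hasFDerivAt (hd x hx) i⟩⟩

end LinearSystem

end YangPure

end

noncomputable section

namespace YangPure

open Topology Metric Set

/-! ### Functions with prescribed Hessian on a Yang pure space -/

lemma IsMetricOn.mono {G : E4 → Matrix (Fin 4) (Fin 4) ℝ} {D D' : Set E4} (h : IsMetricOn G D)
    (hD' : IsOpen D') (hs : D' ⊆ D) : IsMetricOn G D' where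
  isOpen := hD'
  smooth i j := (h.smooth i j).mono hs
  symm q hq := h.symm q (hs hq)
  det_ne_zero q hq := h.det_ne_zero q (hs hq)

lemma ScalarYangOn.mono {G : E4 → Matrix (Fin 4) (Fin 4) ℝ} {φ W : E4 → ℝ} {D D' : Set E4}
    (h : ScalarYangOn G φ W D) (hD' : IsOpen D') (hs : D' ⊆ D) : ScalarYangOn G φ W D' where
  toIsMetricOn := h.toIsMetricOn.mono hD' hs
  lorentz q hq := h.lorentz q (hs hq)
  field := h.field.mono hs
  einstein q hq := h.einstein q (hs hq)
  yang q hq := h.yang q (hs hq)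
  grad_ne_zero q hq := h.grad_ne_zero q (hs hq)

/-- The length `|∇φ|`. -/
def speed (G : E4 → Matrix (Fin 4) (Fin 4) ℝ) (φ : E4 → ℝ) (ε : ℝ) (y : E4) : ℝ :=
  √(ε * coordGradSq G φ y)

/-- A Yang pure space with a scalar field, together with the normalization `α` of the squared warping
function `α / |∇φ|` for which the leaves of constant `φ` have curvature `k`. -/
structure WarpedOn (G : E4 → Matrix (Fin 4) (Fin 4) ℝ) (φ W : E4 → ℝ) (D : Set E4) (ε α k : ℝ) : Prop
    extends ScalarYangOn G φ W D where
  sign_sq : ε * ε = 1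
  sign_mul_pos : ∀ y ∈ D, 0 < ε * coordGradSq G φ y
  pos : 0 < α
  -- The Gauss equation: the right-hand side is the intrinsic curvature of the leaf, the umbilic
  -- contribution Nμ² plus the ambient sectional curvature.
  curv : ∀ y ∈ D, k * (speed G φ ε y / α)
    = coordGradSq G φ y * hessCoeff G φ y ^ 2 - (coordGradSq G φ y + 2 * W y) / 6

/-- The Hessian `μ (dφ ⊗ v + v ⊗ dφ) - kγf (g - dφ ⊗ dφ / ∇φ²)`, with `γ = |∇φ| / α`. -/
def leafHess (G : E4 → Matrix (Fin 4) (Fin 4) ℝ) (φ : E4 → ℝ) (ε α k : ℝ) (f : E4 → ℝ)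
    (v : Fin 4 → E4 → ℝ) (a b : Fin 4) (y : E4) : ℝ :=
  hessCoeff G φ y * (pd a φ y * v b y + v a y * pd b φ y)
    + speed G φ ε y / α * (-k * f y)
      * (G y a b - (coordGradSq G φ y)⁻¹ * (pd a φ y * pd b φ y))

namespace WarpedOn

variable {G : E4 → Matrix (Fin 4) (Fin 4) ℝ} {D : Set E4} {q : E4} {φ W : E4 → ℝ} {ε α k : ℝ}

lemma speed_pos (h : WarpedOn G φ W D ε α k) (hq : q ∈ D) : 0 < speed G φ ε q :=
  Real.sqrt_pos.2 (h.sign_mul_pos q hq)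

lemma speed_sq (h : WarpedOn G φ W D ε α k) (hq : q ∈ D) :
    speed G φ ε q ^ 2 = ε * coordGradSq G φ q :=
  Real.sq_sqrt (h.sign_mul_pos q hq).le

end WarpedOn

lemma ScalarYangOn.hasGrad_speed {G : E4 → Matrix (Fin 4) (Fin 4) ℝ} {D : Set E4} {q : E4}
    {φ W : E4 → ℝ} {ε : ℝ} (h : ScalarYangOn G φ W D) (hq : q ∈ D)
    (hε : 0 < ε * coordGradSq G φ q) :
    HasGrad (speed G φ ε) (fun a => 2 * hessCoeff G φ q * speed G φ ε q * pd a φ q) q := by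
  refine (((h.hasGrad_gradSq hq).const_mul ε).comp
    (Real.hasDerivAt_sqrt hε.ne')).congr_grad fun a => ?_
  have h1 : 0 < speed G φ ε q := Real.sqrt_pos.2 hε
  have h2 : speed G φ ε q ^ 2 = ε * coordGradSq G φ q := Real.sq_sqrt hε.le
  change 1 / (2 * speed G φ ε q) * _ = _
  field_simp
  linear_combination (-4 * hessCoeff G φ q * pd a φ q) * h2

lemma ScalarYangOn.contDiffOn_speed {G : E4 → Matrix (Fin 4) (Fin 4) ℝ} {D : Set E4}
    {φ W : E4 → ℝ} {ε : ℝ} (h : ScalarYangOn G φ W D)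
    (hε : ∀ q ∈ D, 0 < ε * coordGradSq G φ q) : ContDiffOn ℝ ∞ (speed G φ ε) D :=
  (contDiffOn_const.mul (h.contDiffOn_gradSq h.field)).sqrt fun q hq => (hε q hq).ne'

namespace WarpedOn

variable {G : E4 → Matrix (Fin 4) (Fin 4) ℝ} {D : Set E4} {q : E4} {φ W : E4 → ℝ} {ε α k : ℝ}

/-- The linear system `∇ₐv_b = leafHess` is integrable. -/
lemma leafHess_integrable (h : WarpedOn G φ W D ε α k) (hq : q ∈ D) {f : E4 → ℝ}
    {v : Fin 4 → E4 → ℝ} (hf : HasGrad f (fun a => v a q) q)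
    (hv : HasCov G v (fun a b => leafHess G φ ε α k f v a b q) q)
    (hw : ip G q (fun a => pd a φ q) (fun a => v a q) = 0) (a d b : Fin 4) :
    pd d (fun y => ∑ c, christoffel G c a b y * v c y + leafHess G φ ε α k f v a b y) q
      = pd a (fun y => ∑ c, christoffel G c d b y * v c y + leafHess G φ ε α k f v d b y) q := by
  have hφ := h.hasCov_field hq
  have hN := h.grad_ne_zero q hq
  have hs := h.hasGrad_speed hq (h.sign_mul_pos q hq)
  have hS := (HasCov₂.mul (h.hasGrad_hessCoeff hq) ((hφ.mul hv).add (hv.mul hφ))).add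
    (HasCov₂.mul ((hs.div (HasGrad.const α q) h.pos.ne').mul
      (hf.const_mul (-k)))
      ((h.hasCov_metric hq).sub (HasCov₂.mul ((h.hasGrad_gradSq hq).inv hN) (hφ.mul hφ))))
  have key := ricci_identity h.toIsMetricOn hq (S := fun a b => leafHess G φ ε α k f v a b)
    hv hS d a b
  -- The only use of df ⊥ dφ: for such covectors the curvature has the reduced form of
  -- `riemann_apply`.
  rw [← sub_eq_zero, key, h.riemann_apply hq hw]
  have hgs := h.symm q hq
  have hc := h.curv q hq
  have hα := h.pos
  have hL : ScalarYangOn.radialCurv G φ W q * coordGradSq G φ q = (coordGradSq G φ q - W q) / 3 := by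
    rw [ScalarYangOn.radialCurv]; field_simp
  simp only [leafHess]
  obtain ⟨g, hg⟩ : ∃ g : Fin 4 → Fin 4 → ℝ, ∀ a b, G q a b = g a b := ⟨_, fun _ _ => rfl⟩
  simp only [hg] at hgs ⊢
  rw [hgs d b, hgs d a]
  generalize coordGradSq G φ q = N at *
  generalize hessCoeff G φ q = μ at *
  generalize ScalarYangOn.radialCurv G φ W q = L at *
  generalize speed G φ ε q = s at *
  field_simp at hL hc ⊢
  -- The radial terms cancel by the formula for dμ, the leaf terms by the normalization of the leaf
  -- curvature.
  linear_combination 4 * α ^ 2 * pd b φ q * (pd d φ q * v a q - pd a φ q * v d q) * hL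
    + 2 * α * (v a q * (N * g b d - pd b φ q * pd d φ q)
      - v d q * (N * g a b - pd a φ q * pd b φ q)) * hc

/-- The coefficients of the linear system for `(df, f)`. -/
def leafMatrix (G : E4 → Matrix (Fin 4) (Fin 4) ℝ) (φ : E4 → ℝ) (ε α k : ℝ) (a : Fin 4) :
    Option (Fin 4) → Option (Fin 4) → E4 → ℝ
  | some b, some c => fun y => christoffel G c a b y
      + hessCoeff G φ y * ((if c = b then 1 else 0) * pd a φ y + (if c = a then 1 else 0) * pd b φ y)
  | some b, none => fun y => -k * (speed G φ ε y / α
      * (G y a b - (coordGradSq G φ y)⁻¹ * (pd a φ y * pd b φ y)))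
  | none, some b => fun _ => if b = a then 1 else 0
  | none, none => fun _ => 0

lemma leafMatrix_sum_some (a b : Fin 4) (Z : Option (Fin 4) → ℝ) :
    ∑ j, leafMatrix G φ ε α k a (some b) j q * Z j = ∑ c, christoffel G c a b q * Z (some c)
      + (hessCoeff G φ q * (pd a φ q * Z (some b) + Z (some a) * pd b φ q)
      + speed G φ ε q / α * (-k * Z none)
      * (G q a b - (coordGradSq G φ q)⁻¹ * (pd a φ q * pd b φ q))) := by
  simp only [leafMatrix, Fintype.sum_option, add_mul, mul_add, Finset.sum_add_distrib]
  simp [mul_assoc]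
  ring

lemma leafMatrix_sum_none (a : Fin 4) (Z : Option (Fin 4) → ℝ) :
    ∑ j, leafMatrix G φ ε α k a none j q * Z j = Z (some a) := by
  simp [leafMatrix]

lemma contDiffOn_leafMatrix (h : WarpedOn G φ W D ε α k) (a : Fin 4) (i j : Option (Fin 4)) :
    ContDiffOn ℝ ∞ (leafMatrix G φ ε α k a i j) D := by
  have hφ (a : Fin 4) := contDiffOn_pd h.isOpen h.field a
  have hT (b : Fin 4) : ContDiffOn ℝ ∞ (fun y => speed G φ ε y / α
      * (G y a b - (coordGradSq G φ y)⁻¹ * (pd a φ y * pd b φ y))) D :=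
    ((h.contDiffOn_speed h.sign_mul_pos).div_const α).mul ((h.smooth a b).sub
      (((h.contDiffOn_gradSq h.field).inv h.grad_ne_zero).mul ((hφ a).mul (hφ b))))
  rcases i with _ | b <;> rcases j with _ | c
  · exact contDiffOn_const
  · exact contDiffOn_const
  · exact contDiffOn_const.mul (hT b)
  · exact (h.contDiffOn_christoffel c a b).add (h.contDiffOn_hessCoeff.mul
      ((contDiffOn_const.mul (hφ a)).add (contDiffOn_const.mul (hφ b))))

/-- The system for functions with Hessian `leafHess` is solvable with any initial value of `f` and
of `df ⊥ dφ`. -/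
theorem exists_leaf_functions (h : WarpedOn G φ W D ε α k) {x₀ : E4} (hx₀ : x₀ ∈ D) :
    ∃ r > 0, ball x₀ r ⊆ D ∧ ∀ (f₀ : ℝ) (v₀ : Fin 4 → ℝ),
      ip G x₀ (fun a => pd a φ x₀) v₀ = 0 → ∃ f : E4 → ℝ, f x₀ = f₀ ∧ (∀ a, pd a f x₀ = v₀ a) ∧
        ContDiffOn ℝ ∞ f (ball x₀ r) ∧ ∀ x ∈ ball x₀ r,
          ip G x (fun a => pd a φ x) (fun a => pd a f x) = 0 ∧
          HasCov G (fun a => pd a f)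
            (fun a b => leafHess G φ ε α k f (fun a => pd a f) a b x) x := by
  -- The unknown is the pair (df, f), with `none` labelling f; `w` pairs it to ⟨dφ, df⟩.
  set w : Option (Fin 4) → E4 → ℝ :=
    fun i y => i.elim 0 fun b => raise G y (fun a => pd a φ y) b with hw
  have hwZ (y : E4) (Z : Option (Fin 4) → ℝ) (hy : y ∈ D) :
      ∑ i, w i y * Z i = ip G y (fun a => pd a φ y) (fun a => Z (some a)) := by
    simp [hw, h.sum_raise_mul hy]
  have hφ (a : Fin 4) := contDiffOn_pd h.isOpen h.field a
  have hws : ∀ i, ContDiffOn ℝ ∞ (w i) D := by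
    rintro (_ | b)
    · exact contDiffOn_const
    · have : ContDiffOn ℝ ∞ (fun y => ∑ a, (G y)⁻¹ b a * pd a φ y) D :=
        ContDiffOn.sum fun a _ => (h.smooth_inv b a).mul (hφ a)
      exact this
  -- The orthogonality condition propagates: the terms ∓μN v from the Hessians of φ and f cancel,
  -- and the leaf part is orthogonal to dφ, leaving the recurrence factor 4μ dφ.
  have hwd : ∀ x ∈ D, ∀ Z : Option (Fin 4) → E4 → ℝ,
      (∀ i, HasGrad (Z i) (fun a => ∑ j, leafMatrix G φ ε α k a i j x * Z j x) x) →
      HasGrad (fun y => ∑ i, w i y * Z i y)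
        (fun a => (4 * hessCoeff G φ x * pd a φ x) * ∑ i, w i x * Z i x) x := by
    intro x hx Z hZ
    have hN := h.grad_ne_zero x hx
    have hv : HasCov G (fun b => Z (some b)) (fun a b => hessCoeff G φ x
        * (pd a φ x * Z (some b) x + Z (some a) x * pd b φ x)
        + speed G φ ε x / α * (-k * Z none x)
        * (G x a b - (coordGradSq G φ x)⁻¹ * (pd a φ x * pd b φ x))) x := fun b =>
      (hZ (some b)).congr_grad fun a => leafMatrix_sum_some a b _
    refine ((h.hasGrad_ip hx (h.hasCov_field hx) hv).congr_of_eventuallyEq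
      (Filter.eventuallyEq_of_mem (h.isOpen.mem_nhds hx)
        fun y hy => hwZ y (fun i => Z i y) hy)).congr_grad fun d => ?_
    rw [hwZ x (fun i => Z i x) hx]
    have e1 (w) := h.ip_metric_left hx d w
    have e2 (w) := h.ip_metric_right hx d w
    obtain ⟨g, hg⟩ : ∃ g : Fin 4 → Fin 4 → ℝ, ∀ a b, G x a b = g a b := ⟨_, fun _ _ => rfl⟩
    simp only [hg] at e1 e2 ⊢
    rw [ip_mul_left, ip_sub_left, ip_mul_left, ip_mul_left, ip_mul_left, e1,
      ip_add_right, ip_mul_right, ip_mul_right, ip_add_right, ip_sub_right, ip_mul_right,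
      ip_mul_right, ip_mul_right, ip_mul_right, e2, ScalarYangOn.ip_grad_grad]
    field_simp
    ring
  have hflat : ∀ x ∈ D, ∀ Z : Option (Fin 4) → E4 → ℝ,
      (∀ i, HasGrad (Z i) (fun a => ∑ j, leafMatrix G φ ε α k a i j x * Z j x) x) →
      ∑ i, w i x * Z i x = 0 → ∀ a d i, pd d (fun y => ∑ j, leafMatrix G φ ε α k a i j y * Z j y) x
        = pd a (fun y => ∑ j, leafMatrix G φ ε α k d i j y * Z j y) x := by
    intro x hx Z hZ hw0 a d i
    rw [hwZ x (fun i => Z i x) hx] at hw0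
    have hf : HasGrad (Z none) (fun a => Z (some a) x) x :=
      (hZ none).congr_grad fun a => by rw [leafMatrix_sum_none]
    rcases i with _ | b
    · simp only [leafMatrix_sum_none]
      refine ((hZ (some a)).2 d).trans (Eq.trans ?_ ((hZ (some d)).2 a).symm)
      beta_reduce
      rw [leafMatrix_sum_some, leafMatrix_sum_some, h.symm x hx a d]
      simp only [h.christoffel_symm hx _ a d]
      ring
    · simp only [leafMatrix_sum_some]
      exact h.leafHess_integrable hx hf (fun b => (hZ (some b)).congr_grad fun a =>
        leafMatrix_sum_some a b _) hw0 a d b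
  obtain ⟨r, hr, hball, hsol⟩ := exists_solution (M := leafMatrix G φ ε α k) (D := D) h.isOpen
    h.contDiffOn_leafMatrix w (fun a y => 4 * hessCoeff G φ y * pd a φ y)
    (fun a => ((contDiffOn_const.mul h.contDiffOn_hessCoeff).mul (hφ a)).continuousOn) hws hwd hflat hx₀
  refine ⟨r, hr, hball, fun f₀ v₀ hv₀ => ?_⟩
  obtain ⟨Y, hY₀, hYs, hY⟩ := hsol (fun i => i.elim f₀ v₀)
    (by rw [hwZ _ _ hx₀]; exact hv₀)
  have hgrad : ∀ x ∈ ball x₀ r, HasGrad (Y none) (fun a => Y (some a) x) x :=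
    fun x hx => ((hY x hx).2 none).congr_grad fun a => by
      rw [leafMatrix_sum_none]
  have hpd (a) : ∀ x ∈ ball x₀ r, pd a (Y none) x = Y (some a) x :=
    fun x hx => (hgrad x hx).2 a
  refine ⟨Y none, hY₀ _, fun a => ?_, hYs _, fun x hx => ⟨?_, fun b => ?_⟩⟩
  · rw [hpd a x₀ (mem_ball_self hr), hY₀]; rfl
  · simp only [hpd _ x hx]
    rw [← hwZ x (fun i => Y i x) (hball hx)]
    exact (hY x hx).1
  · refine (((hY x hx).2 (some b)).congr_of_eventuallyEq (g := pd b (Y none)) <|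
      Filter.eventuallyEq_of_mem (isOpen_ball.mem_nhds hx) (hpd b)).congr_grad fun a => ?_
    rw [leafMatrix_sum_some]
    simp only [leafHess, hpd _ x hx]

end WarpedOn

end YangPure

end

/-! ### Constancy of the normalized leaf curvature and of the quadric invariant -/

noncomputable section

namespace YangPure

open Topology Metric Set Matrix

lemma eq_of_hasGrad_zero {f : E4 → ℝ} {x₀ : E4} {r : ℝ}
    (h : ∀ y ∈ ball x₀ r, HasGrad f (fun _ => 0) y) {x y : E4} (hx : x ∈ ball x₀ r)
    (hy : y ∈ ball x₀ r) : f x = f y :=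
  isOpen_ball.is_const_of_fderiv_eq_zero (𝕜 := ℝ) (f := f)
    (convex_ball x₀ r).isPreconnected (fun y hy => (h y hy).1.differentiableWithinAt)
    (fun y hy => by ext v; simp [(h y hy).fderiv_apply]) hx hy

/-- On a small ball the squared warping function can be normalized so that `k ∈ {-1, 0, 1}`. -/
lemma ScalarYangOn.exists_warpedOn {G : E4 → Matrix (Fin 4) (Fin 4) ℝ} {D : Set E4} {q : E4}
    {φ W : E4 → ℝ} (h : ScalarYangOn G φ W D) (hq : q ∈ D) :
    ∃ r > 0, ball q r ⊆ D ∧ ∃ α k : ℝ, (k = -1 ∨ k = 0 ∨ k = 1) ∧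
      WarpedOn G φ W (ball q r) (Real.sign (coordGradSq G φ q)) α k := by
  set ε := Real.sign (coordGradSq G φ q) with hε
  have hNq := h.grad_ne_zero q hq
  have hε2 : ε * ε = 1 := by
    rcases Real.sign_apply_eq_of_ne_zero _ hNq with h | h <;> rw [hε, h] <;> norm_num
  have hpos : 0 < ε * coordGradSq G φ q := Real.sign_mul_pos_of_ne_zero _ hNq
  have hc : ContinuousAt (fun y => ε * coordGradSq G φ y) q := continuousAt_const.mul
    ((h.contDiffOn_gradSq h.field).contDiffAt (h.isOpen.mem_nhds hq)).continuousAt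
  obtain ⟨r, hr, hball⟩ := Metric.eventually_nhds_iff_ball.1
    ((hc.eventually_const_lt hpos).and (show ∀ᶠ x in 𝓝 q, x ∈ D from h.isOpen.mem_nhds hq))
  have hsub : ball q r ⊆ D := fun y hy => (hball y hy).2
  -- The leaf curvature divided by |∇φ|; it is constant, and α = 1/|κ| normalizes it to ±1, while
  -- for κ = 0 any positive α would do.
  set κ : E4 → ℝ := fun y => (coordGradSq G φ y * (hessCoeff G φ y * hessCoeff G φ y)
    - 1 / 6 * (coordGradSq G φ y + 2 * W y)) / speed G φ ε y with hκ
  have hs (y) (hy : y ∈ ball q r) : 0 < speed G φ ε y := Real.sqrt_pos.2 (hball y hy).1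
  have hgrad : ∀ y ∈ ball q r, HasGrad κ (fun _ => 0) y := by
    intro y hy
    have hyD := hsub hy
    have hμ := h.hasGrad_hessCoeff hyD
    have hN := h.grad_ne_zero y hyD
    have hsy := hs y hy
    refine ((((h.hasGrad_gradSq hyD).mul (hμ.mul hμ)).sub (((h.hasGrad_gradSq hyD).add
      ((h.hasGrad_potential hyD).const_mul 2)).const_mul (1 / 6))).div
      (h.hasGrad_speed hyD (hball y hy).1) hsy.ne').congr_grad fun a => ?_
    rw [radialCurv]
    field_simp
    ring
  have hconst (y) (hy : y ∈ ball q r) : κ y = κ q :=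
    eq_of_hasGrad_zero hgrad hy (mem_ball_self hr)
  have hcurv (y) (hy : y ∈ ball q r) : κ q * speed G φ ε y
      = coordGradSq G φ y * hessCoeff G φ y ^ 2 - (coordGradSq G φ y + 2 * W y) / 6 := by
    have := (hs y hy).ne'
    rw [← hconst y hy, hκ]; field_simp
  have hW (α k : ℝ) (hα : 0 < α) (hk : k = α * κ q) : WarpedOn G φ W (ball q r) ε α k :=
    { h.mono isOpen_ball hsub with
      sign_sq := hε2
      sign_mul_pos := fun y hy => (hball y hy).1
      pos := hα
      curv := fun y hy => by rw [← hcurv y hy, hk]; field_simp }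
  refine ⟨r, hr, hsub, ?_⟩
  rcases lt_trichotomy (κ q) 0 with h0 | h0 | h0
  · exact ⟨-(κ q)⁻¹, -1, by simp, hW _ _ (by simpa using h0) (by rw [neg_mul, inv_mul_cancel₀ h0.ne])⟩
  · exact ⟨1, 0, by simp, hW _ _ one_pos (by simp [h0])⟩
  · exact ⟨(κ q)⁻¹, 1, by simp, hW _ _ (by simpa using h0) (by field_simp)⟩

namespace WarpedOn

variable {G : E4 → Matrix (Fin 4) (Fin 4) ℝ} {D : Set E4} {q : E4} {φ W : E4 → ℝ} {ε α k : ℝ}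

lemma hasGrad_warp (h : WarpedOn G φ W D ε α k) (hq : q ∈ D) :
    HasGrad (fun y => α / speed G φ ε y)
      (fun a => -2 * hessCoeff G φ q * (α / speed G φ ε q) * pd a φ q) q :=
  ((HasGrad.const α q).div (h.hasGrad_speed hq (h.sign_mul_pos q hq))
    (h.speed_pos hq).ne').congr_grad fun a => by
      have := (h.speed_pos hq).ne'
      field_simp
      ring

/-- `⟨df₁, df₂⟩ / γ + k f₁ f₂` is constant for functions with Hessian `leafHess`. -/
lemma hasGrad_invariant (h : WarpedOn G φ W D ε α k) (hq : q ∈ D) {f₁ f₂ : E4 → ℝ}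
    (hf₁ : DifferentiableAt ℝ f₁ q) (hf₂ : DifferentiableAt ℝ f₂ q)
    (h₁ : ip G q (fun a => pd a φ q) (fun a => pd a f₁ q) = 0)
    (h₂ : ip G q (fun a => pd a φ q) (fun a => pd a f₂ q) = 0)
    (hc₁ : HasCov G (fun a => pd a f₁)
      (fun a b => leafHess G φ ε α k f₁ (fun a => pd a f₁) a b q) q)
    (hc₂ : HasCov G (fun a => pd a f₂)
      (fun a b => leafHess G φ ε α k f₂ (fun a => pd a f₂) a b q) q) :
    HasGrad (fun y => α / speed G φ ε y * ip G y (fun a => pd a f₁ y) (fun a => pd a f₂ y)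
      + k * (f₁ y * f₂ y)) (fun _ => 0) q := by
  refine (((h.hasGrad_warp hq).mul (h.hasGrad_ip hq hc₁ hc₂)).add
    (((DifferentiableAt.hasGrad hf₁).mul (DifferentiableAt.hasGrad hf₂)).const_mul k)).congr_grad fun d => ?_
  have e1 (w) := h.ip_metric_left hq d w
  have e2 (w) := h.ip_metric_right hq d w
  have h₁' := h₁
  rw [h.ip_comm hq] at h₁'
  have hs := (h.speed_pos hq).ne'
  have hα := h.pos.ne'
  obtain ⟨g, hg⟩ : ∃ g : Fin 4 → Fin 4 → ℝ, ∀ a b, G q a b = g a b := ⟨_, fun _ _ => rfl⟩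
  simp only [leafHess, hg] at e1 e2 ⊢
  rw [ip_add_left, ip_mul_left, ip_add_left, ip_mul_left, ip_mul_left, ip_mul_left, ip_sub_left,
    ip_mul_left, ip_mul_left, e1, ip_add_right, ip_mul_right, ip_add_right, ip_mul_right,
    ip_mul_right, ip_mul_right, ip_sub_right, ip_mul_right, ip_mul_right, e2, h₂, h₁']
  field_simp
  ring

end WarpedOn

end YangPure

end

/-! ### Stereographic coordinates on the leaves -/

noncomputable section

namespace YangPure

open Topology Metric Set Matrix

lemma mul_mul_transpose_apply (G : E4 → Matrix (Fin 4) (Fin 4) ℝ) (q : E4)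
    (P : Matrix (Fin 4) (Fin 4) ℝ) (i j : Fin 4) :
    (P * (G q)⁻¹ * Pᵀ) i j = ip G q (P i) (P j) := by
  simp only [mul_apply, transpose_apply, ip, Finset.sum_mul]
  rw [Finset.sum_comm]
  exact Finset.sum_congr rfl fun a _ => Finset.sum_congr rfl fun b _ => by ring

/-- The signature of the leaves of constant field. -/
def leafSign (ε : ℝ) : Fin 3 → ℝ := ![1, 1, -ε]

lemma leafSign_sq {ε : ℝ} (h : ε * ε = 1) (i : Fin 3) : leafSign ε i * leafSign ε i = 1 := by
  fin_cases i <;> simp [leafSign, h]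

/-- The conformal factor `1 + k/4 ∑ ηᵢ xᵢ²` of stereographic coordinates. -/
def leafFactor (ε k : ℝ) (x : Fin 3 → E4 → ℝ) (y : E4) : ℝ :=
  1 + k / 4 * ∑ i, leafSign ε i * x i y ^ 2

namespace WarpedOn

variable {G : E4 → Matrix (Fin 4) (Fin 4) ℝ} {D : Set E4} {q : E4} {φ W : E4 → ℝ} {ε α k : ℝ}

lemma sign_eq (h : WarpedOn G φ W D ε α k) (hq : q ∈ D) : Real.sign (coordGradSq G φ q) = ε := by
  have h1 := h.sign_mul_pos q hq
  rcases mul_self_eq_one_iff.1 h.sign_sq with rfl | rfl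
  · exact Real.sign_of_pos (by linarith)
  · exact Real.sign_of_neg (by linarith)

/-- Orthonormal initial data for the leaves. -/
lemma exists_leaf_frame (h : WarpedOn G φ W D ε α k) (hq : q ∈ D) :
    ∃ v : Fin 3 → Fin 4 → ℝ, (∀ i, ip G q (fun a => pd a φ q) (v i) = 0) ∧
      ∀ i j, α / speed G φ ε q * ip G q (v i) (v j) = if i = j then leafSign ε i else 0 := by
  obtain ⟨P, hP0, hP⟩ := h.frame hq
  have hs := h.speed_pos hq
  have hα := h.pos
  have key (i j : Fin 4) := congr_fun (congr_fun hP i) j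
  simp only [mul_mul_transpose_apply, h.sign_eq hq] at key
  -- The frame is scaled by √γ because the invariant carries the factor 1/γ.
  set t := √(speed G φ ε q / α) with ht
  have ht2 : t * t = speed G φ ε q / α := Real.mul_self_sqrt (by positivity)
  refine ⟨fun i a => t * P i.succ a, fun i => ?_, fun i j => ?_⟩
  · rw [ip_mul_right, ← hP0, key]
    fin_cases i <;> simp
  · rw [ip_mul_left, ip_mul_right, ← mul_assoc t, ht2, key]
    have : α / speed G φ ε q * (speed G φ ε q / α) = 1 := by field_simp
    rw [← mul_assoc, this]
    fin_cases i <;> fin_cases j <;> simp [leafSign]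

/-- Stereographic coordinates on the leaves. -/
theorem exists_leaf_coordinates (h : WarpedOn G φ W D ε α k) {x₀ : E4} (hx₀ : x₀ ∈ D) :
    ∃ r > 0, ball x₀ r ⊆ D ∧ ∃ x : Fin 3 → E4 → ℝ, (∀ i, ContDiffOn ℝ ∞ (x i) (ball x₀ r)) ∧
      (∀ i, x i x₀ = 0) ∧ ∀ y ∈ ball x₀ r, 0 < leafFactor ε k x y ∧
        (∀ i, ip G y (fun a => pd a φ y) (fun a => pd a (x i) y) = 0) ∧
        ∀ i j, ip G y (fun a => pd a (x i) y) (fun a => pd a (x j) y)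
          = if i = j then leafSign ε i * (speed G φ ε y / α * leafFactor ε k x y ^ 2) else 0 := by
  obtain ⟨r₁, hr₁, hball₁, hsol⟩ := h.exists_leaf_functions hx₀
  obtain ⟨v, hv0, hv⟩ := h.exists_leaf_frame hx₀
  choose X hX0 hXd hXs hX using fun i => hsol 0 (v i) (hv0 i)
  have hη := leafSign_sq h.sign_sq
  set η := leafSign ε with hηdef
  set ξ : E4 → ℝ := fun y => ∑ i, η i * (X i y * X i y) with hξ
  have hξs : ContDiffOn ℝ ∞ ξ (ball x₀ r₁) := ContDiffOn.sum fun i _ =>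
    contDiffOn_const.mul ((hXs i).mul (hXs i))
  have hξ0 : ξ x₀ = 0 := by simp [hξ, hX0]
  have hc : ContinuousAt (fun y => 1 - k * ξ y) x₀ := continuousAt_const.sub
    (continuousAt_const.mul (hξs.contDiffAt (isOpen_ball.mem_nhds (mem_ball_self hr₁))).continuousAt)
  obtain ⟨r, hr, hball⟩ := Metric.eventually_nhds_iff_ball.1
    ((hc.eventually_const_lt (u := 0) (by simp [hξ0])).and
      (show ∀ᶠ y in 𝓝 x₀, y ∈ ball x₀ r₁ from isOpen_ball.mem_nhds (mem_ball_self hr₁)))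
  have hsub : ball x₀ r ⊆ ball x₀ r₁ := fun y hy => (hball y hy).2
  -- The invariant has the value ηᵢδᵢⱼ at x₀, hence everywhere on the ball.
  have hXX : ∀ y ∈ ball x₀ r, ∀ i j, ip G y (fun a => pd a (X i) y) (fun a => pd a (X j) y)
      = speed G φ ε y / α * ((if i = j then η i else 0) - k * (X i y * X j y)) := by
    intro y hy i j
    have hd (i) (z) (hz : z ∈ ball x₀ r₁) : DifferentiableAt ℝ (X i) z :=
      ((hXs i).hasGrad isOpen_ball hz).1
    have h1 := eq_of_hasGrad_zero (fun z hz => h.hasGrad_invariant (hball₁ hz) (hd i z hz)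
      (hd j z hz) (hX i z hz).1 (hX j z hz).1 (hX i z hz).2 (hX j z hz).2) (hsub hy)
      (mem_ball_self hr₁)
    simp only [hX0, hXd, mul_zero, add_zero] at h1
    rw [hv] at h1
    have hs := h.speed_pos (hball₁ (hsub hy))
    have hα := h.pos
    rw [← h1]
    field_simp
    ring
  -- The remaining ambient coordinate on the quadric kξ + Z² = 1, equal to 1 at x₀.
  set Z : E4 → ℝ := fun y => √(1 - k * ξ y) with hZ
  have hZpos (y) (hy : y ∈ ball x₀ r) : 0 < Z y := Real.sqrt_pos.2 (hball y hy).1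
  have hZsq (y) (hy : y ∈ ball x₀ r) : Z y ^ 2 = 1 - k * ξ y := Real.sq_sqrt (hball y hy).1.le
  have hZs : ContDiffOn ℝ ∞ Z (ball x₀ r) :=
    (contDiffOn_const.sub (contDiffOn_const.mul (hξs.mono hsub))).sqrt fun y hy => (hball y hy).1.ne'
  have hF (y) (hy : y ∈ ball x₀ r) : 1 + Z y ≠ 0 := by have := hZpos y hy; positivity
  -- Stereographic projection from the point Z = -1.
  set x : Fin 3 → E4 → ℝ := fun i y => 2 * X i y / (1 + Z y) with hx
  have hfac (y) (hy : y ∈ ball x₀ r) : leafFactor ε k x y = 2 / (1 + Z y) := by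
    have h1 : ∑ i, η i * x i y ^ 2 = 4 / (1 + Z y) ^ 2 * ξ y := by
      simp only [hξ, hx, Finset.mul_sum]
      exact Finset.sum_congr rfl fun i _ => by rw [div_pow]; ring
    have := hF y hy
    rw [leafFactor, h1]
    field_simp
    linear_combination hZsq y hy
  have hgrad (y) (hy : y ∈ ball x₀ r) (i : Fin 3) : HasGrad (x i) (fun a =>
      2 / (1 + Z y) * pd a (X i) y
        + 2 * k * X i y / (Z y * (1 + Z y) ^ 2) * ∑ l, η l * X l y * pd a (X l) y) y := by
    have hXg (i) := (hXs i).hasGrad isOpen_ball (hsub hy)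
    have hξg : HasGrad ξ (fun a => 2 * ∑ l, η l * X l y * pd a (X l) y) y :=
      (HasGrad.sum (s := Finset.univ) fun i _ => ((hXg i).mul (hXg i)).const_mul (η i)).congr_grad
        fun a => by rw [Finset.mul_sum]; exact Finset.sum_congr rfl fun i _ => by ring
    have hZp := hZpos y hy
    have hZg : HasGrad Z (fun a => -k / Z y * ∑ l, η l * X l y * pd a (X l) y) y :=
      (((HasGrad.const 1 y).sub (hξg.const_mul k)).comp
        (Real.hasDerivAt_sqrt (hball y hy).1.ne')).congr_grad fun a => by
          change 1 / (2 * Z y) * _ = _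
          field_simp
          ring
    refine (((hXg i).const_mul 2).div ((HasGrad.const 1 y).add hZg) (hF y hy)).congr_grad
      fun a => ?_
    have := hF y hy
    field_simp
    ring
  refine ⟨r, hr, hsub.trans hball₁, x, fun i => ?_, fun i => by simp [hx, hX0], fun y hy =>
    ⟨?_, fun i => ?_, fun i j => ?_⟩⟩
  · exact (contDiffOn_const.mul ((hXs i).mono hsub)).div (contDiffOn_const.add hZs) hF
  · rw [hfac y hy]; have := hZpos y hy; positivity
  · have h1 (i) := (hX i y (hsub hy)).1
    simp only [(hgrad y hy i).2, Fin.sum_univ_three]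
    simp only [ip_add_right, ip_mul_right, h1]
    ring
  · have hyD := hball₁ (hsub hy)
    set T : Fin 4 → ℝ := fun a => ∑ l, η l * X l y * pd a (X l) y with hT
    have hXT (i) : ip G y (fun a => pd a (X i) y) T = speed G φ ε y / α * (X i y * Z y ^ 2) := by
      simp only [hT, Fin.sum_univ_three]
      simp only [ip_add_right, ip_mul_right, hXX y hy, hZsq y hy, hξ, Fin.sum_univ_three]
      fin_cases i
      · simp; linear_combination (speed G φ ε y / α * X 0 y) * hη 0
      · simp; linear_combination (speed G φ ε y / α * X 1 y) * hη 1
      · simp; linear_combination (speed G φ ε y / α * X 2 y) * hη 2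
    have hTX (i) : ip G y T (fun a => pd a (X i) y) = speed G φ ε y / α * (X i y * Z y ^ 2) := by
      rw [h.ip_comm hyD, hXT]
    have hTT : ip G y T T = speed G φ ε y / α * (ξ y * Z y ^ 2) := by
      conv_lhs => arg 3; rw [hT]
      simp only [Fin.sum_univ_three]
      simp only [ip_add_left, ip_mul_left, hXT, hξ, Fin.sum_univ_three]
      ring
    simp only [(hgrad y hy _).2]
    change ip G y (fun a => 2 / (1 + Z y) * pd a (X i) y
        + 2 * k * X i y / (Z y * (1 + Z y) ^ 2) * T a) (fun a => 2 / (1 + Z y) * pd a (X j) y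
        + 2 * k * X j y / (Z y * (1 + Z y) ^ 2) * T a) = _
    rw [ip_add_left, ip_mul_left, ip_mul_left, ip_add_right, ip_add_right, ip_mul_right,
      ip_mul_right, ip_mul_right, ip_mul_right, hXX y hy, hXT, hTX, hTT, hfac y hy]
    have hF' := hF y hy
    have hZp := hZpos y hy
    have hα := h.pos
    have hZ2 := hZsq y hy
    generalize Z y = z at *
    have e : k * ξ y = 1 - z ^ 2 := by linarith
    split_ifs with hij
    · field_simp
      linear_combination (speed G φ ε y * k * X i y * X j y) * e
    · field_simp
      linear_combination (4 * speed G φ ε y * k * X i y * X j y) * e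

end WarpedOn

end YangPure

end

/-! ### Arc length along the gradient and orthogonal coordinates -/

noncomputable section

namespace YangPure

open Topology Metric Set Matrix

namespace WarpedOn

variable {G : E4 → Matrix (Fin 4) (Fin 4) ℝ} {D : Set E4} {q : E4} {φ W : E4 → ℝ} {ε α k : ℝ}

/-- The arc length `u` along the gradient of the field, `du = dφ / |∇φ|`. -/
lemma exists_arclength (h : WarpedOn G φ W D ε α k) {x₀ : E4} {r : ℝ}
    (hball : ball x₀ r ⊆ D) (u₀ : ℝ) : ∃ u : E4 → ℝ, ContDiffOn ℝ ∞ u (ball x₀ r) ∧ u x₀ = u₀ ∧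
      ∀ y ∈ ball x₀ r, HasGrad u (fun a => pd a φ y / speed G φ ε y) y := by
  set θ : E4 → E4 →L[ℝ] ℝ := fun y => (speed G φ ε y)⁻¹ • fderiv ℝ φ y with hθ
  have hs0 : ∀ y ∈ D, speed G φ ε y ≠ 0 := fun y hy => (h.speed_pos hy).ne'
  have hsi := (h.contDiffOn_speed h.sign_mul_pos).inv hs0
  have hφ' : ContDiffOn ℝ ∞ (fderiv ℝ φ) D := h.field.fderiv_of_isOpen h.isOpen (m := ∞) (by simp)
  have hθs : ContDiffOn ℝ ∞ θ (ball x₀ r) := (hsi.smul hφ').mono hball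
  -- The form dφ/|∇φ| is closed because d|∇φ| is a multiple of dφ; the Poincaré lemma on the ball
  -- gives u.
  obtain ⟨u, hu⟩ := (convex_ball x₀ r).exists_forall_hasFDerivAt_of_fderiv_symmetric isOpen_ball
    (hθs.differentiableOn (by simp)) (fun y hy v w => by
      have hyD := hball hy
      have h1 := h.isOpen.mem_nhds hyD
      have hsg := (h.hasGrad_speed hyD (h.sign_mul_pos y hyD)).inv (hs0 y hyD)
      have h2 : HasFDerivAt (fderiv ℝ φ) (fderiv ℝ (fderiv ℝ φ) y) y :=
        ((hφ'.contDiffAt h1).differentiableAt (by simp)).hasFDerivAt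
      have h3 := (hsg.1.hasFDerivAt.smul h2).fderiv
      have hsym : fderiv ℝ (fderiv ℝ φ) y v w = fderiv ℝ (fderiv ℝ φ) y w v :=
        (h.field.contDiffAt h1).isSymmSndFDerivAt (by simpa using two_le_infty) v w
      have h4 (v : E4) : fderiv ℝ (fun y => (speed G φ ε y)⁻¹) y v
          = -2 * hessCoeff G φ y / speed G φ ε y * fderiv ℝ φ y v := by
        rw [hsg.fderiv_apply, (h.hasGrad_field hyD).fderiv_apply, Finset.mul_sum]
        have := hs0 y hyD
        exact Finset.sum_congr rfl fun i _ => by field_simp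
      change fderiv ℝ (fun y => (speed G φ ε y)⁻¹ • fderiv ℝ φ y) y v w
        = fderiv ℝ (fun y => (speed G φ ε y)⁻¹ • fderiv ℝ φ y) y w v
      erw [h3]
      simp only [_root_.add_apply, _root_.smul_apply, ContinuousLinearMap.smulRight_apply, h4, hsym, smul_eq_mul]
      ring)
  have hgrad : ∀ y ∈ ball x₀ r, HasGrad u (fun a => pd a φ y / speed G φ ε y) y := fun y hy =>
    ⟨(hu y hy).differentiableAt, fun a => by
      rw [pd, (hu y hy).fderiv, hθ]; simp [pd, div_eq_inv_mul]⟩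
  have hus : ContDiffOn ℝ ∞ u (ball x₀ r) := by
    rw [contDiffOn_infty_iff_fderiv_of_isOpen isOpen_ball]
    exact ⟨fun y hy => (hu y hy).differentiableAt.differentiableWithinAt,
      hθs.congr fun y hy => (hu y hy).fderiv⟩
  exact ⟨fun y => u y + (u₀ - u x₀), hus.add contDiffOn_const, by ring, fun y hy =>
    ((hgrad y hy).add (HasGrad.const _ y)).congr_grad fun a => add_zero _⟩

/-- Coordinates in which the inverse metric is diagonal. -/
theorem exists_coordinates (h : WarpedOn G φ W D ε α k) {x₀ : E4} (hx₀ : x₀ ∈ D) (u₀ : ℝ) :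
    ∃ r > 0, ball x₀ r ⊆ D ∧ ∃ Ψ : Fin 4 → E4 → ℝ, (∀ i, ContDiffOn ℝ ∞ (Ψ i) (ball x₀ r)) ∧
      Ψ 0 x₀ = u₀ ∧ (∀ i : Fin 3, Ψ i.succ x₀ = 0) ∧ ∀ y ∈ ball x₀ r,
        0 < leafFactor ε k (fun i => Ψ i.succ) y ∧
        HasGrad (Ψ 0) (fun a => pd a φ y / speed G φ ε y) y ∧
        ∀ i j, ip G y (fun a => pd a (Ψ i) y) (fun a => pd a (Ψ j) y) = diagonal (Fin.cons ε fun i =>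
          leafSign ε i * (speed G φ ε y / α * leafFactor ε k (fun i => Ψ i.succ) y ^ 2)) i j := by
  obtain ⟨r, hr, hball, x, hxs, hx0, hx⟩ := h.exists_leaf_coordinates hx₀
  obtain ⟨u, hus, hu0, hu⟩ := h.exists_arclength hball u₀
  refine ⟨r, hr, hball, Fin.cons u x, fun i => ?_, hu0, hx0, fun y hy => ?_⟩
  · cases i using Fin.cases with
    | zero => exact hus
    | succ i => exact hxs i
  · obtain ⟨h1, h2, h3⟩ := hx y hy
    simp only [Fin.cons_succ, Fin.cons_zero]
    refine ⟨h1, hu y hy, fun i j => ?_⟩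
    have hyD := hball hy
    have hs := (h.speed_pos hyD).ne'
    have e (a) : pd a φ y / speed G φ ε y = (speed G φ ε y)⁻¹ * pd a φ y := by ring
    cases i using Fin.cases with
    | zero =>
      cases j using Fin.cases with
      | zero =>
        simp only [Fin.cons_zero, (hu y hy).2, e, diagonal_apply_eq]
        rw [ip_mul_left, ip_mul_right, ScalarYangOn.ip_grad_grad]
        have h4 := h.speed_sq hyD
        have h5 := h.sign_sq
        field_simp
        rw [h4]
        linear_combination -coordGradSq G φ y * h5
      | succ j =>
        simp only [Fin.cons_zero, Fin.cons_succ, (hu y hy).2, e]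
        rw [ip_mul_left, h2, diagonal_apply_ne _ (Fin.succ_ne_zero j).symm, mul_zero]
    | succ i =>
      cases j using Fin.cases with
      | zero =>
        simp only [Fin.cons_zero, Fin.cons_succ, (hu y hy).2, e]
        rw [h.ip_comm hyD, ip_mul_left, h2, diagonal_apply_ne _ (Fin.succ_ne_zero i), mul_zero]
      | succ j =>
        simp only [Fin.cons_succ, h3, diagonal_apply, Fin.succ_inj]

end WarpedOn

end YangPure

end

noncomputable section

namespace YangPure

open Topology Metric Set

/-! ### The warping function -/

/-- `B` satisfies `B'' = 2εk - εR/3 B` as a function of `u`, with first integral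
`B'² = α² + 4εkB - εR/3 B²`; here `b = B'`. -/
structure WarpODE (ε k R α : ℝ) (u B b : E4 → ℝ) (s : Set E4) : Prop where
  exists_grad : ∀ y ∈ s, ∃ d : Fin 4 → ℝ, HasGrad u d y ∧ HasGrad B (fun a => b y * d a) y ∧
    HasGrad b (fun a => (2 * ε * k - ε * R / 3 * B y) * d a) y
  pos : ∀ y ∈ s, 0 < B y
  energy : ∀ y ∈ s, b y ^ 2 = α ^ 2 + 4 * ε * k * B y - ε * R / 3 * B y ^ 2

namespace WarpODE

variable {ε k R α : ℝ} {u B b : E4 → ℝ} {x₀ : E4} {r : ℝ}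

/-- The initial value of u is the required translation: the energy at x₀ is a difference of squares,
(b - a₀)(b + a₀) = 4εkB, so this value makes b = 2εku + a₀ at x₀, and b - 2εku is constant. -/
lemma quadratic (h : WarpODE ε k R α u B b (ball x₀ r)) (hr : 0 < r) (hR : R = 0) {a₀ : ℝ}
    (ha : a₀ ^ 2 = α ^ 2) (hb : b x₀ + a₀ ≠ 0) (hu : u x₀ = 2 * B x₀ / (b x₀ + a₀)) {y : E4}
    (hy : y ∈ ball x₀ r) : B y = ε * k * u y ^ 2 + a₀ * u y := by
  have hx₀ := mem_ball_self (x := x₀) hr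
  have he := h.energy x₀ hx₀
  have hu' : u x₀ * (b x₀ + a₀) = 2 * B x₀ := by rw [hu]; field_simp
  have h1 : ∀ y ∈ ball x₀ r, HasGrad (fun y => b y - 2 * ε * k * u y) (fun _ => 0) y := by
    intro y hy
    obtain ⟨d, hd, -, hb⟩ := h.exists_grad y hy
    exact (hb.sub (hd.const_mul _)).congr_grad fun a => by rw [hR]; ring
  have hb0 : b x₀ - 2 * ε * k * u x₀ = a₀ := by
    apply mul_right_cancel₀ hb
    rw [hR] at he
    linear_combination he - ha - 2 * ε * k * hu'
  have h2 (y) (hy : y ∈ ball x₀ r) : b y = 2 * ε * k * u y + a₀ := by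
    have := eq_of_hasGrad_zero h1 hy hx₀
    linarith
  have h3 : ∀ y ∈ ball x₀ r, HasGrad (fun y => B y - (ε * k * (u y * u y) + a₀ * u y))
      (fun _ => 0) y := by
    intro y hy
    obtain ⟨d, hd, hB, -⟩ := h.exists_grad y hy
    refine (hB.sub (((hd.mul hd).const_mul _).add (hd.const_mul _))).congr_grad fun a => ?_
    rw [h2 y hy]; ring
  have h4 := eq_of_hasGrad_zero h3 hy hx₀
  linear_combination h4 - 1 / 2 * hu' + 1 / 2 * u x₀ * hb0

/-- Partial fractions for df/du = α/(u(εku + a₀)); positivity of B keeps both factors away from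
zero. -/
lemma logarithm (h : WarpODE ε k R α u B b (ball x₀ r)) {f : E4 → ℝ}
    (hf : ∀ y ∈ ball x₀ r, ∀ d : Fin 4 → ℝ, HasGrad u d y → HasGrad f (fun a => α / B y * d a) y)
    {a₀ σ : ℝ} (hσ : α = σ * a₀)
    (hB : ∀ y ∈ ball x₀ r, B y = ε * k * u y ^ 2 + a₀ * u y) :
    ∃ c, ∀ y ∈ ball x₀ r, f y = σ * Real.log |u y / (ε * k * u y + a₀)| + c := by
  have h1 : ∀ y ∈ ball x₀ r, HasGrad
      (fun y => f y - σ * Real.log (u y / (ε * k * u y + a₀))) (fun _ => 0) y := by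
    intro y hy
    obtain ⟨d, hd, -, -⟩ := h.exists_grad y hy
    have hp := h.pos y hy
    have hBy := hB y hy
    have e : B y = u y * (ε * k * u y + a₀) := by rw [hBy]; ring
    rw [e] at hp
    have h0 : u y ≠ 0 := fun h => by simp [h] at hp
    have h0' : ε * k * u y + a₀ ≠ 0 := fun h => by simp [h] at hp
    refine ((hf y hy d hd).sub ((HasGrad.comp (Real.hasDerivAt_log (div_ne_zero h0 h0'))
      (hd.div ((hd.const_mul (ε * k)).add (HasGrad.const a₀ y)) h0')).const_mul σ)).congr_grad
      fun a => ?_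
    rw [e, hσ]
    field_simp
    ring
  refine ⟨f x₀ - σ * Real.log (u x₀ / (ε * k * u x₀ + a₀)), fun y hy => ?_⟩
  have := eq_of_hasGrad_zero h1 hy (mem_ball_self (pos_of_mem_ball hy))
  rw [Real.log_abs]
  linarith

lemma exponential (h : WarpODE ε k R α u B b (ball x₀ r)) (hr : 0 < r)
    (hR : 0 < -(ε * R)) : ∃ a₀ a₁ : ℝ,
      α ^ 2 = -(12 * ε * k ^ 2 / R) + 4 / 3 * ε * R * (a₀ * a₁) ∧
      ∀ y ∈ ball x₀ r, B y = 6 * k / R + a₀ * Real.exp (Real.sqrt (-(ε * R) / 3) * u y)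
        + a₁ * Real.exp (-(Real.sqrt (-(ε * R) / 3) * u y)) := by
  have hR0 : R ≠ 0 := fun h => by simp [h] at hR
  set l := √(-(ε * R) / 3) with hl
  have hl0 : 0 < l := Real.sqrt_pos.2 (by linarith)
  have hl2 : l ^ 2 = -(ε * R) / 3 := Real.sq_sqrt (by linarith)
  have hlk : l ^ 2 * (6 * k / R) = -(2 * ε * k) := by rw [hl2]; field_simp; ring
  set m := 6 * k / R with hm
  have hexp (y) (d) (hd : HasGrad u d y) : HasGrad (fun y => Real.exp (l * u y))
      (fun a => Real.exp (l * u y) * (l * d a)) y := HasGrad.comp (Real.hasDerivAt_exp _)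
        (hd.const_mul l)
  have hexn (y) (d) (hd : HasGrad u d y) : HasGrad (fun y => Real.exp (-(l * u y)))
      (fun a => Real.exp (-(l * u y)) * (-(l * d a))) y := HasGrad.comp (Real.hasDerivAt_exp _)
        (hd.const_mul l).neg
  -- Variation of constants about the equilibrium m = 6k/R: these are the coefficients of the two
  -- exponentials, and the ODE makes them constant. The formula for α² is the energy at x₀ expressed
  -- through their product.
  set β₀ : E4 → ℝ := fun y => 1 / 2 * (Real.exp (-(l * u y)) * (B y - m + l⁻¹ * b y)) with hβ₀
  set β₁ : E4 → ℝ := fun y => 1 / 2 * (Real.exp (l * u y) * (B y - m - l⁻¹ * b y)) with hβ₁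
  have h0 : ∀ y ∈ ball x₀ r, HasGrad β₀ (fun _ => 0) y := by
    intro y hy
    obtain ⟨d, hd, hB, hb⟩ := h.exists_grad y hy
    refine (((hexn y d hd).mul ((hB.sub (HasGrad.const m y)).add
      (hb.const_mul l⁻¹))).const_mul (1 / 2)).congr_grad fun a => ?_
    have e : 2 * ε * k - ε * R / 3 * B y = l ^ 2 * (B y - m) := by
      rw [mul_sub, hlk, hl2]; ring
    rw [e]
    field_simp
    ring
  have h1 : ∀ y ∈ ball x₀ r, HasGrad β₁ (fun _ => 0) y := by
    intro y hy
    obtain ⟨d, hd, hB, hb⟩ := h.exists_grad y hy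
    refine (((hexp y d hd).mul ((hB.sub (HasGrad.const m y)).sub
      (hb.const_mul l⁻¹))).const_mul (1 / 2)).congr_grad fun a => ?_
    have e : 2 * ε * k - ε * R / 3 * B y = l ^ 2 * (B y - m) := by
      rw [mul_sub, hlk, hl2]; ring
    rw [e]
    field_simp
    ring
  have hpn (y) : Real.exp (l * u y) * Real.exp (-(l * u y)) = 1 := by
    rw [← Real.exp_add, add_neg_cancel, Real.exp_zero]
  refine ⟨β₀ x₀, β₁ x₀, ?_, fun y hy => ?_⟩
  · have he := h.energy x₀ (mem_ball_self hr)
    have e : β₀ x₀ * β₁ x₀ = 1 / 4 * ((B x₀ - m) ^ 2 - l⁻¹ ^ 2 * b x₀ ^ 2) := by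
      simp only [hβ₀, hβ₁]
      linear_combination 1 / 4 * ((B x₀ - m) ^ 2 - l⁻¹ ^ 2 * b x₀ ^ 2) * hpn x₀
    have e1 : 12 * ε * k ^ 2 / R = -(l ^ 2 * m ^ 2) := by rw [hl2, hm]; field_simp; ring
    have e2 : 4 / 3 * ε * R = -4 * l ^ 2 := by rw [hl2]; ring
    have e3 : 4 * ε * k = -2 * l ^ 2 * m := by linear_combination 2 * hlk
    have e4 : ε * R / 3 = -l ^ 2 := by rw [hl2]; ring
    rw [e, e1, e2, he, e4, e3]
    field_simp
    ring
  · rw [← eq_of_hasGrad_zero h0 hy (mem_ball_self hr), ← eq_of_hasGrad_zero h1 hy (mem_ball_self hr)]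
    simp only [hβ₀, hβ₁]
    linear_combination (m - B y) * hpn y

lemma trigonometric (h : WarpODE ε k R α u B b (ball x₀ r)) (hr : 0 < r)
    (hR : 0 < ε * R) : ∃ b₀ b₁ : ℝ,
      α ^ 2 = -(12 * ε * k ^ 2 / R) + 1 / 3 * ε * R * (b₀ ^ 2 + b₁ ^ 2) ∧
      ∀ y ∈ ball x₀ r, B y = 6 * k / R + b₀ * Real.cos (Real.sqrt (ε * R / 3) * u y)
        + b₁ * Real.sin (Real.sqrt (ε * R / 3) * u y) := by
  have hR0 : R ≠ 0 := fun h => by simp [h] at hR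
  set l := √(ε * R / 3) with hl
  have hl0 : 0 < l := Real.sqrt_pos.2 (by linarith)
  have hl2 : l ^ 2 = ε * R / 3 := Real.sq_sqrt (by linarith)
  have hlk : l ^ 2 * (6 * k / R) = 2 * ε * k := by rw [hl2]; field_simp; ring
  set m := 6 * k / R with hm
  have hcos (y) (d) (hd : HasGrad u d y) : HasGrad (fun y => Real.cos (l * u y))
      (fun a => -Real.sin (l * u y) * (l * d a)) y := HasGrad.comp (Real.hasDerivAt_cos _)
        (hd.const_mul l)
  have hsin (y) (d) (hd : HasGrad u d y) : HasGrad (fun y => Real.sin (l * u y))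
      (fun a => Real.cos (l * u y) * (l * d a)) y := HasGrad.comp (Real.hasDerivAt_sin _)
        (hd.const_mul l)
  -- Rotating (B - m, b/l) back by the angle lu yields constants; the sum of their squares enters
  -- the energy.
  set β₀ : E4 → ℝ := fun y => (B y - m) * Real.cos (l * u y) - l⁻¹ * (b y * Real.sin (l * u y))
    with hβ₀
  set β₁ : E4 → ℝ := fun y => (B y - m) * Real.sin (l * u y) + l⁻¹ * (b y * Real.cos (l * u y))
    with hβ₁
  have h0 : ∀ y ∈ ball x₀ r, HasGrad β₀ (fun _ => 0) y := by
    intro y hy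
    obtain ⟨d, hd, hB, hb⟩ := h.exists_grad y hy
    refine (((hB.sub (HasGrad.const m y)).mul (hcos y d hd)).sub
      ((hb.mul (hsin y d hd)).const_mul l⁻¹)).congr_grad fun a => ?_
    rw [← hl2, ← hlk]
    field_simp
    ring
  have h1 : ∀ y ∈ ball x₀ r, HasGrad β₁ (fun _ => 0) y := by
    intro y hy
    obtain ⟨d, hd, hB, hb⟩ := h.exists_grad y hy
    refine (((hB.sub (HasGrad.const m y)).mul (hsin y d hd)).add
      ((hb.mul (hcos y d hd)).const_mul l⁻¹)).congr_grad fun a => ?_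
    rw [← hl2, ← hlk]
    field_simp
    ring
  refine ⟨β₀ x₀, β₁ x₀, ?_, fun y hy => ?_⟩
  · have he := h.energy x₀ (mem_ball_self hr)
    have hsc := Real.sin_sq_add_cos_sq (l * u x₀)
    have e : β₀ x₀ ^ 2 + β₁ x₀ ^ 2 = (B x₀ - m) ^ 2 + l⁻¹ ^ 2 * b x₀ ^ 2 := by
      simp only [hβ₀, hβ₁]
      linear_combination ((B x₀ - m) ^ 2 + l⁻¹ ^ 2 * b x₀ ^ 2) * hsc
    have e1 : 12 * ε * k ^ 2 / R = l ^ 2 * m ^ 2 := by rw [hl2, hm]; field_simp; ring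
    have e2 : 1 / 3 * ε * R = l ^ 2 := by rw [hl2]; ring
    have e3 : 4 * ε * k = 2 * l ^ 2 * m := by linear_combination -2 * hlk
    rw [e, e1, e2, he, ← hl2, e3]
    field_simp
    ring
  · rw [← eq_of_hasGrad_zero h0 hy (mem_ball_self hr), ← eq_of_hasGrad_zero h1 hy (mem_ball_self hr)]
    simp only [hβ₀, hβ₁]
    linear_combination (m - B y) * Real.sin_sq_add_cos_sq (l * u y)

end WarpODE

end YangPure

end

noncomputable section

namespace YangPure

open Topology Metric Set

/-! ### Local coordinates -/

/-- The inverse function theorem for a map with injective derivatives: a local diffeomorphism onto a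
ball. -/
lemma exists_local_inverse {f : E4 → E4} {D : Set E4} (hD : IsOpen D) (hf : ContDiffOn ℝ ∞ f D)
    (hinj : ∀ x ∈ D, Function.Injective (fderiv ℝ f x)) {x₀ : E4} (hx₀ : x₀ ∈ D) :
    ∃ (P : OpenPartialHomeomorph E4 E4) (ρ : ℝ), 0 < ρ ∧ (∀ x, P x = f x) ∧ P.source ⊆ D ∧
      x₀ ∈ P.source ∧ P.target = ball (f x₀) ρ ∧ ContDiffOn ℝ ∞ P.symm P.target := by
  have heq (x) (hx : x ∈ D) : ∃ L : E4 ≃L[ℝ] E4, HasFDerivAt f (L : E4 →L[ℝ] E4) x := by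
    refine ⟨(LinearEquiv.ofInjectiveEndo _ (hinj x hx)).toContinuousLinearEquiv, ?_⟩
    convert! ((hf.contDiffAt (hD.mem_nhds hx)).differentiableAt (by simp)).hasFDerivAt using 1
  obtain ⟨L, hL⟩ := heq x₀ hx₀
  have hat := hf.contDiffAt (hD.mem_nhds hx₀)
  set Q := hat.toOpenPartialHomeomorph f hL (by simp) with hQ
  have hxQ : x₀ ∈ Q.source := hat.mem_toOpenPartialHomeomorph_source hL (by simp)
  have hopen : IsOpen (Q.target ∩ Q.symm ⁻¹' D) := Q.isOpen_inter_preimage_symm hD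
  have hmem : f x₀ ∈ Q.target ∩ Q.symm ⁻¹' D :=
    ⟨Q.map_source hxQ, by
      change Q.symm (Q x₀) ∈ D
      rwa [Q.left_inv hxQ]⟩
  obtain ⟨ρ, hρ, hball⟩ := Metric.isOpen_iff.1 hopen _ hmem
  -- The target is cut down to a ball, so that it contains the segments joining its points to their
  -- projections on the u-axis.
  refine ⟨(Q.symm.restrOpen (ball (f x₀) ρ) isOpen_ball).symm, ρ, hρ, fun x => rfl, ?_, ?_, ?_, ?_⟩
  · intro x hx
    have hx' : x ∈ Q.source ∧ Q x ∈ ball (f x₀) ρ := by simpa using hx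
    have := (hball hx'.2).2
    rwa [mem_preimage, Q.left_inv hx'.1] at this
  · simpa using ⟨hxQ, (show Q x₀ ∈ ball (f x₀) ρ from mem_ball_self hρ)⟩
  · simpa using (hball.trans inter_subset_left)
  · intro y hy
    have hy' : y ∈ ball (f x₀) ρ := by
      have : y ∈ Q.target ∧ y ∈ ball (f x₀) ρ := by simpa using hy
      exact this.2
    obtain ⟨L, hL⟩ := heq _ (hball hy').2
    exact (Q.contDiffAt_symm (hball hy').1 hL
      (hf.contDiffAt (hD.mem_nhds (hball hy').2))).contDiffWithinAt

/-- The point with coordinates `(t, 0, 0, 0)`. -/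
def axis (t : ℝ) : E4 := EuclideanSpace.single 0 t

/-- Orthogonal projection to the axis does not increase the distance to a point of the axis. -/
lemma axis_mem_ball {u₀ ρ : ℝ} {y : E4} (hy : y ∈ ball (axis u₀) ρ) : axis (y 0) ∈ ball (axis u₀) ρ := by
  rw [mem_ball_iff_norm] at hy ⊢
  refine lt_of_le_of_lt ?_ hy
  have h1 : axis (y 0) - axis u₀ = EuclideanSpace.single 0 ((y - axis u₀) 0) := by
    ext i
    fin_cases i <;> simp [axis]
  rw [h1, PiLp.norm_single]
  exact PiLp.norm_apply_le _ _

/-- A function whose gradient is proportional to the first coordinate is a function of it. -/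
lemma eq_axis_of_hasGrad {g c : E4 → ℝ} {u₀ ρ : ℝ}
    (hg : ∀ y ∈ ball (axis u₀) ρ, HasGrad g (fun i => if i = 0 then c y else 0) y) {y : E4}
    (hy : y ∈ ball (axis u₀) ρ) : g y = g (axis (y 0)) := by
  have hp := axis_mem_ball hy
  set p := axis (y 0) with hp_def
  have hmem (t : ℝ) (ht : t ∈ Icc (0 : ℝ) 1) : p + t • (y - p) ∈ ball (axis u₀) ρ :=
    (convex_ball _ _).add_smul_sub_mem hp hy ht
  have hd (t : ℝ) (ht : t ∈ Icc (0 : ℝ) 1) :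
      HasDerivAt (fun t : ℝ => g (p + t • (y - p))) 0 t := by
    have h1 : HasDerivAt (fun t : ℝ => p + t • (y - p)) (y - p) t := by
      convert! ((hasDerivAt_id t).smul_const (y - p)).const_add p using 1
      simp
    have h2 := hg _ (hmem t ht)
    refine (HasFDerivAt.comp_hasDerivAt (l := g) t h2.1.hasFDerivAt h1).congr_deriv ?_
    rw [h2.fderiv_apply]
    simp [hp_def, axis]
  have := constant_of_has_deriv_right_zero (f := fun t : ℝ => g (p + t • (y - p))) (a := 0) (b := 1)
    (fun t ht => (hd t ht).continuousAt.continuousWithinAt)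
    (fun t ht => (hd t ⟨ht.1, ht.2.le⟩).hasDerivWithinAt) 1 (by simp)
  simpa using this

lemma hasDerivAt_axis {g c : E4 → ℝ} {u₀ ρ : ℝ}
    (hg : ∀ y ∈ ball (axis u₀) ρ, HasGrad g (fun i => if i = 0 then c y else 0) y) {y : E4}
    (hy : y ∈ ball (axis u₀) ρ) : HasDerivAt (fun t => g (axis t)) (c (axis (y 0))) (y 0) := by
  have h1 : HasDerivAt axis (axis 1) (y 0) := by
    have h0 : axis = fun t : ℝ => t • axis 1 := by
      ext t i
      simp [axis]
    rw [h0]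
    convert! (hasDerivAt_id (y 0)).smul_const (axis 1) using 1
  have h2 := hg _ (axis_mem_ball hy)
  refine (HasFDerivAt.comp_hasDerivAt (l := g) (y 0) h2.1.hasFDerivAt h1).congr_deriv ?_
  rw [h2.fderiv_apply]
  simp [axis]

namespace WarpedOn

variable {G : E4 → Matrix (Fin 4) (Fin 4) ℝ} {D : Set E4} {q : E4} {φ W : E4 → ℝ} {ε α k : ℝ}

/-- Since dφ = |∇φ| du, the gradient of α/|∇φ| is -2αμ du. The second derivative follows from dμ,
and the energy law is the Gauss equation rewritten with R = N - 4W. -/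
lemma warpODE (h : WarpedOn G φ W D ε α k) {R : ℝ} (hR : ∀ y ∈ D, coordScalar G y = R)
    {u : E4 → ℝ} {s : Set E4} (hs : s ⊆ D)
    (hu : ∀ y ∈ s, HasGrad u (fun a => pd a φ y / speed G φ ε y) y) :
    WarpODE ε k R α u (fun y => α / speed G φ ε y) (fun y => -2 * α * hessCoeff G φ y) s where
  exists_grad y hy := by
    have hyD := hs hy
    have hsp := h.speed_pos hyD
    have hsq := h.speed_sq hyD
    have hα := h.pos
    have hN := h.grad_ne_zero y hyD
    refine ⟨_, hu y hy, (h.hasGrad_warp hyD).congr_grad fun a => by field_simp,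
      ((h.hasGrad_hessCoeff hyD).const_mul (-2 * α)).congr_grad fun a => ?_⟩
    have hc := h.curv y hyD
    have hL : ScalarYangOn.radialCurv G φ W y * coordGradSq G φ y
        = (coordGradSq G φ y - W y) / 3 := by
      rw [ScalarYangOn.radialCurv]; field_simp
    rw [← hR y hyD, h.scalar_eq hyD]
    generalize coordGradSq G φ y = N at *
    generalize speed G φ ε y = t at *
    generalize ScalarYangOn.radialCurv G φ W y = L at *
    generalize hessCoeff G φ y = μ at *
    have hc' : 6 * (k * t) = α * (6 * N * μ ^ 2 - N - 2 * W y) := by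
      field_simp at hc; linear_combination hc
    have key : -6 * α * t ^ 2 * (L - μ ^ 2) = 6 * ε * k * t - ε * (N - 4 * W y) * α := by
      linear_combination -6 * α * (L - μ ^ 2) * hsq - 6 * α * ε * hL - ε * hc'
    field_simp
    linear_combination pd a φ y * key
  pos y hy := div_pos h.pos (h.speed_pos (hs hy))
  energy y hy := by
    have hyD := hs hy
    have hsp := h.speed_pos hyD
    have hsq := h.speed_sq hyD
    have hα := h.pos
    have hc := h.curv y hyD
    rw [← hR y hyD, h.scalar_eq hyD]
    generalize coordGradSq G φ y = N at *
    generalize speed G φ ε y = t at *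
    generalize hessCoeff G φ y = μ at *
    have hc' : 6 * (k * t) = α * (6 * N * μ ^ 2 - N - 2 * W y) := by
      field_simp at hc; linear_combination hc
    field_simp
    linear_combination (12 * α * μ ^ 2 - 3 * α) * hsq - 2 * ε * hc'

end WarpedOn

end YangPure

end

/-! ### Pull-back of metrics and charts with given coordinate functions -/

noncomputable section

namespace YangPure

open Topology Metric Set Matrix

/-- The Jacobian matrix `∂Fᵃ/∂yⁱ`. -/
def jacobian (F : E4 → E4) (y : E4) : Matrix (Fin 4) (Fin 4) ℝ :=
  of fun a i => fderiv ℝ F y (EuclideanSpace.single i 1) a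

/-- The components of the pull-back of a metric. -/
def pullback (G : E4 → Matrix (Fin 4) (Fin 4) ℝ) (F : E4 → E4) (y : E4) :
    Matrix (Fin 4) (Fin 4) ℝ :=
  (jacobian F y)ᵀ * G (F y) * jacobian F y

lemma HasGrad.comp_map {f : E4 → ℝ} {f' : Fin 4 → ℝ} {F : E4 → E4} {y : E4}
    (hf : HasGrad f f' (F y)) (hF : DifferentiableAt ℝ F y) :
    HasGrad (fun z => f (F z)) (fun i => ∑ a, jacobian F y a i * f' a) y := by
  have h1 := hf.1.hasFDerivAt.comp y hF.hasFDerivAt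
  refine ⟨h1.differentiableAt, fun i => ?_⟩
  rw [pd]
  change fderiv ℝ (f ∘ F) y _ = _
  rw [h1.fderiv, ContinuousLinearMap.comp_apply, hf.fderiv_apply]
  rfl

/-- The inverse of the pull-back is the push-forward of the inverse. -/
lemma inv_pullback {G : E4 → Matrix (Fin 4) (Fin 4) ℝ} {F : E4 → E4} {y : E4}
    {K d : Matrix (Fin 4) (Fin 4) ℝ} (hG : IsUnit (G (F y)).det) (hKJ : K * jacobian F y = 1)
    (hK : K * (G (F y))⁻¹ * Kᵀ = d) : d * pullback G F y = 1 := by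
  have hJK : jacobian F y * K = 1 := mul_eq_one_comm.1 hKJ
  have h1 : Kᵀ * (jacobian F y)ᵀ = 1 := by rw [← transpose_mul, hJK, transpose_one]
  calc d * pullback G F y
      = K * ((G (F y))⁻¹ * ((Kᵀ * (jacobian F y)ᵀ) * G (F y))) * jacobian F y := by
        rw [← hK, pullback]; simp only [Matrix.mul_assoc]
    _ = 1 := by rw [h1, Matrix.one_mul, nonsing_inv_mul _ hG, Matrix.mul_one, hKJ]

/-- Local coordinates with prescribed component functions. -/
lemma exists_chart_of_components {Ψ : Fin 4 → E4 → ℝ} {D : Set E4} (hD : IsOpen D)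
    (hΨ : ∀ i, ContDiffOn ℝ ∞ (Ψ i) D)
    (hdet : ∀ x ∈ D, IsUnit (of fun i a => pd a (Ψ i) x : Matrix (Fin 4) (Fin 4) ℝ))
    {x₀ : E4} (hx₀ : x₀ ∈ D) {u₀ : ℝ} (h0 : Ψ 0 x₀ = u₀) (hs : ∀ i : Fin 3, Ψ i.succ x₀ = 0) :
    ∃ (P : OpenPartialHomeomorph E4 E4) (ρ : ℝ), P.source ⊆ D ∧ x₀ ∈ P.source ∧
      ContDiffOn ℝ ∞ P P.source ∧ ContDiffOn ℝ ∞ P.symm P.target ∧ P.target = ball (axis u₀) ρ ∧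
      ∀ y ∈ P.target, (∀ i, Ψ i (P.symm y) = y i) ∧
        (of fun i a => pd a (Ψ i) (P.symm y)) * jacobian P.symm y = 1 := by
  set f : E4 → E4 := fun x => WithLp.toLp 2 fun i => Ψ i x with hf
  have hfs : ContDiffOn ℝ ∞ f D := contDiffOn_euclidean.2 hΨ
  have hfd (x) (hx : x ∈ D) (v : E4) (i : Fin 4) : fderiv ℝ f x v i = ∑ a, v a * pd a (Ψ i) x := by
    have h1 := ((hfs.contDiffAt (hD.mem_nhds hx)).differentiableAt (by simp)).hasFDerivAt
    have h2 := (EuclideanSpace.proj i : E4 →L[ℝ] ℝ).hasFDerivAt.comp x h1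
    rw [← ((hΨ i).hasGrad hD hx).fderiv_apply]
    have h3 : fderiv ℝ (Ψ i) x = (EuclideanSpace.proj i : E4 →L[ℝ] ℝ).comp (fderiv ℝ f x) := h2.fderiv
    rw [h3]; rfl
  have hinj : ∀ x ∈ D, Function.Injective (fderiv ℝ f x) := by
    intro x hx
    rw [injective_iff_map_eq_zero]
    intro v hv
    have h1 : (of fun i a => pd a (Ψ i) x : Matrix (Fin 4) (Fin 4) ℝ) *ᵥ v = 0 := by
      ext i
      have := hfd x hx v i
      rw [hv] at this
      simp only [mulVec, dotProduct, of_apply, Pi.zero_apply]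
      rw [Finset.sum_congr rfl fun a _ => mul_comm _ _, ← this]; rfl
    have h2 := (mulVec_injective_iff_isUnit.2 (hdet x hx)) (h1.trans (mulVec_zero _).symm)
    ext i
    exact congr_fun h2 i
  obtain ⟨P, ρ, hρ, hPf, hPD, hxP, hPt, hPs⟩ := exists_local_inverse hD hfs hinj hx₀
  have hfx : f x₀ = axis u₀ := by
    ext i
    cases i using Fin.cases with
    | zero => simp [hf, h0, axis]
    | succ i => simp [hf, hs, axis]
  have hcoord (y) (hy : y ∈ P.target) (i) : Ψ i (P.symm y) = y i := by
    have : f (P.symm y) = y := by rw [← hPf, P.right_inv hy]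
    exact congrArg (fun z : E4 => z i) this
  refine ⟨P, ρ, hPD, hxP, (hfs.mono hPD).congr fun x _ => hPf x, hPs, by rw [hPt, hfx],
    fun y hy => ⟨hcoord y hy, ?_⟩⟩
  have hxD := hPD (P.map_target hy)
  ext i j
  have h1 := (((hΨ i).hasGrad hD hxD).comp_map
    ((hPs.contDiffAt (P.open_target.mem_nhds hy)).differentiableAt (by simp))).2 j
  have h2 : (fun z => Ψ i (P.symm z)) =ᶠ[𝓝 y] fun z => (EuclideanSpace.proj i : E4 →L[ℝ] ℝ) z :=
    Filter.eventuallyEq_of_mem (P.open_target.mem_nhds hy) fun z hz => hcoord z hz i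
  rw [pd, h2.fderiv_eq, ContinuousLinearMap.fderiv] at h1
  rw [mul_apply, one_apply]
  refine (Finset.sum_congr rfl fun a _ => mul_comm _ _).trans (h1.symm.trans ?_)
  simp

end YangPure

end

/-! ### The normal form in a coordinate domain -/

noncomputable section

namespace YangPure

open Topology Metric Set Matrix

/-- The metric, the field and the potential in normal form. -/
structure IsNormalForm (ε R k a : ℝ) (A f : ℝ → ℝ) (g : E4 → Matrix (Fin 4) (Fin 4) ℝ)
    (φ W : E4 → ℝ) (s : Set E4) : Prop where
  curv : k = -1 ∨ k = 0 ∨ k = 1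
  ne_zero : a ≠ 0
  pos : ∀ y ∈ s, 0 < A (y 0)
  factor_ne_zero : ∀ y ∈ s, confFactor ε k y ≠ 0
  metric : ∀ y ∈ s, g y = lineElement ε k A y
  field : ∀ y ∈ s, φ y = f (y 0)
  hasDerivAt : ∀ y ∈ s, HasDerivAt f (a / A (y 0) ^ 2) (y 0)
  potential : ∀ y ∈ s, W y = ε * a ^ 2 / (4 * A (y 0) ^ 4) - R / 4
  of_eq_zero : R = 0 → ∃ a₀ σ c : ℝ, (σ = 1 ∨ σ = -1) ∧ a = σ * a₀ ∧ ∀ y ∈ s,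
    A (y 0) ^ 2 = ε * k * y 0 ^ 2 + a₀ * y 0 ∧
    f (y 0) = σ * Real.log |y 0 / (ε * k * y 0 + a₀)| + c
  of_neg : 0 < -(ε * R) → ∃ a₀ a₁ : ℝ,
    a ^ 2 = -(12 * ε * k ^ 2 / R) + 4 / 3 * ε * R * (a₀ * a₁) ∧ ∀ y ∈ s,
      A (y 0) ^ 2 = 6 * k / R + a₀ * Real.exp (Real.sqrt (-(ε * R) / 3) * y 0)
        + a₁ * Real.exp (-(Real.sqrt (-(ε * R) / 3) * y 0))
  of_pos : 0 < ε * R → ∃ b₀ b₁ : ℝ,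
    a ^ 2 = -(12 * ε * k ^ 2 / R) + 1 / 3 * ε * R * (b₀ ^ 2 + b₁ ^ 2) ∧ ∀ y ∈ s,
      A (y 0) ^ 2 = 6 * k / R + b₀ * Real.cos (Real.sqrt (ε * R / 3) * y 0)
        + b₁ * Real.sin (Real.sqrt (ε * R / 3) * y 0)

lemma eq_diagonal_of_mul_eq_one {d d' : Fin 4 → ℝ} {g : Matrix (Fin 4) (Fin 4) ℝ}
    (h : diagonal d * g = 1) (hd : ∀ i, d' i * d i = 1) : g = diagonal d' := by
  have h1 : diagonal d' * diagonal d = 1 := by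
    rw [diagonal_mul_diagonal, ← diagonal_one]; congr 1; funext i; exact hd i
  calc g = diagonal d' * diagonal d * g := by rw [h1, Matrix.one_mul]
    _ = diagonal d' := by rw [Matrix.mul_assoc, h, Matrix.mul_one]

theorem ScalarYangOn.exists_normal_chart {G : E4 → Matrix (Fin 4) (Fin 4) ℝ} {φ W : E4 → ℝ}
    {D : Set E4} (h : ScalarYangOn G φ W D) {x₀ : E4} (hx₀ : x₀ ∈ D) {ε R : ℝ}
    (hε : ε = Real.sign (coordGradSq G φ x₀)) (hR : R = coordScalar G x₀) :
    ∃ P : OpenPartialHomeomorph E4 E4, P.source ⊆ D ∧ x₀ ∈ P.source ∧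
      ContDiffOn ℝ ∞ P P.source ∧ ContDiffOn ℝ ∞ P.symm P.target ∧ ∃ (k a : ℝ) (A f : ℝ → ℝ),
        IsNormalForm ε R k a A f (pullback G P.symm) (fun y => φ (P.symm y))
          (fun y => W (P.symm y)) P.target := by
  obtain ⟨r₁, hr₁, hsub, α, k, hk, hw⟩ := h.exists_warpedOn hx₀
  rw [← hε] at hw
  have hx₁ : x₀ ∈ ball x₀ r₁ := mem_ball_self hr₁
  have hRc : ∀ y ∈ ball x₀ r₁, coordScalar G y = R := fun y hy => by
    rw [hR]; exact eq_of_hasGrad_zero (fun z hz => hw.hasGrad_scalar hz) hy hx₁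
  set B : E4 → ℝ := fun y => α / speed G φ ε y with hB
  set b : E4 → ℝ := fun y => -2 * α * hessCoeff G φ y with hb
  -- The sign of a₀ = ±α is chosen to agree with that of b(x₀), so that the denominator b + a₀ in
  -- the initial value of u cannot vanish. Only the case R = 0 needs this value of u.
  obtain ⟨a₀, σ, hσ, hασ, ha₀, hba⟩ : ∃ a₀ σ : ℝ, (σ = 1 ∨ σ = -1) ∧ α = σ * a₀ ∧
      a₀ ^ 2 = α ^ 2 ∧ b x₀ + a₀ ≠ 0 := by
    have hα := hw.pos
    rcases le_total 0 (b x₀) with h0 | h0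
    · exact ⟨α, 1, by simp, by ring, by ring, by positivity⟩
    · exact ⟨-α, -1, by simp, by ring, by ring, (by linarith : b x₀ + -α < 0).ne⟩
  obtain ⟨r, hr, hball, Ψ, hΨs, hΨ0, hΨi, hΨ⟩ :=
    hw.exists_coordinates hx₁ (2 * B x₀ / (b x₀ + a₀))
  have hode := hw.warpODE hRc hball (u := Ψ 0) fun y hy => (hΨ y hy).2.1
  have hγ (y) (hy : y ∈ ball x₀ r) : 0 < speed G φ ε y / α :=
    div_pos (hw.speed_pos (hball hy)) hw.pos
  have hε0 : ε ≠ 0 := fun h => by have := hw.sign_sq; simp [h] at this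
  have hη (i) : leafSign ε i ≠ 0 := fun h => by
    have := leafSign_sq hw.sign_sq i; simp [h] at this
  set d : E4 → Fin 4 → ℝ := fun y => Fin.cons ε fun i =>
    leafSign ε i * (speed G φ ε y / α * leafFactor ε k (fun i => Ψ i.succ) y ^ 2) with hd
  have hd0 (y) (hy : y ∈ ball x₀ r) (i) : d y i ≠ 0 := by
    have h1 := hγ y hy
    have h2 := (hΨ y hy).1
    cases i using Fin.cases with
    | zero => exact hε0
    | succ i => exact mul_ne_zero (hη i) (by positivity)
  have hdiag (y) (hy : y ∈ ball x₀ r) : (of fun i a => pd a (Ψ i) y : Matrix (Fin 4) (Fin 4) ℝ)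
      * (G y)⁻¹ * (of fun i a => pd a (Ψ i) y : Matrix (Fin 4) (Fin 4) ℝ)ᵀ = diagonal (d y) := by
    ext i j
    rw [mul_mul_transpose_apply]
    exact (hΨ y hy).2.2 i j
  obtain ⟨P, ρ, hPD, hxP, hPs, hPi, hPt, hP⟩ := exists_chart_of_components isOpen_ball hΨs
    (fun y hy => by
      have h1 : IsUnit (diagonal (d y)) := by
        rw [isUnit_iff_isUnit_det, det_diagonal]
        exact (Finset.prod_ne_zero_iff.2 fun i _ => hd0 y hy i).isUnit
      rw [← hdiag y hy, Matrix.mul_assoc] at h1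
      exact isUnit_of_mul_isUnit_left h1) (mem_ball_self hr) hΨ0 hΨi
  have hmem (y) (hy : y ∈ P.target) : P.symm y ∈ ball x₀ r := hPD (P.map_target hy)
  -- In the new coordinates Ψ₀ is the first one, so a gradient proportional to dΨ₀ has only its
  -- first component.
  have hpush {g c : E4 → ℝ} (hg : ∀ x ∈ ball x₀ r, ∀ e : Fin 4 → ℝ, HasGrad (Ψ 0) e x →
      HasGrad g (fun a => c x * e a) x) : ∀ y ∈ P.target, HasGrad (fun y => g (P.symm y))
        (fun i => if i = 0 then c (P.symm y) else 0) y := by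
    intro y hy
    have h1 := (hg _ (hmem y hy) _ ((hΨs 0).hasGrad isOpen_ball (hmem y hy))).comp_map
      ((hPi.contDiffAt (P.open_target.mem_nhds hy)).differentiableAt (by simp))
    refine h1.congr_grad fun i => ?_
    have h2 := congr_fun (congr_fun (hP y hy).2 0) i
    rw [mul_apply, one_apply] at h2
    simp only [of_apply] at h2
    calc _ = c (P.symm y) * ∑ a, pd a (Ψ 0) (P.symm y) * jacobian P.symm y a i := by
          rw [Finset.mul_sum]; exact Finset.sum_congr rfl fun a _ => by ring
      _ = _ := by rw [h2]; simp [eq_comm]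
  have hBg : ∀ x ∈ ball x₀ r, ∀ e : Fin 4 → ℝ, HasGrad (Ψ 0) e x →
      HasGrad B (fun a => b x * e a) x := fun x hx e he => by
    obtain ⟨e', he', h1, -⟩ := hode.exists_grad x hx
    exact h1.congr_grad fun a => by rw [he'.unique he a]
  have hφg : ∀ x ∈ ball x₀ r, ∀ e : Fin 4 → ℝ, HasGrad (Ψ 0) e x →
      HasGrad φ (fun a => α / B x * e a) x := fun x hx e he =>
    (hw.hasGrad_field (hball hx)).congr_grad fun a => by
      have hs := hw.speed_pos (hball hx)
      have hα := hw.pos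
      rw [he.unique (hΨ x hx).2.1 a, hB]
      field_simp
  have hBaxis := hpush hBg
  have hφaxis := hpush hφg
  rw [hPt] at hBaxis hφaxis
  -- `B` depends on u alone, so its values on the axis determine A.
  set A : ℝ → ℝ := fun t => √(B (P.symm (axis t))) with hA
  have hBpos (y) (hy : y ∈ P.target) : 0 < B (P.symm y) := hode.pos _ (hmem y hy)
  have hBe (y) (hy : y ∈ P.target) : B (P.symm (axis (y 0))) = B (P.symm y) :=
    (eq_axis_of_hasGrad hBaxis (hPt ▸ hy)).symm
  have hA2 (y) (hy : y ∈ P.target) : A (y 0) ^ 2 = B (P.symm y) := by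
    rw [hA]; beta_reduce; rw [hBe y hy]; exact Real.sq_sqrt (hBpos y hy).le
  have hA0 (y) (hy : y ∈ P.target) : 0 < A (y 0) := by
    rw [hA]; beta_reduce; rw [hBe y hy]; exact Real.sqrt_pos.2 (hBpos y hy)
  have hcf (y) (hy : y ∈ P.target) :
      confFactor ε k y = leafFactor ε k (fun i => Ψ i.succ) (P.symm y) := by
    have h1 (i) := (hP y hy).1 i
    simp only [confFactor, leafFactor, Fin.sum_univ_three, h1, leafSign]
    simp
    ring_nf
    simp
  have hfe (y) (hy : y ∈ P.target) : φ (P.symm y) = φ (P.symm (axis (y 0))) :=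
    eq_axis_of_hasGrad hφaxis (hPt ▸ hy)
  have hcf0 (y) (hy : y ∈ P.target) : 0 < confFactor ε k y := by
    rw [hcf y hy]; exact (hΨ _ (hmem y hy)).1
  refine ⟨P, hPD.trans (hball.trans hsub), hxP, hPs, hPi, k, α, A, fun t => φ (P.symm (axis t)),
    ⟨hk, hw.pos.ne', hA0, fun y hy => (hcf0 y hy).ne', fun y hy => ?_, hfe, fun y hy => ?_,
      fun y hy => ?_, fun hR0 => ?_, fun hR0 => ?_, fun hR0 => ?_⟩⟩
  · have hx := hmem y hy
    have hdet : IsUnit (G (P.symm y)).det := (hw.det_ne_zero _ (hball hx)).isUnit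
    -- The inner products of the coordinate differentials give a diagonal inverse metric, which is
    -- inverted entry by entry.
    refine eq_diagonal_of_mul_eq_one (inv_pullback hdet (hP y hy).2 (hdiag _ hx)) fun i => ?_
    have h1 := hcf0 y hy
    have h2 := hw.speed_pos (hball hx)
    have h3 := hw.pos
    rw [hA2 y hy]
    simp only [hd, ← hcf y hy, hB]
    have h4 := hw.sign_sq
    fin_cases i
    · exact h4
    · change α / speed G φ ε (P.symm y) / confFactor ε k y ^ 2
        * (1 * (speed G φ ε (P.symm y) / α * confFactor ε k y ^ 2)) = 1
      field_simp
    · change α / speed G φ ε (P.symm y) / confFactor ε k y ^ 2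
        * (1 * (speed G φ ε (P.symm y) / α * confFactor ε k y ^ 2)) = 1
      field_simp
    · change -ε * (α / speed G φ ε (P.symm y) / confFactor ε k y ^ 2)
        * (-ε * (speed G φ ε (P.symm y) / α * confFactor ε k y ^ 2)) = 1
      field_simp
      linear_combination h4
  · have := hasDerivAt_axis hφaxis (hPt ▸ hy)
    rwa [hBe y hy, ← hA2 y hy] at this
  · have hx := hball (hmem y hy)
    have h1 := hw.scalar_eq hx
    rw [hRc _ hx] at h1
    have h2 : A (y 0) ^ 4 = B (P.symm y) ^ 2 := by rw [← hA2 y hy]; ring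
    have h3 := hw.speed_pos hx
    have h4 := hw.pos
    have h5 := hw.speed_sq hx
    have h6 := hw.sign_sq
    rw [h2]
    simp only [hB]
    field_simp
    rw [h5]
    linear_combination h1 - coordGradSq G φ (P.symm y) * h6
  · have hq := fun y hy => hode.quadratic hr hR0 ha₀ hba hΨ0 (y := y) hy
    obtain ⟨c, hc⟩ := hode.logarithm hφg hασ hq
    refine ⟨a₀, σ, c, hσ, hασ, fun y hy => ⟨?_, ?_⟩⟩
    · rw [hA2 y hy, ← (hP y hy).1 0]; exact hq _ (hmem y hy)
    · rw [← hfe y hy, hc _ (hmem y hy), (hP y hy).1 0]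
  · obtain ⟨c₀, c₁, hc, hq⟩ := hode.exponential hr hR0
    refine ⟨c₀, c₁, hc, fun y hy => ?_⟩
    rw [hA2 y hy, ← (hP y hy).1 0]; exact hq _ (hmem y hy)
  · obtain ⟨c₀, c₁, hc, hq⟩ := hode.trigonometric hr hR0
    refine ⟨c₀, c₁, hc, fun y hy => ?_⟩
    rw [hA2 y hy, ← (hP y hy).1 0]; exact hq _ (hmem y hy)

end YangPure

end

noncomputable section

namespace YangPure

open Topology Metric Set Matrix

/-! ### Passage to the manifold -/

lemma sum_smul_single (v : E4) : v = ∑ i, v i • EuclideanSpace.single i (1 : ℝ) := by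
  ext j
  simp [Finset.sum_apply, Pi.single_apply]

section Charts

variable {M : Type*} [TopologicalSpace M] [ChartedSpace E4 M] [IsManifold (𝓡 4) ∞ M]
  {g : ∀ x : M, TangentSpace (𝓡 4) x →L[ℝ] TangentSpace (𝓡 4) x →L[ℝ] ℝ} {φ : M → ℝ} {V : ℝ → ℝ}
  {e e' : OpenPartialHomeomorph M E4} {y : E4}

omit [IsManifold (𝓡 4) ∞ M] in
lemma mdifferentiableAt_chart (he : e ∈ IsManifold.maximalAtlas (𝓡 4) ∞ M) {x : M}
    (hx : x ∈ e.source) : MDifferentiableAt (𝓡 4) (𝓡 4) e x :=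
  ((contMDiffOn_of_mem_maximalAtlas he).contMDiffAt (e.open_source.mem_nhds hx)).mdifferentiableAt
    (by simp)

omit [IsManifold (𝓡 4) ∞ M] in
lemma mdifferentiableAt_chart_symm (he : e ∈ IsManifold.maximalAtlas (𝓡 4) ∞ M)
    (hy : y ∈ e.target) : MDifferentiableAt (𝓡 4) (𝓡 4) e.symm y :=
  ((contMDiffOn_symm_of_mem_maximalAtlas he).contMDiffAt
    (e.open_target.mem_nhds hy)).mdifferentiableAt (by simp)

omit [IsManifold (𝓡 4) ∞ M] in
/-- The components of a bilinear form in a chart, evaluated on linear combinations. -/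
lemma sum_chartMetric (e : OpenPartialHomeomorph M E4) (y v w : E4) :
    g (e.symm y) (mfderiv (𝓡 4) (𝓡 4) e.symm y v) (mfderiv (𝓡 4) (𝓡 4) e.symm y w)
      = ∑ a, ∑ b, v a * w b * chartMetric g e y a b := by
  set L : E4 →L[ℝ] TangentSpace (𝓡 4) (e.symm y) := mfderiv (𝓡 4) (𝓡 4) e.symm y with hL
  change g (e.symm y) (L v) (L w) = _
  conv_lhs => rw [sum_smul_single v, sum_smul_single w]
  simp only [map_sum, map_smul, _root_.sum_apply, _root_.smul_apply,
    smul_eq_mul, Finset.mul_sum]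
  rw [Finset.sum_comm]
  refine Finset.sum_congr rfl fun a _ => Finset.sum_congr rfl fun b _ => ?_
  rw [chartMetric, of_apply]
  change _ = v a * w b * g (e.symm y) (L _) (L _)
  ring

omit [IsManifold (𝓡 4) ∞ M] in
/-- Change of coordinates of the metric. -/
lemma chartMetric_eq_pullback (he' : e' ∈ IsManifold.maximalAtlas (𝓡 4) ∞ M) {F : E4 → E4}
    (hF : DifferentiableAt ℝ F y) (hFy : F y ∈ e'.target)
    (heq : e.symm =ᶠ[𝓝 y] fun z => e'.symm (F z)) :
    chartMetric g e y = pullback (chartMetric g e') F y := by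
  have h1 : mfderiv (𝓡 4) (𝓡 4) e.symm y
      = mfderiv (𝓡 4) (𝓡 4) (e'.symm ∘ F) y := heq.mfderiv_eq
  have h2 : mfderiv (𝓡 4) (𝓡 4) (e'.symm ∘ F) y
      = (mfderiv (𝓡 4) (𝓡 4) e'.symm (F y)).comp (mfderiv (𝓡 4) (𝓡 4) F y) :=
    mfderiv_comp y (mdifferentiableAt_chart_symm he' hFy) hF.mdifferentiableAt
  have h3 : mfderiv (𝓡 4) (𝓡 4) F y = fderiv ℝ F y := mfderiv_eq_fderiv
  have h4 (v : E4) : (mfderiv (𝓡 4) (𝓡 4) e.symm y v : E4)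
      = mfderiv (𝓡 4) (𝓡 4) e'.symm (F y) (fderiv ℝ F y v) := by
    rw [h1, h2, h3]; rfl
  have h5 : e.symm y = e'.symm (F y) := heq.self_of_nhds
  -- The tangent spaces at the two equal base points are different as types until the equality is
  -- eliminated.
  have h6 : ∀ {x x' : M} (_ : x = x') (v w : E4), g x v w = g x' v w := by
    rintro x _ rfl v w; rfl
  ext i j
  rw [chartMetric, of_apply]
  refine (h6 h5 _ _).trans ?_
  rw [h4, h4]
  refine (sum_chartMetric e' (F y) _ _).trans ?_
  simp only [pullback, mul_apply, transpose_apply, Finset.sum_mul]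
  rw [Finset.sum_comm]
  exact Finset.sum_congr rfl fun a _ => Finset.sum_congr rfl fun b _ => by
    simp only [jacobian, of_apply]; ring

omit [IsManifold (𝓡 4) ∞ M] in
-- The derivative of the chart carries a pseudo-orthonormal basis of the tangent space to the
-- columns of `Q`.
lemma exists_frame_chart (hg : IsLorentzMetric g) (he : e ∈ IsManifold.maximalAtlas (𝓡 4) ∞ M)
    (hy : y ∈ e.target) :
    ∃ Q : Matrix (Fin 4) (Fin 4) ℝ, Qᵀ * chartMetric g e y * Q = Matrix.diagonal ![-1, 1, 1, 1] := by
  obtain ⟨v, hv⟩ := hg.lorentz (e.symm y)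
  have hx : e.symm y ∈ e.source := e.map_target hy
  set L : TangentSpace (𝓡 4) (e.symm y) →L[ℝ] E4 := mfderiv (𝓡 4) (𝓡 4) e (e.symm y) with hL
  have hid (w : TangentSpace (𝓡 4) (e.symm y)) : mfderiv (𝓡 4) (𝓡 4) e.symm y (L w) = w := by
    have h1 : mfderiv (𝓡 4) (𝓡 4) (e.symm ∘ e) (e.symm y)
        = (mfderiv (𝓡 4) (𝓡 4) e.symm (e (e.symm y))).comp
          (mfderiv (𝓡 4) (𝓡 4) e (e.symm y)) :=
      mfderiv_comp _ (by rw [e.right_inv hy]; exact mdifferentiableAt_chart_symm he hy)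
        (mdifferentiableAt_chart he hx)
    have h2 : (e.symm ∘ e) =ᶠ[𝓝 (e.symm y)] id :=
      Filter.eventuallyEq_of_mem (e.open_source.mem_nhds hx) fun z hz => e.left_inv hz
    rw [h2.mfderiv_eq, mfderiv_id, e.right_inv hy] at h1
    exact (congrArg (fun T : E4 →L[ℝ] E4 => T w) h1).symm
  refine ⟨of fun a j => L (v j) a, ?_⟩
  ext i j
  have h1 := sum_chartMetric (g := g) e y (L (v i)) (L (v j))
  have h2 : g (e.symm y) (mfderiv (𝓡 4) (𝓡 4) e.symm y (L (v i)))
      (mfderiv (𝓡 4) (𝓡 4) e.symm y (L (v j))) = g (e.symm y) (v i) (v j) := by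
    rw [hid, hid]
  rw [h2] at h1
  have h3 := hv i j
  simp only [mul_apply, transpose_apply, Finset.sum_mul, of_apply]
  rw [Finset.sum_comm]
  calc _ = ∑ a, ∑ b, L (v i) a * L (v j) b * chartMetric g e y a b :=
        Finset.sum_congr rfl fun a _ => Finset.sum_congr rfl fun b _ => by ring
    _ = g (e.symm y) (v i) (v j) := h1.symm
    _ = _ := h3
    _ = _ := by fin_cases i <;> fin_cases j <;> simp [Matrix.diagonal]

omit [IsManifold (𝓡 4) ∞ M] in
lemma isMetricOn_chart (hg : IsLorentzMetric g) (he : e ∈ IsManifold.maximalAtlas (𝓡 4) ∞ M) :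
    IsMetricOn (chartMetric g e) e.target where
  isOpen := e.open_target
  smooth i j := hg.smooth e he i j
  symm y _ i j := hg.symm _ _ _
  det_ne_zero y hy h := by
    obtain ⟨Q, hQ⟩ := exists_frame_chart hg he hy
    have := congrArg det hQ
    rw [det_mul, det_mul, h] at this
    simp [det_diagonal, Fin.prod_univ_four] at this

omit [IsManifold (𝓡 4) ∞ M] in
lemma contDiffOn_field_chart (he : e ∈ IsManifold.maximalAtlas (𝓡 4) ∞ M)
    (hφ : ContMDiff (𝓡 4) 𝓘(ℝ, ℝ) ∞ φ) : ContDiffOn ℝ ∞ (fun z => φ (e.symm z)) e.target :=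
  contMDiffOn_iff_contDiffOn.1 (hφ.comp_contMDiffOn (contMDiffOn_symm_of_mem_maximalAtlas he))

omit [IsManifold (𝓡 4) ∞ M] in
/-- `∇ₐφ∇ᵃφ` does not depend on the coordinates. -/
lemma coordGradSq_chart_eq (hg : IsLorentzMetric g) (hφ : ContMDiff (𝓡 4) 𝓘(ℝ, ℝ) ∞ φ)
    (he : e ∈ IsManifold.maximalAtlas (𝓡 4) ∞ M) (he' : e' ∈ IsManifold.maximalAtlas (𝓡 4) ∞ M)
    {x : M} (hx : x ∈ e.source) (hx' : x ∈ e'.source) :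
    coordGradSq (chartMetric g e) (fun z => φ (e.symm z)) (e x)
      = coordGradSq (chartMetric g e') (fun z => φ (e'.symm z)) (e' x) := by
  set F : E4 → E4 := fun z => e' (e.symm z) with hFdef
  have hy : e x ∈ e.target := e.map_source hx
  have hFy : F (e x) = e' x := by rw [hFdef]; beta_reduce; rw [e.left_inv hx]
  have hF : DifferentiableAt ℝ F (e x) := by
    have h1 : MDifferentiableAt (𝓡 4) (𝓡 4) (e' ∘ e.symm) (e x) :=
      MDifferentiableAt.comp (e x) (by rw [e.left_inv hx]; exact mdifferentiableAt_chart he' hx')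
        (mdifferentiableAt_chart_symm he hy)
    exact mdifferentiableAt_iff_differentiableAt.1 h1
  have heq : e.symm =ᶠ[𝓝 (e x)] fun z => e'.symm (F z) := by
    have h1 : e.symm ⁻¹' e'.source ∈ 𝓝 (e x) := (e.symm.continuousAt hy).preimage_mem_nhds
      (e'.open_source.mem_nhds (by rwa [e.left_inv hx]))
    exact Filter.eventuallyEq_of_mem h1 fun z hz => (e'.left_inv hz).symm
  have hG := chartMetric_eq_pullback (g := g) he' hF (by rw [hFy]; exact e'.map_source hx') heq
  have hm := (isMetricOn_chart hg he).det_ne_zero _ hy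
  have hm' := (isMetricOn_chart hg he').det_ne_zero _ (e'.map_source hx')
  have hgrad : HasGrad (fun z => φ (e'.symm z)) (fun a => pd a (fun z => φ (e'.symm z)) (e' x))
      (F (e x)) := by
    rw [hFy]
    exact (contDiffOn_field_chart he' hφ).hasGrad e'.open_target (e'.map_source hx')
  have hpd (i) := ((hgrad.comp_map hF).congr_of_eventuallyEq (g := fun z => φ (e.symm z))
    (heq.mono fun z hz => congrArg φ hz)).2 i
  rw [pullback, hFy] at hG
  set J := jacobian F (e x)
  have hJ : IsUnit J.det := by
    rw [hG, det_mul] at hm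
    exact (right_ne_zero_of_mul hm).isUnit
  have hJt : IsUnit Jᵀ.det := by rwa [det_transpose]
  rw [← ScalarYangOn.ip_grad_grad, ← ScalarYangOn.ip_grad_grad, ip_eq_dotProduct,
    ip_eq_dotProduct, hG]
  have hv : (fun a => pd a (fun z => φ (e.symm z)) (e x))
      = Jᵀ *ᵥ fun a => pd a (fun z => φ (e'.symm z)) (e' x) := by
    ext i
    rw [hpd i]; rfl
  rw [hv, Matrix.mul_inv_rev, Matrix.mul_inv_rev, mulVec_mulVec, Matrix.mul_assoc,
    Matrix.mul_assoc, nonsing_inv_mul _ hJt, Matrix.mul_one, mulVec_transpose,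
    ← dotProduct_mulVec, mulVec_mulVec, ← Matrix.mul_assoc, mul_nonsing_inv _ hJ, Matrix.one_mul]

lemma scalarYangOn_chart (hg : IsYangPureSpace g) (hφ : ContMDiff (𝓡 4) 𝓘(ℝ, ℝ) ∞ φ)
    (hsource : IsGeneratedByScalarField g V φ) (hgrad : ∀ p : M, gradSq g φ p ≠ 0)
    (he : e ∈ IsManifold.maximalAtlas (𝓡 4) ∞ M) :
    ScalarYangOn (chartMetric g e) (fun z => φ (e.symm z)) (fun z => V (φ (e.symm z))) e.target where
  toIsMetricOn := isMetricOn_chart hg.toIsLorentzMetric he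
  lorentz y hy := exists_frame_chart hg.toIsLorentzMetric he hy
  field := contDiffOn_field_chart he hφ
  einstein y hy a b := hsource e he y hy a b
  yang y hy a b c := hg.yang e he y hy a b c
  grad_ne_zero y hy := by
    have h1 := coordGradSq_chart_eq hg.toIsLorentzMetric hφ he
      (IsManifold.chart_mem_maximalAtlas (e.symm y)) (e.map_target hy) (mem_chart_source E4 _)
    rw [e.right_inv hy] at h1
    rw [h1]
    exact hgrad (e.symm y)

/-- Coordinate invariance of the scalar curvature without the transformation law of the Riemann
tensor: R = N - 4W in every chart, and N and W are invariant. -/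
lemma scalarCurvature_eq (hg : IsYangPureSpace g) (hφ : ContMDiff (𝓡 4) 𝓘(ℝ, ℝ) ∞ φ)
    (hsource : IsGeneratedByScalarField g V φ) (hgrad : ∀ p : M, gradSq g φ p ≠ 0)
    (he : e ∈ IsManifold.maximalAtlas (𝓡 4) ∞ M) {x : M} (hx : x ∈ e.source) :
    scalarCurvature g x = coordScalar (chartMetric g e) (e x) := by
  have h0 := IsManifold.chart_mem_maximalAtlas (I := 𝓡 4) (n := ∞) x
  have hx0 := mem_chart_source E4 x
  rw [scalarCurvature, (scalarYangOn_chart hg hφ hsource hgrad he).scalar_eq (e.map_source hx),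
    (scalarYangOn_chart hg hφ hsource hgrad h0).scalar_eq (mem_chart_target E4 x),
    coordGradSq_chart_eq hg.toIsLorentzMetric hφ he h0 hx hx0, e.left_inv hx,
    (chartAt E4 x).left_inv hx0]

lemma isLocallyConstant_scalarCurvature (hg : IsYangPureSpace g)
    (hφ : ContMDiff (𝓡 4) 𝓘(ℝ, ℝ) ∞ φ) (hsource : IsGeneratedByScalarField g V φ)
    (hgrad : ∀ p : M, gradSq g φ p ≠ 0) : IsLocallyConstant (scalarCurvature g) := by
  rw [IsLocallyConstant.iff_eventually_eq]
  intro p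
  have h0 := IsManifold.chart_mem_maximalAtlas (I := 𝓡 4) (n := ∞) p
  have h := scalarYangOn_chart hg hφ hsource hgrad h0
  obtain ⟨r, hr, hball⟩ := Metric.isOpen_iff.1 h.isOpen _ (mem_chart_target E4 p)
  have h1 : chartAt E4 p ⁻¹' ball (chartAt E4 p p) r ∈ 𝓝 p :=
    ((chartAt E4 p).continuousAt (mem_chart_source E4 p)).preimage_mem_nhds
      (isOpen_ball.mem_nhds (mem_ball_self hr))
  filter_upwards [h1, (chartAt E4 p).open_source.mem_nhds (mem_chart_source E4 p)] with q hq hqs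
  rw [scalarCurvature_eq hg hφ hsource hgrad h0 hqs, scalarCurvature]
  exact eq_of_hasGrad_zero (fun z hz => h.hasGrad_scalar (hball hz)) hq (mem_ball_self hr)

/-- A Yang pure space with a scalar field source has coordinates in normal form. -/
theorem exists_normal_coordinates (hg : IsYangPureSpace g)
    (hφ : ContMDiff (𝓡 4) 𝓘(ℝ, ℝ) ∞ φ) (hsource : IsGeneratedByScalarField g V φ)
    (hgrad : ∀ p : M, gradSq g φ p ≠ 0) (p : M) :
    ∃ e ∈ IsManifold.maximalAtlas (𝓡 4) ∞ M, p ∈ e.source ∧ ∃ (k a : ℝ) (A f : ℝ → ℝ),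
      IsNormalForm (Real.sign (gradSq g φ p)) (scalarCurvature g p) k a A f (chartMetric g e)
        (fun y => φ (e.symm y)) (fun y => V (φ (e.symm y))) e.target := by
  have h0 := IsManifold.chart_mem_maximalAtlas (I := 𝓡 4) (n := ∞) p
  have h := scalarYangOn_chart hg hφ hsource hgrad h0
  set e₀ := chartAt E4 p
  obtain ⟨P, hPD, hpP, hPs, hPi, k, a, A, f, hN⟩ :=
    h.exists_normal_chart (mem_chart_target E4 p) (ε := Real.sign (gradSq g φ p)) rfl
      (R := scalarCurvature g p) rfl
  -- No point of the target is lost, as the source of `P` lies in the target of the original chart.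
  have htarget : (e₀ ≫ₕ P).target = P.target := by
    rw [OpenPartialHomeomorph.trans_target]
    exact inter_eq_left.2 fun y hy => hPD (P.map_target hy)
  have hsource' : (e₀ ≫ₕ P).source ⊆ e₀.source := by
    rw [OpenPartialHomeomorph.trans_source]; exact inter_subset_left
  have hmem : e₀ ≫ₕ P ∈ IsManifold.maximalAtlas (𝓡 4) ∞ M := by
    refine OpenPartialHomeomorph.mem_maximalAtlas_of_contMDiffOn _ ?_ ?_
    · exact (contMDiffOn_iff_contDiffOn.2 hPs).comp
        ((contMDiffOn_of_mem_maximalAtlas h0).mono hsource') fun x hx => by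
          rw [OpenPartialHomeomorph.trans_source] at hx; exact hx.2
    · rw [htarget]
      exact (contMDiffOn_symm_of_mem_maximalAtlas h0).comp (contMDiffOn_iff_contDiffOn.2 hPi)
        fun y hy => hPD (P.map_target hy)
  refine ⟨e₀ ≫ₕ P, hmem, by
    rw [OpenPartialHomeomorph.trans_source]; exact ⟨mem_chart_source E4 p, hpP⟩, k, a, A, f, ?_⟩
  rw [htarget]
  have hmetric : ∀ y ∈ P.target,
      chartMetric g (e₀ ≫ₕ P) y = pullback (chartMetric g e₀) P.symm y := fun y hy =>
    chartMetric_eq_pullback h0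
      ((hPi.contDiffAt (P.open_target.mem_nhds hy)).differentiableAt (by simp))
      (hPD (P.map_target hy)) (Filter.Eventually.of_forall fun z => rfl)
  exact { hN with metric := fun y hy => (hmetric y hy).trans (hN.metric y hy) }

end Charts

end YangPure

end

theorem mainTheorem8 {M : Type*} [TopologicalSpace M] [ChartedSpace YangPure.E4 M]
    [IsManifold (𝓡 4) ∞ M]
    (g : ∀ x : M, TangentSpace (𝓡 4) x →L[ℝ] TangentSpace (𝓡 4) x →L[ℝ] ℝ)
    (hg : YangPure.IsYangPureSpace g)
    (V : ℝ → ℝ) (φ : M → ℝ) (hφ : ContMDiff (𝓡 4) 𝓘(ℝ, ℝ) ∞ φ)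
    (hsource : YangPure.IsGeneratedByScalarField g V φ)
    (hgrad : ∀ p : M, YangPure.gradSq g φ p ≠ 0) :
    IsLocallyConstant (YangPure.scalarCurvature g) ∧
    ∀ (p : M) (ε R : ℝ), ε = Real.sign (YangPure.gradSq g φ p) →
      R = YangPure.scalarCurvature g p →
      ∃ e ∈ IsManifold.maximalAtlas (𝓡 4) ∞ M, p ∈ e.source ∧
      ∃ (k a : ℝ) (A f : ℝ → ℝ), (k = -1 ∨ k = 0 ∨ k = 1) ∧ a ≠ 0 ∧
        -- the line element, and the scalar field and potential in terms of `A`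
        (∀ y ∈ e.target,
          0 < A (y 0) ∧
          YangPure.confFactor ε k y ≠ 0 ∧
          YangPure.chartMetric g e y = YangPure.lineElement ε k A y ∧
          φ (e.symm y) = f (y 0) ∧
          HasDerivAt f (a / A (y 0) ^ 2) (y 0) ∧
          V (φ (e.symm y)) = ε * a ^ 2 / (4 * A (y 0) ^ 4) - R / 4) ∧
        -- the function `A²`, the constant `a`, and for `R = 0` the scalar field
        (R = 0 → ∃ a₀ σ c : ℝ, (σ = 1 ∨ σ = -1) ∧ a = σ * a₀ ∧
          ∀ y ∈ e.target,
            A (y 0) ^ 2 = ε * k * y 0 ^ 2 + a₀ * y 0 ∧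
            f (y 0) = σ * Real.log |y 0 / (ε * k * y 0 + a₀)| + c) ∧
        (0 < -(ε * R) → ∃ a₀ a₁ : ℝ,
          a ^ 2 = -(12 * ε * k ^ 2 / R) + 4 / 3 * ε * R * (a₀ * a₁) ∧
          ∀ y ∈ e.target,
            A (y 0) ^ 2 = 6 * k / R + a₀ * Real.exp (Real.sqrt (-(ε * R) / 3) * y 0)
              + a₁ * Real.exp (-(Real.sqrt (-(ε * R) / 3) * y 0))) ∧
        (0 < ε * R → ∃ b₀ b₁ : ℝ,
          a ^ 2 = -(12 * ε * k ^ 2 / R) + 1 / 3 * ε * R * (b₀ ^ 2 + b₁ ^ 2) ∧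
          ∀ y ∈ e.target,
            A (y 0) ^ 2 = 6 * k / R + b₀ * Real.cos (Real.sqrt (ε * R / 3) * y 0)
              + b₁ * Real.sin (Real.sqrt (ε * R / 3) * y 0)) := by
  refine ⟨YangPure.isLocallyConstant_scalarCurvature hg hφ hsource hgrad, ?_⟩
  rintro p ε R rfl rfl
  obtain ⟨e, he, hp, k, a, A, f, hN⟩ := YangPure.exists_normal_coordinates hg hφ hsource hgrad p
  exact ⟨e, he, hp, k, a, A, f, hN.curv, hN.ne_zero,
    fun y hy => ⟨hN.pos y hy, hN.factor_ne_zero y hy, hN.metric y hy, hN.field y hy,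
      hN.hasDerivAt y hy, hN.potential y hy⟩, hN.of_eq_zero, hN.of_neg, hN.of_pos⟩
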